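/- Let $M$ be a filtered manifold: a smooth manifold with a filtration $TM=T^{-k}M\supseteq\dots\supseteq T^{-1}M\supseteq T^0M=0$ by smooth subbundles (with $T^{j}M=TM$ for $j\le -k$) such that the Lie bracket of a section of $T^{i}M$ and a section of $T^{j}M$ is a section of $T^{i+j}M$. Put $\mathrm{gr}_{-i}(T_xM)=T^{-i}_xM/T^{-i+1}_xM$ and assume that for every $x\in M$ the graded Lie algebra $\mathrm{gr}(T_xM)=\bigoplus_i\mathrm{gr}_{-i}(T_xM)$, with the bracket induced by the Lie bracket of vector fields, is generated by $\mathrm{gr}_{-1}(T_xM)$. Let $E\to M$ be a smooth real vector bundle of finite rank and let $r\ge 0$. A linear differential operator on functions is of weighted order $\le r$ if it is locally a finite sum of operators $c\,\xi_1\cdots\xi_\ell$ with $c$ a smooth function and $\xi_j$ local sections of $T^{-w_j}M$, $w_j\geq 1$, $w_1+\dots+w_\ell\le r$. For a vector bundle $V\to M$, the space $J^r_x(V)$ of weighted jets is the quotient of the space of germs at $x$ of smooth sections of $V$ by the subspace of those $s$ with $D(\langle\lambda,s\rangle)(x)=0$ for all differential operators $D$ of weighted order $\le r$ and all local sections $\lambda$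 of $V^*$; write $j^r_xs$ for the class of $s$. The spaces $J^r_x(V)$ form a smooth vector bundle $J^r(V)$, whose smooth sections are locally the finite sums $\sum f_i\,j^rs_i$ with $f_i$ smooth functions and $s_i$ smooth sections of $V$; let $\pi^r_q:J^r(V)\to J^q(V)$, $q\le r$, be the projections, where $J^0(V)=V$. There is an isomorphism $\iota:\mathrm{gr}_{-1}(TM)^*\otimes V\to\ker(\pi^1_0)\subseteq J^1(V)$, $\iota(\alpha\otimes v)=j^1_x(fs)$, where $f(x)=0$, $df(x)=\alpha$ on $\mathrm{gr}_{-1}(T_xM)$ and $s(x)=v$. A differential operator of weighted order one (that is, of weighted order at most one) from $V$ to $W$ is a vector bundle map $\phi:J^1(V)\to W$; its symbol is the bundle map $\sigma(\phi)=\phi\circ\iota:\mathrm{gr}_{-1}(TM)^*\otimes V\to W$. **Proposition.** There is a vector bundle map $p_1(\mathrm{id}_r):J^{r+1}(E)\to J^1(J^r(E))$ with $p_1(\mathrm{id}_r)(j^{r+1}_xs)=j^1_x(j^rs)$ for all local sections $s$ of $E$, and it is injective on every fibre. Let $W^r$ be the quotient of $\mathrm{gr}_{-1}(TM)^*\otimes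 J^r(E)$ by the subbundle of all $a$ with $\iota(a)\in p_1(\mathrm{id}_r)(\ker\pi^{r+1}_r)$, where $\pi^{r+1}_r:J^{r+1}(E)\to J^r(E)$; this is a smooth vector bundle. Then there is a unique differential operator $\delta^r:J^1(J^r(E))\to W^r$ of weighted order one such that - the kernel of $\delta^r$ is $p_1(\mathrm{id}_r)(J^{r+1}(E))\cong J^{r+1}(E)$, and - the symbol $\sigma(\delta^r):\mathrm{gr}_{-1}(TM)^*\otimes J^r(E)\to W^r$ is the canonical projection. -/

import Mathlib

set_option linter.unusedSectionVars false

open Set Filter Topology Bundle Manifold TensorProduct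
open scoped ContDiff

namespace WeightedJet

noncomputable section

section Smooth

variable {E₀ : Type*} [NormedAddCommGroup E₀] [NormedSpace ℝ E₀]
  {H : Type*} [TopologicalSpace H] (I : ModelWithCorners ℝ E₀ H)
  {M : Type*} [TopologicalSpace M] [ChartedSpace H M]

/-- `f` is a smooth function on some neighbourhood of `x`. -/
def SmoothNear (f : M → ℝ) (x : M) : Prop :=
  ∃ U ∈ 𝓝 x, ContMDiffOn I 𝓘(ℝ, ℝ) ∞ f U

/-- `s` is a smooth section of the vector bundle `V` on some neighbourhood of `x`. -/
def SmoothSectionNear (F : Type*) [NormedAddCommGroup F] [NormedSpace ℝ F]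
    {V : M → Type*} [TopologicalSpace (TotalSpace F V)] [∀ x, TopologicalSpace (V x)]
    [FiberBundle F V] (s : ∀ y, V y) (x : M) : Prop :=
  ∃ U ∈ 𝓝 x, ContMDiffOn I (I.prod 𝓘(ℝ, F)) ∞ (fun y => TotalSpace.mk' F y (s y)) U

/-- `X` is a smooth vector field on some neighbourhood of `x`. -/
def SmoothFieldNear [IsManifold I 1 M] (X : ∀ y : M, TangentSpace I y) (x : M) : Prop :=
  SmoothSectionNear I E₀ X x

variable {I}

theorem SmoothNear.congr {f g : M → ℝ} {x : M} (hf : SmoothNear I f x) (h : g =ᶠ[𝓝 x] f) :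
    SmoothNear I g x := by
  obtain ⟨U, hU, hfU⟩ := hf
  exact ⟨U ∩ {y | g y = f y}, inter_mem hU h,
    (hfU.mono inter_subset_left).congr fun y hy => hy.2⟩

theorem SmoothNear.const (c : ℝ) (x : M) : SmoothNear I (fun _ : M => c) x :=
  ⟨univ, univ_mem, contMDiffOn_const⟩

theorem SmoothNear.add {f g : M → ℝ} {x : M} (hf : SmoothNear I f x) (hg : SmoothNear I g x) :
    SmoothNear I (fun y => f y + g y) x := by
  obtain ⟨U, hU, hfU⟩ := hf
  obtain ⟨W, hW, hgW⟩ := hg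
  exact ⟨U ∩ W, inter_mem hU hW, (hfU.mono inter_subset_left).add (hgW.mono inter_subset_right)⟩

theorem SmoothNear.mul {f g : M → ℝ} {x : M} (hf : SmoothNear I f x) (hg : SmoothNear I g x) :
    SmoothNear I (fun y => f y * g y) x := by
  obtain ⟨U, hU, hfU⟩ := hf
  obtain ⟨W, hW, hgW⟩ := hg
  exact ⟨U ∩ W, inter_mem hU hW, (hfU.mono inter_subset_left).mul (hgW.mono inter_subset_right)⟩

theorem SmoothNear.eventually {f : M → ℝ} {x : M} (hf : SmoothNear I f x) :
    ∀ᶠ y in 𝓝 x, SmoothNear I f y := by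
  obtain ⟨U, hU, hfU⟩ := hf
  filter_upwards [eventually_mem_nhds_iff.2 hU] with y hy
  exact ⟨U, hy, hfU⟩

theorem SmoothNear.mdifferentiableAt {f : M → ℝ} {x : M} (hf : SmoothNear I f x) :
    MDifferentiableAt I 𝓘(ℝ, ℝ) f x := by
  obtain ⟨U, hU, hfU⟩ := hf
  exact (hfU.contMDiffAt hU).mdifferentiableAt (by simp)

/-- The derivative `X · f` of the function `f` along the vector field `X`. -/
def lieDeriv (X : ∀ y : M, TangentSpace I y) (f : M → ℝ) : M → ℝ :=
  fun y => mvfderiv I f y (X y)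

theorem lieDeriv_congr {X : ∀ y : M, TangentSpace I y} {f g : M → ℝ} {x : M}
    (h : f =ᶠ[𝓝 x] g) : lieDeriv X f =ᶠ[𝓝 x] lieDeriv X g := by
  filter_upwards [eventually_eventually_nhds.2 h] with y hy
  have h1 := Filter.EventuallyEq.mfderiv_eq (I := I) (I' := 𝓘(ℝ, ℝ)) hy
  exact congrArg (fun L : E₀ →L[ℝ] ℝ => L (X y)) h1

theorem SmoothNear.lieDeriv [IsManifold I 1 M] {X : ∀ y : M, TangentSpace I y} {f : M → ℝ} {x : M}
    (hX : SmoothFieldNear I X x) (hf : SmoothNear I f x) : SmoothNear I (lieDeriv X f) x := by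
  obtain ⟨U, hU, hfU⟩ := hf
  obtain ⟨W, hW, hXW⟩ := hX
  obtain ⟨O, hOs, hO, hxO⟩ := mem_nhds_iff.1 (inter_mem hU hW)
  refine ⟨O, hO.mem_nhds hxO, ?_⟩
  have h1 := (hfU.mono (hOs.trans inter_subset_left)).contMDiffOn_tangentMapWithin
    (m := ∞) (by simp) hO.uniqueMDiffOn
  have h2 := h1.comp (hXW.mono (hOs.trans inter_subset_right)) (fun y hy => hy)
  have h3 : ContMDiffOn I 𝓘(ℝ, ℝ) ∞ (fun y => (tangentMapWithin I 𝓘(ℝ, ℝ) f O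
      (TotalSpace.mk' E₀ y (X y))).2) O := by
    intro y hy
    have := (h2 y hy)
    rw [Function.comp_def, contMDiffWithinAt_totalSpace] at this
    simpa using! this.2
  refine h3.congr fun y hy => ?_
  simp only [tangentMapWithin, mfderivWithin_of_isOpen hO hy]
  rfl

theorem lieDeriv_add {X : ∀ y : M, TangentSpace I y} {f g : M → ℝ} {x : M}
    (hf : SmoothNear I f x) (hg : SmoothNear I g x) :
    lieDeriv X (fun y => f y + g y) =ᶠ[𝓝 x] fun y => lieDeriv X f y + lieDeriv X g y := by
  filter_upwards [hf.eventually, hg.eventually] with y hy hy'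
  simp only [lieDeriv, mvfderiv_fun_add hy.mdifferentiableAt hy'.mdifferentiableAt]
  rfl

theorem lieDeriv_mul {X : ∀ y : M, TangentSpace I y} {f g : M → ℝ} {x : M}
    (hf : SmoothNear I f x) (hg : SmoothNear I g x) :
    lieDeriv X (fun y => f y * g y) x = f x * lieDeriv X g x + g x * lieDeriv X f x := by
  simp only [lieDeriv, mvfderiv_fun_mul hf.mdifferentiableAt hg.mdifferentiableAt]
  rfl

theorem lieDeriv_const_mul {X : ∀ y : M, TangentSpace I y} {g : M → ℝ} {x : M} (c : ℝ)
    (hg : SmoothNear I g x) :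
    lieDeriv X (fun y => c * g y) =ᶠ[𝓝 x] fun y => c * lieDeriv X g y := by
  filter_upwards [hg.eventually] with y hy
  rw [lieDeriv_mul (SmoothNear.const c y) hy]
  simp [lieDeriv, mvfderiv_const]

end Smooth

section Filtration

variable {E₀ : Type*} [NormedAddCommGroup E₀] [NormedSpace ℝ E₀]
  {H : Type*} [TopologicalSpace H] (I : ModelWithCorners ℝ E₀ H)
  (M : Type*) [TopologicalSpace M] [ChartedSpace H M] [IsManifold I ∞ M]

/-- The structure of a filtered manifold on `M`: a finite filtration
`TM = T⁻ᵏM ⊇ ⋯ ⊇ T⁻¹M ⊇ T⁰M = 0` of the tangent bundle by smooth subbundles which is compatible with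
the Lie bracket of vector fields. The space `T i x` is the fibre of `T⁻ⁱM` at `x`. -/
structure Filtration where
  T : ℕ → ∀ x : M, Submodule ℝ (TangentSpace I x)
  zero : ∀ x, T 0 x = ⊥
  mono : ∀ i j x, i ≤ j → T i x ≤ T j x
  exhaustive : ∃ k, ∀ x, T k x = ⊤
  subbundle : ∀ i x, ∃ (n : ℕ) (e : Fin n → ∀ y : M, TangentSpace I y),
    (∀ a, SmoothFieldNear I (e a) x) ∧
    ∀ᶠ y in 𝓝 x, LinearIndependent ℝ (fun a => e a y) ∧
      Submodule.span ℝ (range fun a => e a y) = T i y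
  bracket : ∀ i j x (X Y : ∀ y : M, TangentSpace I y),
    SmoothFieldNear I X x → (∀ᶠ y in 𝓝 x, X y ∈ T i y) →
    SmoothFieldNear I Y x → (∀ᶠ y in 𝓝 x, Y y ∈ T j y) →
    VectorField.mlieBracket I X Y x ∈ T (i + j) x

variable {I M} (𝓕 : Filtration I M)

namespace Filtration

/-- `X` is, near `x`, a smooth section of `T⁻ⁱM`, i.e. a local vector field of weighted order
at most `i`. -/
def IsSectionNear (i : ℕ) (X : ∀ y : M, TangentSpace I y) (x : M) : Prop :=
  SmoothFieldNear I X x ∧ ∀ᶠ y in 𝓝 x, X y ∈ 𝓕.T i y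

/-- The component `gr₋ᵢ(TₓM) = T⁻ⁱₓM / T⁻ⁱ⁺¹ₓM` of the associated graded of the tangent space. -/
def Gr (i : ℕ) (x : M) : Type _ :=
  𝓕.T i x ⧸ (𝓕.T (i - 1) x).submoduleOf (𝓕.T i x)

instance (i : ℕ) (x : M) : AddCommGroup (𝓕.Gr i x) :=
  inferInstanceAs (AddCommGroup (𝓕.T i x ⧸ (𝓕.T (i - 1) x).submoduleOf (𝓕.T i x)))

instance (i : ℕ) (x : M) : Module ℝ (𝓕.Gr i x) :=
  inferInstanceAs (Module ℝ (𝓕.T i x ⧸ (𝓕.T (i - 1) x).submoduleOf (𝓕.T i x)))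

/-- The class in `gr₋ᵢ(TₓM)` of an element of `T⁻ⁱₓM`. -/
def toGr (i : ℕ) (x : M) : 𝓕.T i x →ₗ[ℝ] 𝓕.Gr i x :=
  ((𝓕.T (i - 1) x).submoduleOf (𝓕.T i x)).mkQ

/-- The graded Lie algebra `gr(TₓM)` is generated by `gr₋₁(TₓM)`: a family of subspaces of the
graded components which contains `gr₋₁(TₓM)` and is closed under the bracket
`{[X(x)], [Y(x)]} = [[X, Y](x)]` (for `X`, `Y` local sections of `T⁻ⁱM` and `T⁻ʲM`) consists of
the full components. -/
def GeneratedAt (x : M) : Prop :=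
  ∀ S : ∀ i, Submodule ℝ (𝓕.Gr i x), S 1 = ⊤ →
    (∀ i j (X Y : ∀ y : M, TangentSpace I y)
      (hX : X x ∈ 𝓕.T i x) (hY : Y x ∈ 𝓕.T j x)
      (hXY : VectorField.mlieBracket I X Y x ∈ 𝓕.T (i + j) x),
      𝓕.IsSectionNear i X x → 𝓕.IsSectionNear j Y x →
      𝓕.toGr i x ⟨X x, hX⟩ ∈ S i → 𝓕.toGr j x ⟨Y x, hY⟩ ∈ S j →
      𝓕.toGr (i + j) x ⟨VectorField.mlieBracket I X Y x, hXY⟩ ∈ S (i + j)) →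
    ∀ i, S i = ⊤

/-- The iterated derivative `ξ₁ ⋯ ξₗ f` along a list of vector fields. -/
def iterDeriv : List (∀ y : M, TangentSpace I y) → (M → ℝ) → M → ℝ
  | [], f => f
  | X :: L, f => lieDeriv X (iterDeriv L f)

/-- The linear differential operators on functions, defined near `x`, of weighted order at most
`r`: the finite sums of operators `c ξ₁ ⋯ ξₗ` with `c` a smooth function and `ξ₁, …, ξₗ` local
vector fields whose weighted orders are at most `w₁, …, wₗ ≥ 1`, with `w₁ + ⋯ + wₗ ≤ r`. -/
def diffOp (r : ℕ) (x : M) : Submodule ℝ ((M → ℝ) → M → ℝ) :=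
  Submodule.span ℝ {D | ∃ (c : M → ℝ) (L : List ((∀ y : M, TangentSpace I y) × ℕ)),
    SmoothNear I c x ∧ (∀ p ∈ L, 1 ≤ p.2 ∧ 𝓕.IsSectionNear p.2 p.1 x) ∧
    (L.map Prod.snd).sum ≤ r ∧ D = fun f y => c y * iterDeriv (L.map Prod.fst) f y}

variable {𝓕}

theorem iterDeriv_congr {f g : M → ℝ} {x : M} (h : f =ᶠ[𝓝 x] g)
    (L : List (∀ y : M, TangentSpace I y)) : iterDeriv L f =ᶠ[𝓝 x] iterDeriv L g := by
  induction L with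
  | nil => exact h
  | cons X L ih => exact lieDeriv_congr ih

theorem SmoothNear.iterDeriv {f : M → ℝ} {x : M} (hf : SmoothNear I f x)
    (L : List (∀ y : M, TangentSpace I y)) (hL : ∀ X ∈ L, SmoothFieldNear I X x) :
    SmoothNear I (iterDeriv L f) x := by
  induction L with
  | nil => exact hf
  | cons X L ih =>
    exact SmoothNear.lieDeriv (hL X (by simp)) (ih fun Y hY => hL Y (by simp [hY]))

theorem iterDeriv_add {f g : M → ℝ} {x : M} (hf : SmoothNear I f x) (hg : SmoothNear I g x)
    (L : List (∀ y : M, TangentSpace I y)) (hL : ∀ X ∈ L, SmoothFieldNear I X x) :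
    iterDeriv L (fun y => f y + g y) =ᶠ[𝓝 x] fun y => iterDeriv L f y + iterDeriv L g y := by
  induction L with
  | nil => rfl
  | cons X L ih =>
    have hL' : ∀ Y ∈ L, SmoothFieldNear I Y x := fun Y hY => hL Y (by simp [hY])
    exact (lieDeriv_congr (ih hL')).trans
      (lieDeriv_add (SmoothNear.iterDeriv hf L hL') (SmoothNear.iterDeriv hg L hL'))

theorem iterDeriv_const_mul {g : M → ℝ} {x : M} (c : ℝ) (hg : SmoothNear I g x)
    (L : List (∀ y : M, TangentSpace I y)) (hL : ∀ X ∈ L, SmoothFieldNear I X x) :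
    iterDeriv L (fun y => c * g y) =ᶠ[𝓝 x] fun y => c * iterDeriv L g y := by
  induction L with
  | nil => rfl
  | cons X L ih =>
    have hL' : ∀ Y ∈ L, SmoothFieldNear I Y x := fun Y hY => hL Y (by simp [hY])
    exact (lieDeriv_congr (ih hL')).trans (lieDeriv_const_mul c (SmoothNear.iterDeriv hg L hL'))

theorem diffOp_congr {r : ℕ} {x : M} {D : (M → ℝ) → M → ℝ} (hD : D ∈ 𝓕.diffOp r x)
    {f g : M → ℝ} (h : f =ᶠ[𝓝 x] g) : D f x = D g x := by
  induction hD using Submodule.span_induction with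
  | mem D hD =>
    obtain ⟨c, L, hc, hL, hr, rfl⟩ := hD
    simp only [(iterDeriv_congr h (L.map Prod.fst)).eq_of_nhds]
  | zero => rfl
  | add D D' _ _ h1 h2 => simp only [Pi.add_apply, h1, h2]
  | smul a D _ h1 => simp only [Pi.smul_apply, h1]

theorem diffOp_add {r : ℕ} {x : M} {D : (M → ℝ) → M → ℝ} (hD : D ∈ 𝓕.diffOp r x)
    {f g : M → ℝ} (hf : SmoothNear I f x) (hg : SmoothNear I g x) :
    D (fun y => f y + g y) x = D f x + D g x := by
  induction hD using Submodule.span_induction with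
  | mem D hD =>
    obtain ⟨c, L, hc, hL, hr, rfl⟩ := hD
    have hL' : ∀ X ∈ L.map Prod.fst, SmoothFieldNear I X x := by
      intro X hX
      obtain ⟨p, hp, rfl⟩ := List.mem_map.1 hX
      exact (hL p hp).2.1
    simp only [(iterDeriv_add hf hg _ hL').eq_of_nhds, mul_add]
  | zero => simp
  | add D D' _ _ h1 h2 => simp only [Pi.add_apply, h1, h2]; ring
  | smul a D _ h1 => simp only [Pi.smul_apply, h1, smul_add]

theorem diffOp_const_mul {r : ℕ} {x : M} {D : (M → ℝ) → M → ℝ} (hD : D ∈ 𝓕.diffOp r x)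
    {g : M → ℝ} (a : ℝ) (hg : SmoothNear I g x) :
    D (fun y => a * g y) x = a * D g x := by
  induction hD using Submodule.span_induction with
  | mem D hD =>
    obtain ⟨c, L, hc, hL, hr, rfl⟩ := hD
    have hL' : ∀ X ∈ L.map Prod.fst, SmoothFieldNear I X x := by
      intro X hX
      obtain ⟨p, hp, rfl⟩ := List.mem_map.1 hX
      exact (hL p hp).2.1
    simp only [(iterDeriv_const_mul a hg _ hL').eq_of_nhds]; ring
  | zero => simp
  | add D D' _ _ h1 h2 => simp only [Pi.add_apply, h1, h2]; ring
  | smul b D _ h1 => simp only [Pi.smul_apply, h1, smul_eq_mul]; ring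

theorem diffOp_mono {r r' : ℕ} (h : r ≤ r') (x : M) : 𝓕.diffOp r x ≤ 𝓕.diffOp r' x :=
  Submodule.span_mono fun _ ⟨c, L, hc, hL, hr, hD⟩ => ⟨c, L, hc, hL, hr.trans h, hD⟩

end Filtration

end Filtration

section Sections

variable {E₀ : Type*} [NormedAddCommGroup E₀] [NormedSpace ℝ E₀]
  {H : Type*} [TopologicalSpace H] (I : ModelWithCorners ℝ E₀ H)
  {M : Type*} [TopologicalSpace M] [ChartedSpace H M]

/-- A smooth structure on a family `V` of vector spaces over `M`, given through its local sections:
`near x` consists of the sections which are defined and smooth on a neighbourhood of `x` (their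
values away from `x` are irrelevant, as `congr` shows). -/
structure SmoothSections (V : M → Type*) [∀ x, AddCommGroup (V x)] [∀ x, Module ℝ (V x)] where
  near : M → Submodule ℝ (∀ y, V y)
  congr : ∀ x s t, s ∈ near x → (∀ᶠ y in 𝓝 x, t y = s y) → t ∈ near x
  eventually : ∀ x s, s ∈ near x → ∀ᶠ y in 𝓝 x, s ∈ near y
  smul_mem : ∀ x (f : M → ℝ) s, SmoothNear I f x → s ∈ near x → (fun y => f y • s y) ∈ near x
  eval_surjective : ∀ x (v : V x), ∃ s ∈ near x, s x = v

/-- The smooth local sections of a smooth vector bundle. -/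
def bundleSections (F : Type*) [NormedAddCommGroup F] [NormedSpace ℝ F]
    (V : M → Type*) [TopologicalSpace (TotalSpace F V)] [∀ x, AddCommGroup (V x)]
    [∀ x, Module ℝ (V x)] [∀ x, TopologicalSpace (V x)] [FiberBundle F V] [VectorBundle ℝ F V]
    [ContMDiffVectorBundle ∞ F V I] : SmoothSections I V where
  near x :=
    { carrier := {s | SmoothSectionNear I F s x}
      zero_mem' := ⟨univ, univ_mem, (contMDiff_zeroSection ℝ V).contMDiffOn⟩
      add_mem' := by
        rintro s t ⟨U, hU, hs⟩ ⟨W, hW, ht⟩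
        exact ⟨U ∩ W, inter_mem hU hW,
          (hs.mono inter_subset_left).add_section (ht.mono inter_subset_right)⟩
      smul_mem' := by
        rintro c s ⟨U, hU, hs⟩
        exact ⟨U, hU, hs.const_smul_section⟩ }
  congr := by
    rintro x s t ⟨U, hU, hs⟩ h
    refine ⟨U ∩ {y | t y = s y}, inter_mem hU h, (hs.mono inter_subset_left).congr ?_⟩
    intro y hy
    rw [show t y = s y from hy.2]
  eventually := by
    rintro x s ⟨U, hU, hs⟩
    filter_upwards [eventually_mem_nhds_iff.2 hU] with y hy
    exact ⟨U, hy, hs⟩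
  smul_mem := by
    rintro x f s ⟨U, hU, hf⟩ ⟨W, hW, hs⟩
    exact ⟨U ∩ W, inter_mem hU hW,
      (hf.mono inter_subset_left).smul_section (hs.mono inter_subset_right)⟩
  eval_surjective := by
    intro x v
    obtain ⟨U, hU, h⟩ := FiberBundle.exists_contMDiffOn_extend (k := ∞) I F v
    exact ⟨FiberBundle.extend F v, ⟨U, hU, h⟩, FiberBundle.extend_apply_self F v⟩

variable {I} {V : M → Type*} [∀ x, AddCommGroup (V x)] [∀ x, Module ℝ (V x)]

/-- The smooth sections near `x` of the dual family: the families of linear functionals whose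
pairing with every smooth section is smooth. -/
def SmoothSections.dual (Γ : SmoothSections I V) (x : M) : Set (∀ y, Module.Dual ℝ (V y)) :=
  {l | ∀ s ∈ Γ.near x, SmoothNear I (fun y => l y (s y)) x}

/-- The sections which near `x` are finite linear combinations of members of `G`. -/
def locallySpanned (G : Set (∀ y, V y)) (x : M) : Submodule ℝ (∀ y, V y) where
  carrier := {s | ∃ t ∈ Submodule.span ℝ G, ∀ᶠ y in 𝓝 x, s y = t y}
  zero_mem' := ⟨0, zero_mem _, Eventually.of_forall fun _ => rfl⟩
  add_mem' := by
    rintro s s' ⟨t, ht, h⟩ ⟨t', ht', h'⟩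
    refine ⟨t + t', add_mem ht ht', ?_⟩
    filter_upwards [h, h'] with y hy hy'
    simp only [Pi.add_apply, hy, hy']
  smul_mem' := by
    rintro c s ⟨t, ht, h⟩
    refine ⟨c • t, Submodule.smul_mem _ c ht, ?_⟩
    filter_upwards [h] with y hy
    simp only [Pi.smul_apply, hy]

variable (I) in
/-- The family `V` with the local sections `near` is a smooth vector bundle of finite rank: near
every point there are finitely many sections which form a basis in every fibre, and a section is
smooth if and only if its coefficients with respect to this local frame are smooth. -/
def IsVectorBundle (near : M → Submodule ℝ (∀ y, V y)) : Prop :=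
  ∀ x, ∃ (n : ℕ) (e : Fin n → ∀ y, V y), ∃ U ∈ 𝓝 x, ∀ y ∈ U,
    LinearIndependent ℝ (fun i => e i y) ∧ Submodule.span ℝ (range fun i => e i y) = ⊤ ∧
    ∀ s, s ∈ near y ↔ ∃ c : Fin n → M → ℝ, (∀ i, SmoothNear I (c i) y) ∧
      ∀ᶠ z in 𝓝 y, s z = ∑ i, c i z • e i z

/-- A vector bundle map over the identity of `M`: a family of linear maps which takes smooth local
sections to smooth local sections. -/
structure BundleMap {V W : M → Type*} [∀ x, AddCommGroup (V x)] [∀ x, Module ℝ (V x)]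
    [∀ x, AddCommGroup (W x)] [∀ x, Module ℝ (W x)]
    (near : M → Submodule ℝ (∀ y, V y)) (near' : M → Submodule ℝ (∀ y, W y)) where
  toFun : ∀ x, V x →ₗ[ℝ] W x
  smooth : ∀ x, ∀ s ∈ near x, (fun y => toFun y (s y)) ∈ near' x

end Sections

section Jets

variable {E₀ : Type*} [NormedAddCommGroup E₀] [NormedSpace ℝ E₀]
  {H : Type*} [TopologicalSpace H] {I : ModelWithCorners ℝ E₀ H}
  {M : Type*} [TopologicalSpace M] [ChartedSpace H M] [IsManifold I ∞ M]
  {V : M → Type*} [∀ x, AddCommGroup (V x)] [∀ x, Module ℝ (V x)]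
  (𝓕 : Filtration I M) (Γ : SmoothSections I V)

/-- The local sections `s` near `x` which are `r`-equivalent to zero: `D ⟨λ, s⟩ (x) = 0` for all
differential operators `D` of weighted order at most `r` and all sections `λ` of the dual. -/
def nullJets (r : ℕ) (x : M) : Submodule ℝ (Γ.near x) where
  carrier := {s | ∀ D ∈ 𝓕.diffOp r x, ∀ l ∈ Γ.dual x, D (fun y => l y (s.1 y)) x = 0}
  zero_mem' := by
    intro D hD l hl
    have := Filtration.diffOp_const_mul hD 0 (SmoothNear.const 0 x)
    simpa using this
  add_mem' := by
    intro s t hs ht D hD l hl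
    have := Filtration.diffOp_add hD (hl s.1 s.2) (hl t.1 t.2)
    rw [hs D hD l hl, ht D hD l hl] at this
    simpa using this
  smul_mem' := by
    intro c s hs D hD l hl
    have := Filtration.diffOp_const_mul hD c (hl s.1 s.2)
    rw [hs D hD l hl] at this
    simpa using this

/-- The space `Jʳₓ(V)` of weighted jets of order `r` with source `x`. -/
def Jet (r : ℕ) (x : M) : Type _ := Γ.near x ⧸ nullJets 𝓕 Γ r x

instance (r : ℕ) (x : M) : AddCommGroup (Jet 𝓕 Γ r x) :=
  inferInstanceAs (AddCommGroup (Γ.near x ⧸ nullJets 𝓕 Γ r x))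

instance (r : ℕ) (x : M) : Module ℝ (Jet 𝓕 Γ r x) :=
  inferInstanceAs (Module ℝ (Γ.near x ⧸ nullJets 𝓕 Γ r x))

/-- The jet `jʳₓ s` of a local section `s` near `x`. -/
def jetAt (r : ℕ) (x : M) : Γ.near x →ₗ[ℝ] Jet 𝓕 Γ r x := (nullJets 𝓕 Γ r x).mkQ

variable {𝓕 Γ} in
theorem jetAt_eq_zero_iff {r : ℕ} {x : M} {s : Γ.near x} :
    jetAt 𝓕 Γ r x s = 0 ↔ s ∈ nullJets 𝓕 Γ r x := Submodule.Quotient.mk_eq_zero _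

variable {𝓕 Γ} in
theorem jetAt_surjective (r : ℕ) (x : M) : Function.Surjective (jetAt 𝓕 Γ r x) :=
  Submodule.mkQ_surjective _

variable {𝓕 Γ} in
theorem jetAt_congr {r : ℕ} {x : M} {s t : Γ.near x} (h : ∀ᶠ y in 𝓝 x, s.1 y = t.1 y) :
    jetAt 𝓕 Γ r x s = jetAt 𝓕 Γ r x t := by
  rw [← sub_eq_zero, ← map_sub, jetAt_eq_zero_iff]
  intro D hD l hl
  have h0 : (fun y => l y ((s - t).1 y)) =ᶠ[𝓝 x] fun _ => 0 := by
    filter_upwards [h] with y hy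
    simp [hy]
  rw [Filtration.diffOp_congr hD h0]
  simpa using Filtration.diffOp_const_mul hD 0 (SmoothNear.const 0 x)

/-- The natural projection `πʳ_q : Jʳₓ(V) → J^q_x(V)` for `q ≤ r`. -/
def jetProj {q r : ℕ} (h : q ≤ r) (x : M) : Jet 𝓕 Γ r x →ₗ[ℝ] Jet 𝓕 Γ q x :=
  (nullJets 𝓕 Γ r x).liftQ (jetAt 𝓕 Γ q x) fun _ hs =>
    jetAt_eq_zero_iff.2 fun D hD l hl => hs D (Filtration.diffOp_mono h x hD) l hl

open Classical in
/-- The section `jʳ s : y ↦ jʳ_y s` of the jets (zero where `s` is not smooth). -/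
def jetSection (r : ℕ) (s : ∀ y, V y) : ∀ y, Jet 𝓕 Γ r y :=
  fun y => if h : s ∈ Γ.near y then jetAt 𝓕 Γ r y ⟨s, h⟩ else 0

variable {𝓕 Γ} in
theorem jetSection_of_mem {r : ℕ} {s : ∀ y, V y} {y : M} (h : s ∈ Γ.near y) :
    jetSection 𝓕 Γ r s y = jetAt 𝓕 Γ r y ⟨s, h⟩ := dif_pos h

/-- The jet bundle `Jʳ(V)` with its smooth structure: the smooth local sections are the finite
sums `∑ fᵢ jʳ sᵢ` with `fᵢ` smooth functions and `sᵢ` smooth local sections of `V`. -/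
def jetBundle (r : ℕ) : SmoothSections I (Jet 𝓕 Γ r) where
  near x := locallySpanned {σ | ∃ (f : M → ℝ) (s : ∀ y, V y), SmoothNear I f x ∧ s ∈ Γ.near x ∧
    σ = fun y => f y • jetSection 𝓕 Γ r s y} x
  congr := by
    rintro x s t ⟨u, hu, h⟩ h'
    refine ⟨u, hu, ?_⟩
    filter_upwards [h, h'] with y hy hy'
    rw [hy', hy]
  eventually := by
    rintro x s ⟨u, hu, h⟩
    suffices h1 : ∀ᶠ y in 𝓝 x, u ∈ Submodule.span ℝ {σ | ∃ (f : M → ℝ) (s : ∀ y, V y),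
        SmoothNear I f y ∧ s ∈ Γ.near y ∧ σ = fun y => f y • jetSection 𝓕 Γ r s y} by
      filter_upwards [h1, eventually_eventually_nhds.2 h] with y hy hy'
      exact ⟨u, hy, hy'⟩
    clear h
    induction hu using Submodule.span_induction with
    | mem σ hσ =>
      obtain ⟨f, s, hf, hs, rfl⟩ := hσ
      filter_upwards [hf.eventually, Γ.eventually x s hs] with y hy hy'
      exact Submodule.subset_span ⟨f, s, hy, hy', rfl⟩
    | zero => exact Eventually.of_forall fun y => zero_mem _
    | add a b _ _ ha hb =>
      filter_upwards [ha, hb] with y hy hy'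
      exact add_mem hy hy'
    | smul c a _ ha =>
      filter_upwards [ha] with y hy
      exact Submodule.smul_mem _ c hy
  smul_mem := by
    rintro x g s hg ⟨u, hu, h⟩
    refine ⟨fun y => g y • u y, ?_, ?_⟩
    · clear h
      induction hu using Submodule.span_induction with
      | mem σ hσ =>
        obtain ⟨f, s, hf, hs, rfl⟩ := hσ
        exact Submodule.subset_span ⟨fun y => g y * f y, s, hg.mul hf, hs, by
          funext y; rw [mul_smul]⟩
      | zero =>
        have h0 : (fun y => g y • (0 : ∀ y, Jet 𝓕 Γ r y) y) = 0 := funext fun y => smul_zero _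
        rw [h0]
        exact zero_mem _
      | add a b _ _ ha hb =>
        convert! add_mem ha hb using 1
        funext y
        simp
      | smul c a _ ha =>
        convert! Submodule.smul_mem _ c ha using 1
        funext y
        exact smul_comm (g y) c (a y)
    · filter_upwards [h] with y hy
      rw [hy]
  eval_surjective := by
    intro x v
    obtain ⟨⟨s, hs⟩, rfl⟩ := jetAt_surjective r x v
    refine ⟨jetSection 𝓕 Γ r s, ⟨_, Submodule.subset_span ⟨fun _ => 1, s, SmoothNear.const 1 x, hs,
      rfl⟩, ?_⟩, jetSection_of_mem hs⟩
    exact Eventually.of_forall fun y => by simp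

variable {𝓕 Γ} in
theorem jetSection_mem {r : ℕ} {x : M} {s : ∀ y, V y} (hs : s ∈ Γ.near x) :
    jetSection 𝓕 Γ r s ∈ (jetBundle 𝓕 Γ r).near x :=
  ⟨_, Submodule.subset_span ⟨fun _ => 1, s, SmoothNear.const 1 x, hs, rfl⟩,
    Eventually.of_forall fun y => by simp⟩

/-- The linear map `s ↦ j¹ₓ(jʳ s)`, from local sections of `V` near `x` to `J¹ₓ(Jʳ(V))`. -/
def iteratedJetAt (r : ℕ) (x : M) : Γ.near x →ₗ[ℝ] Jet 𝓕 (jetBundle 𝓕 Γ r) 1 x where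
  toFun s := jetAt 𝓕 (jetBundle 𝓕 Γ r) 1 x ⟨jetSection 𝓕 Γ r s.1, jetSection_mem s.2⟩
  map_add' s t := by
    rw [← map_add]
    refine jetAt_congr ?_
    filter_upwards [Γ.eventually x _ s.2, Γ.eventually x _ t.2, Γ.eventually x _ (s + t).2]
      with y hs ht hst
    change jetSection 𝓕 Γ r (s + t).1 y = jetSection 𝓕 Γ r s.1 y + jetSection 𝓕 Γ r t.1 y
    rw [jetSection_of_mem hs, jetSection_of_mem ht, jetSection_of_mem hst, ← map_add]
    rfl
  map_smul' c s := by
    rw [RingHom.id_apply, ← map_smul]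
    refine jetAt_congr ?_
    filter_upwards [Γ.eventually x _ s.2, Γ.eventually x _ (c • s).2] with y hs hcs
    change jetSection 𝓕 Γ r (c • s).1 y = c • jetSection 𝓕 Γ r s.1 y
    rw [jetSection_of_mem hs, jetSection_of_mem hcs, ← map_smul]
    rfl

end Jets

section Symbol

variable {E₀ : Type*} [NormedAddCommGroup E₀] [NormedSpace ℝ E₀]
  {H : Type*} [TopologicalSpace H] {I : ModelWithCorners ℝ E₀ H}
  {M : Type*} [TopologicalSpace M] [ChartedSpace H M] [IsManifold I ∞ M]
  (𝓕 : Filtration I M)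

/-- The restriction of the differential `df(x)` to `gr₋₁(TₓM) = T⁻¹ₓM / 0`. -/
def grDifferential (x : M) (f : M → ℝ) : Module.Dual ℝ (𝓕.Gr 1 x) :=
  Submodule.liftQ ((𝓕.T (1 - 1) x).submoduleOf (𝓕.T 1 x)) ((mvfderiv I f x).toLinearMap ∘ₗ (𝓕.T 1 x).subtype) (by
    intro v hv
    have hv' : (v : TangentSpace I x) ∈ 𝓕.T (1 - 1) x := hv
    rw [Nat.sub_self, 𝓕.zero, Submodule.mem_bot] at hv'
    simp [hv'])

theorem grDifferential_toGr (x : M) (f : M → ℝ) (v : 𝓕.T 1 x) :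
    grDifferential 𝓕 x f (𝓕.toGr 1 x v) = mvfderiv I f x v := rfl

/-- Every element of `gr₋₁(TₓM)*` is the restricted differential of a function vanishing at `x`,
which can be chosen to depend linearly on it. -/
theorem exists_linear_potential [FiniteDimensional ℝ E₀] (x : M) :
    ∃ R : Module.Dual ℝ (𝓕.Gr 1 x) →ₗ[ℝ] M → ℝ, ∀ α,
      SmoothNear I (R α) x ∧ R α x = 0 ∧ grDifferential 𝓕 x (R α) = α := by
  obtain ⟨C, hC⟩ := Submodule.exists_isCompl (𝓕.T 1 x)
  have : FiniteDimensional ℝ (TangentSpace I x) := inferInstanceAs (FiniteDimensional ℝ E₀)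
  let A := mfderiv I 𝓘(ℝ, E₀) (extChartAt I x) x
  have hA : A.IsInvertible := isInvertible_mfderiv_extChartAt (mem_extChartAt_source x)
  let P : E₀ →ₗ[ℝ] 𝓕.Gr 1 x :=
    𝓕.toGr 1 x ∘ₗ (𝓕.T 1 x).projectionOnto C hC ∘ₗ A.inverse.toLinearMap
  let R : Module.Dual ℝ (𝓕.Gr 1 x) →ₗ[ℝ] M → ℝ :=
    { toFun := fun α y => α (P (extChartAt I x y - extChartAt I x x))
      map_add' := fun _ _ => rfl
      map_smul' := fun _ _ => rfl }
  refine ⟨R, fun α => ?_⟩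
  let l : E₀ →L[ℝ] ℝ := LinearMap.toContinuousLinearMap (α ∘ₗ P)
  have hR : R α = fun y => l (extChartAt I x y) - l (extChartAt I x x) := by
    funext y
    change α (P _) = α (P _) - α (P _)
    rw [map_sub, map_sub]
  refine ⟨?_, by rw [hR]; simp, ?_⟩
  · rw [hR]
    refine ⟨_, (chartAt H x).open_source.mem_nhds (mem_chart_source H x), ?_⟩
    exact (l.contMDiff.comp_contMDiffOn contMDiffOn_extChartAt).sub contMDiffOn_const
  · refine LinearMap.ext fun w => ?_
    obtain ⟨v, rfl⟩ := Submodule.mkQ_surjective _ w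
    have h1 : HasMFDerivAt I 𝓘(ℝ, ℝ) (R α) x (l ∘L A) := by
      rw [hR]
      have h2 : HasMFDerivAt I 𝓘(ℝ, ℝ) (fun y => l (extChartAt I x y)) x (l ∘L A) :=
        l.hasMFDerivAt.comp x
          (mdifferentiableAt_extChartAt (mem_chart_source H x)).hasMFDerivAt
      have h6 := h2.sub (hasMFDerivAt_const (I := I) (I' := 𝓘(ℝ, ℝ)) (l (extChartAt I x x)) x)
      have h7 : (l.comp (show E₀ →L[ℝ] E₀ from A)) - (0 : E₀ →L[ℝ] ℝ) = l.comp A := sub_zero _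
      exact h7 ▸ h6
    have h3 : mvfderiv I (R α) x (v : TangentSpace I x) = l (A v) :=
      congrArg (fun L : E₀ →L[ℝ] ℝ => L (v : TangentSpace I x)) h1.mfderiv
    have h4 : A.inverse (A v) = (v : TangentSpace I x) := hA.inverse_apply_self v
    have h5 : P (A v) = 𝓕.toGr 1 x v := by
      change 𝓕.toGr 1 x ((𝓕.T 1 x).projectionOnto C hC (A.inverse (A v))) = _
      rw [h4, Submodule.projectionOnto_apply_left]
    change mvfderiv I (R α) x (v : TangentSpace I x) = α (𝓕.toGr 1 x v)
    rw [h3, ← h5]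
    rfl

variable (V : M → Type*) [∀ x, AddCommGroup (V x)] [∀ x, Module ℝ (V x)]

/-- The fibre at `x` of the bundle `gr₋₁(TM)* ⊗ V`. -/
def SymbolSpace (x : M) : Type _ := Module.Dual ℝ (𝓕.Gr 1 x) ⊗[ℝ] V x

instance (x : M) : AddCommGroup (SymbolSpace 𝓕 V x) :=
  inferInstanceAs (AddCommGroup (Module.Dual ℝ (𝓕.Gr 1 x) ⊗[ℝ] V x))

instance (x : M) : Module ℝ (SymbolSpace 𝓕 V x) :=
  inferInstanceAs (Module ℝ (Module.Dual ℝ (𝓕.Gr 1 x) ⊗[ℝ] V x))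

variable {V} in
/-- The pure tensor `α ⊗ v`. -/
def pureTensor {x : M} (α : Module.Dual ℝ (𝓕.Gr 1 x)) (v : V x) : SymbolSpace 𝓕 V x := α ⊗ₜ[ℝ] v

variable {V} (Γ : SmoothSections I V)

variable {𝓕 Γ} in
/-- The `1`-jet at `x` of `f s` with `f(x) = 0` depends only on the restriction of `df(x)` to
`gr₋₁(TₓM)` and on `s(x)`. -/
theorem jetAt_smul_congr {x : M} {f g : M → ℝ} {s t : ∀ y, V y}
    (hf : SmoothNear I f x) (hg : SmoothNear I g x) (hfx : f x = 0) (hgx : g x = 0)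
    (hfg : grDifferential 𝓕 x f = grDifferential 𝓕 x g)
    (hs : s ∈ Γ.near x) (ht : t ∈ Γ.near x) (hst : s x = t x) :
    jetAt 𝓕 Γ 1 x ⟨fun y => f y • s y, Γ.smul_mem x f s hf hs⟩ =
      jetAt 𝓕 Γ 1 x ⟨fun y => g y • t y, Γ.smul_mem x g t hg ht⟩ := by
  have key : ∀ D ∈ 𝓕.diffOp 1 x, ∀ l ∈ Γ.dual x,
      D (fun y => l y (f y • s y)) x = D (fun y => l y (g y • t y)) x := by
    intro D hD l hl
    induction hD using Submodule.span_induction with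
    | mem D hD =>
      obtain ⟨c, L, hc, hL, hr, rfl⟩ := hD
      simp only
      match L, hL, hr with
      | [], _, _ => simp [Filtration.iterDeriv, hfx, hgx]
      | [(X, w)], hL, hr =>
        obtain ⟨hw, hX, hXw⟩ := hL (X, w) (by simp)
        have hw1 : w = 1 := le_antisymm (by simpa using hr) hw
        have hX1 : X x ∈ 𝓕.T 1 x := hw1 ▸ hXw.self_of_nhds
        have h1 : lieDeriv X f x = lieDeriv X g x :=
          congrArg (fun α => α (𝓕.toGr 1 x ⟨X x, hX1⟩)) hfg
        simp only [List.map_cons, List.map_nil, Filtration.iterDeriv, map_smul, smul_eq_mul]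
        rw [lieDeriv_mul hf (hl s hs), lieDeriv_mul hg (hl t ht), hfx, hgx, hst, h1]
        simp
      | (X, w) :: (Y, w') :: L, hL, hr =>
        have h1 := (hL (X, w) (by simp)).1
        have h2 := (hL (Y, w') (by simp)).1
        simp at hr h1 h2
        omega
    | zero => rfl
    | add D D' _ _ h1 h2 => simp only [Pi.add_apply, h1, h2]
    | smul a D _ h1 => simp only [Pi.smul_apply, h1]
  rw [← sub_eq_zero, ← map_sub, jetAt_eq_zero_iff]
  intro D hD l hl
  have h2 := Filtration.diffOp_add hD (hl _ (Γ.smul_mem x f s hf hs))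
    ((SmoothNear.const (-1) x).mul (hl _ (Γ.smul_mem x g t hg ht)))
  rw [Filtration.diffOp_const_mul hD (-1) (hl _ (Γ.smul_mem x g t hg ht)), key D hD l hl] at h2
  have h3 : (fun y => l y ((⟨fun y => f y • s y, Γ.smul_mem x f s hf hs⟩ -
      ⟨fun y => g y • t y, Γ.smul_mem x g t hg ht⟩ : Γ.near x).1 y)) =
      fun y => l y (f y • s y) + -1 * l y (g y • t y) := by
    funext y
    change l y (f y • s y - g y • t y) = _
    rw [map_sub]
    ring
  rw [h3, h2]
  ring

theorem exists_linear_extension (x : M) :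
    ∃ S : V x →ₗ[ℝ] Γ.near x, ∀ v, (S v).1 x = v := by
  let ev : Γ.near x →ₗ[ℝ] V x := (LinearMap.proj x) ∘ₗ (Γ.near x).subtype
  have hev : LinearMap.range ev = ⊤ := by
    rw [LinearMap.range_eq_top]
    intro v
    obtain ⟨s, hs, h⟩ := Γ.eval_surjective x v
    exact ⟨⟨s, hs⟩, h⟩
  obtain ⟨S, hS⟩ := ev.exists_rightInverse_of_surjective hev
  exact ⟨S, fun v => congrArg (fun T => T v) hS⟩

/-- The inclusion `ι : gr₋₁(TₓM)* ⊗ Vₓ → J¹ₓ(V)`, `α ⊗ v ↦ j¹ₓ(f s)`, where `f` is a function with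
`f(x) = 0` and `df(x) = α` on `gr₋₁(TₓM)`, and `s` is a section with `s(x) = v`; see
`symbolInclusion_tmul` for the independence of the choices. -/
def symbolInclusion [FiniteDimensional ℝ E₀] (x : M) :
    SymbolSpace 𝓕 V x →ₗ[ℝ] Jet 𝓕 Γ 1 x :=
  let R := (exists_linear_potential 𝓕 x).choose
  let hR := (exists_linear_potential 𝓕 x).choose_spec
  let S := (exists_linear_extension Γ x).choose
  TensorProduct.lift (LinearMap.mk₂ ℝ
    (fun α v => jetAt 𝓕 Γ 1 x ⟨fun y => R α y • (S v).1 y, Γ.smul_mem x _ _ (hR α).1 (S v).2⟩)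
    (fun α β v => by
      rw [← map_add]
      congr 1
      ext y
      simp [add_smul])
    (fun c α v => by
      rw [← map_smul]
      congr 1
      ext y
      simp [mul_smul])
    (fun α v w => by
      rw [← map_add]
      congr 1
      ext y
      simp)
    (fun c α v => by
      rw [← map_smul]
      congr 1
      ext y
      simp [smul_comm c]))

variable {𝓕 Γ} in
theorem symbolInclusion_tmul [FiniteDimensional ℝ E₀] {x : M} {f : M → ℝ} {s : ∀ y, V y}
    (hf : SmoothNear I f x) (hfx : f x = 0) (hs : s ∈ Γ.near x) :
    symbolInclusion 𝓕 Γ x (pureTensor 𝓕 (grDifferential 𝓕 x f) (s x)) =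
      jetAt 𝓕 Γ 1 x ⟨fun y => f y • s y, Γ.smul_mem x f s hf hs⟩ := by
  have hR := (exists_linear_potential 𝓕 x).choose_spec (grDifferential 𝓕 x f)
  have hS := (exists_linear_extension Γ x).choose_spec (s x)
  simp only [symbolInclusion, pureTensor]
  exact jetAt_smul_congr hR.1 hf hR.2.1 hfx hR.2.2 (Subtype.mem _) hs hS

/-- The smooth local sections of `gr₋₁(TM)*`: they take smooth sections of `gr₋₁(TM) = T⁻¹M` to
smooth functions. -/
def IsCovectorNear (α : ∀ y, Module.Dual ℝ (𝓕.Gr 1 y)) (x : M) : Prop :=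
  ∀ X : ∀ y, 𝓕.T 1 y, SmoothFieldNear I (fun y => (X y : TangentSpace I y)) x →
    SmoothNear I (fun y => α y (𝓕.toGr 1 y (X y))) x

/-- The smooth local sections of the bundle `gr₋₁(TM)* ⊗ V`. -/
def covectorSections (x : M) :
    Submodule ℝ (∀ y, SymbolSpace 𝓕 V y) :=
  locallySpanned {a | ∃ (α : ∀ y, Module.Dual ℝ (𝓕.Gr 1 y)) (s : ∀ y, V y),
    IsCovectorNear 𝓕 α x ∧ s ∈ Γ.near x ∧ a = fun y => pureTensor 𝓕 (α y) (s y)} x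

/-- The image in `gr₋₁(TₓM)* ⊗ Jʳₓ(V)` of the kernel of `πʳ⁺¹_r : Jʳ⁺¹ₓ(V) → Jʳₓ(V)`: the elements
`a` with `ι(a) = j¹ₓ(jʳ s)` for a local section `s` with `jʳₓ s = 0`. -/
def symbolKernel [FiniteDimensional ℝ E₀] (r : ℕ) (x : M) :
    Submodule ℝ (SymbolSpace 𝓕 (Jet 𝓕 Γ r) x) :=
  ((nullJets 𝓕 Γ r x).map (iteratedJetAt 𝓕 Γ r x)).comap
    (symbolInclusion 𝓕 (jetBundle 𝓕 Γ r) x)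

/-- The fibre of the bundle `Wʳ`, the cokernel of `ker πʳ⁺¹_r → gr₋₁(TM)* ⊗ Jʳ(V)`. -/
abbrev WSpace [FiniteDimensional ℝ E₀] (r : ℕ) (x : M) : Type _ :=
  SymbolSpace 𝓕 (Jet 𝓕 Γ r) x ⧸ symbolKernel 𝓕 Γ r x

/-- The smooth local sections of the quotient bundle `Wʳ`. -/
def wSections [FiniteDimensional ℝ E₀] (r : ℕ) (x : M) : Submodule ℝ (∀ y, WSpace 𝓕 Γ r y) :=
  locallySpanned {w | ∃ a ∈ covectorSections 𝓕 (jetBundle 𝓕 Γ r) x,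
    w = fun y => (symbolKernel 𝓕 Γ r y).mkQ (a y)} x

end Symbol

end

end WeightedJet

namespace WeightedJet

noncomputable section

/-! ### Functions smooth near a point, closed under sums, products, determinants and inverses -/

section SmoothFunctions

variable {E₀ : Type*} [NormedAddCommGroup E₀] [NormedSpace ℝ E₀]
  {H : Type*} [TopologicalSpace H] {I : ModelWithCorners ℝ E₀ H}
  {M : Type*} [TopologicalSpace M] [ChartedSpace H M] {x : M}

/-! Near a point, choose a frame `ξ` of vector fields with weights `w` adapted to the filtration. An
operator of weighted order at most `r` becomes a combination of words in the `ξ i` of weight at most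
`r`. The bracket of `ξ i` and `ξ j` has weight at most `w i + w j`, so exchanging two neighbouring
letters costs only shorter words of no larger weight, and ordered words suffice
(`wordSpan_le_span_sorted`). The values at a point of the ordered derivatives of a function are
independent of each other (`exists_prescribed_derivatives`). Applied to the coordinates of a section
of `V` in a local frame, they are therefore coordinates on weighted jets, and the jets form a vector
bundle (`mem_nullJets_iff`, `exists_jet_frame`).

The map `jʳ⁺¹ₓ s ↦ j¹ₓ(jʳ s)` is well defined because a section of `T⁻¹M` composed with an operator
of weight at most `r` has weight at most `r + 1`. Its injectivity is where the generation of the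
symbol algebra is used. The adapted frame can then be chosen so that each `ξ i` is, as an operator,
a combination of compositions of at most `w i` sections of `T⁻¹M` (`exists_generated_frame`). A word
of weight at most `r + 1` is thus a combination of compositions of at most `r + 1` such sections;
splitting off the outermost one leaves an operator of weight at most `r`, so the result at `x` is
seen by `j¹ₓ(jʳ s)` (`iterDeriv_eq_zero_of_generated`).

The rest is linear algebra. Given a section `σ` of `Jʳ(V)`, choose `s` with `jʳₓ s = σ(x)`; the
difference of `j¹ₓ σ` and `j¹ₓ(jʳ s)` lies in the kernel of `π¹₀`, which is the image of `ι`. Hence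
`J¹(Jʳ(V))` is the sum of the images of `p₁(id_r)` and `ι` (`range_iteratedJetAt_sup_range`), and
`Wʳ` is identified with the quotient of `J¹(Jʳ(V))` by the image of `p₁(id_r)`. The operator is the
quotient map, and nothing else is possible: it is zero on one summand and prescribed on the other.
Smoothness of `Wʳ` and of the operator is read off in a local frame of `J¹(Jʳ(V))` made of images
under the two maps (`exists_sum_frame`, `existsUnique_quotient_bundleMap`). -/

theorem SmoothNear.sum {ι : Type*} (s : Finset ι) {f : ι → M → ℝ}
    (h : ∀ i ∈ s, SmoothNear I (f i) x) : SmoothNear I (fun y => ∑ i ∈ s, f i y) x := by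
  classical
  induction s using Finset.induction_on with
  | empty => simpa using SmoothNear.const 0 x
  | insert a s ha ih =>
    simp only [Finset.sum_insert ha]
    exact (h a (by simp)).add (ih fun i hi => h i (by simp [hi]))

theorem SmoothNear.prod {ι : Type*} (s : Finset ι) {f : ι → M → ℝ}
    (h : ∀ i ∈ s, SmoothNear I (f i) x) : SmoothNear I (fun y => ∏ i ∈ s, f i y) x := by
  classical
  induction s using Finset.induction_on with
  | empty => simpa using SmoothNear.const 1 x
  | insert a s ha ih =>
    simp only [Finset.prod_insert ha]
    exact (h a (by simp)).mul (ih fun i hi => h i (by simp [hi]))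

theorem SmoothNear.sub {f g : M → ℝ} (hf : SmoothNear I f x) (hg : SmoothNear I g x) :
    SmoothNear I (fun y => f y - g y) x := by
  simpa [sub_eq_add_neg] using hf.add ((SmoothNear.const (-1) x).mul hg)

theorem SmoothNear.contMDiffAt {f : M → ℝ} (hf : SmoothNear I f x) :
    ContMDiffAt I 𝓘(ℝ, ℝ) ∞ f x := by
  obtain ⟨U, hU, hfU⟩ := hf
  exact hfU.contMDiffAt hU

theorem SmoothNear.inv {f : M → ℝ} (hf : SmoothNear I f x) (h0 : f x ≠ 0) :
    SmoothNear I (fun y => (f y)⁻¹) x := by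
  have h1 : ∀ᶠ y in 𝓝 x, f y ≠ 0 := hf.contMDiffAt.continuousAt.eventually_ne h0
  obtain ⟨U, hU, hfU⟩ := hf
  refine ⟨U ∩ {y | f y ≠ 0}, inter_mem hU h1, ?_⟩
  exact (hfU.mono inter_subset_left).inv₀ fun y hy => hy.2

theorem SmoothNear.det {ι : Type*} [Fintype ι] [DecidableEq ι] {A : M → Matrix ι ι ℝ}
    (h : ∀ i j, SmoothNear I (fun y => A y i j) x) : SmoothNear I (fun y => (A y).det) x := by
  simp only [Matrix.det_apply']
  exact SmoothNear.sum _ fun σ _ => (SmoothNear.const _ x).mul (SmoothNear.prod _ fun i _ => h _ _)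

/-- Cramer's rule: the entries are cofactors divided by the determinant. Invertibility at `x` alone
is enough, since it persists nearby. -/
theorem SmoothNear.matrix_inv {ι : Type*} [Fintype ι] [DecidableEq ι] {A : M → Matrix ι ι ℝ}
    (h : ∀ i j, SmoothNear I (fun y => A y i j) x) (h0 : (A x).det ≠ 0) (i j : ι) :
    SmoothNear I (fun y => (A y)⁻¹ i j) x := by
  simp only [Matrix.inv_def, Ring.inverse_eq_inv', Matrix.smul_apply, smul_eq_mul]
  refine ((SmoothNear.det h).inv h0).mul ?_
  simp only [Matrix.adjugate_apply]
  refine SmoothNear.det fun k l => ?_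
  by_cases hk : k = j
  · subst hk
    simpa using SmoothNear.const _ x
  · simpa [Matrix.updateRow_ne hk] using h k l

end SmoothFunctions

/-! ### Local frames, their coordinates, and criteria for being a frame -/

section Frames

variable {E₀ : Type*} [NormedAddCommGroup E₀] [NormedSpace ℝ E₀]
  {H : Type*} [TopologicalSpace H] (I : ModelWithCorners ℝ E₀ H)
  {M : Type*} [TopologicalSpace M] [ChartedSpace H M]
  {V : M → Type*} [∀ x, AddCommGroup (V x)] [∀ x, Module ℝ (V x)]

/-- The families of local sections which behave like the sections of a sheaf of modules over the
smooth functions. -/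
structure IsSheafLike (near : M → Submodule ℝ (∀ y, V y)) : Prop where
  congr : ∀ x s t, s ∈ near x → (∀ᶠ y in 𝓝 x, t y = s y) → t ∈ near x
  eventually : ∀ x s, s ∈ near x → ∀ᶠ y in 𝓝 x, s ∈ near y
  smul_mem : ∀ x (f : M → ℝ) s, SmoothNear I f x → s ∈ near x → (fun y => f y • s y) ∈ near x

/-- The sections `e i` form a local frame near `y`: they are a basis of the fibre at `y`, and the
smooth sections near `y` are their combinations with smooth coefficients. -/
structure IsFrameAt (near : M → Submodule ℝ (∀ y, V y)) {ι : Type*} [Fintype ι]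
    (e : ι → ∀ y, V y) (y : M) : Prop where
  linearIndependent : LinearIndependent ℝ (fun i => e i y)
  span_eq_top : Submodule.span ℝ (range fun i => e i y) = ⊤
  mem_iff : ∀ s, s ∈ near y ↔ ∃ c : ι → M → ℝ, (∀ i, SmoothNear I (c i) y) ∧
      ∀ᶠ z in 𝓝 y, s z = ∑ i, c i z • e i z

/-- The coordinates with respect to a family which is a basis of the fibre at `y`. -/
def frameCoord {ι : Type*} (e : ι → ∀ y, V y) (i : ι) (y : M) : V y →ₗ[ℝ] ℝ := by
  classical
  exact if h : LinearIndependent ℝ (fun i => e i y) ∧ ⊤ ≤ Submodule.span ℝ (range fun i => e i y)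
    then (Module.Basis.mk h.1 h.2).coord i else 0

variable {I}

theorem SmoothSections.isSheafLike (Γ : SmoothSections I V) : IsSheafLike I Γ.near :=
  ⟨Γ.congr, Γ.eventually, Γ.smul_mem⟩

theorem IsSheafLike.sum_smul_mem {near : M → Submodule ℝ (∀ y, V y)} (hn : IsSheafLike I near)
    {ι : Type*} (s : Finset ι) {x : M} {c : ι → M → ℝ} {e : ι → ∀ y, V y}
    (hc : ∀ i ∈ s, SmoothNear I (c i) x) (he : ∀ i ∈ s, e i ∈ near x) :
    (fun y => ∑ i ∈ s, c i y • e i y) ∈ near x := by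
  have h := Submodule.sum_mem (near x) (t := s) (f := fun i y => c i y • e i y)
    fun i hi => hn.smul_mem x _ _ (hc i hi) (he i hi)
  convert! h using 1
  funext y
  simp

/-- The span is taken over `ℝ`, so stability under smooth functions has to come from the generating
sets. This serves both the sections of `gr₋₁(TM)* ⊗ V` and those of a quotient bundle. -/
theorem isSheafLike_locallySpanned {G : M → Set (∀ y, V y)}
    (hev : ∀ x s, s ∈ G x → ∀ᶠ y in 𝓝 x, s ∈ G y)
    (hsmul : ∀ x (f : M → ℝ) s, SmoothNear I f x → s ∈ G x → (fun y => f y • s y) ∈ G x) :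
    IsSheafLike I (fun x => locallySpanned (G x) x) where
  congr := by
    rintro x s t ⟨u, hu, h⟩ h'
    refine ⟨u, hu, ?_⟩
    filter_upwards [h, h'] with y hy hy'
    rw [hy', hy]
  eventually := by
    rintro x s ⟨u, hu, h⟩
    suffices h1 : ∀ᶠ y in 𝓝 x, u ∈ Submodule.span ℝ (G y) by
      filter_upwards [h1, eventually_eventually_nhds.2 h] with y hy hy'
      exact ⟨u, hy, hy'⟩
    clear h
    induction hu using Submodule.span_induction with
    | mem σ hσ => exact (hev x σ hσ).mono fun y hy => Submodule.subset_span hy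
    | zero => exact Eventually.of_forall fun y => zero_mem _
    | add a b _ _ ha hb => exact (ha.and hb).mono fun y hy => add_mem hy.1 hy.2
    | smul c a _ ha => exact ha.mono fun y hy => Submodule.smul_mem _ c hy
  smul_mem := by
    rintro x g s hg ⟨u, hu, h⟩
    refine ⟨fun y => g y • u y, ?_, h.mono fun y hy => by simp only [hy]⟩
    clear h
    induction hu using Submodule.span_induction with
    | mem σ hσ => exact Submodule.subset_span (hsmul x g σ hg hσ)
    | zero =>
      convert! zero_mem (Submodule.span ℝ (G x)) using 1
      funext y
      simp
    | add a b _ _ ha hb =>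
      convert! add_mem ha hb using 1
      funext y
      simp
    | smul c a _ ha =>
      convert! Submodule.smul_mem _ c ha using 1
      funext y
      exact smul_comm (g y) c (a y)

theorem isVectorBundle_of_frames {near : M → Submodule ℝ (∀ y, V y)}
    (h : ∀ x, ∃ (ι : Type) (_ : Fintype ι) (e : ι → ∀ y, V y),
      ∀ᶠ y in 𝓝 x, IsFrameAt I near e y) : IsVectorBundle I near := by
  intro x
  obtain ⟨ι, _, e, he⟩ := h x
  let φ := (Fintype.equivFin ι).symm
  refine ⟨Fintype.card ι, fun i => e (φ i), _, he, fun y hy => ⟨?_, ?_, fun s => ?_⟩⟩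
  · exact hy.linearIndependent.comp φ φ.injective
  · rw [← hy.span_eq_top]
    congr 1
    exact φ.surjective.range_comp fun i => e i y
  · rw [hy.mem_iff]
    constructor
    · rintro ⟨c, hc, h⟩
      refine ⟨fun i => c (φ i), fun i => hc _, h.mono fun z hz => ?_⟩
      rw [hz, φ.sum_comp (fun i => c i z • e i z)]
    · rintro ⟨c, hc, h⟩
      refine ⟨fun i => c (φ.symm i), fun i => hc _, h.mono fun z hz => ?_⟩
      rw [hz, ← φ.sum_comp (fun i => c (φ.symm i) z • e i z)]
      simp

theorem IsVectorBundle.exists_frame {near : M → Submodule ℝ (∀ y, V y)}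
    (h : IsVectorBundle I near) (x : M) : ∃ (n : ℕ) (e : Fin n → ∀ y, V y),
      ∀ᶠ y in 𝓝 x, IsFrameAt I near e y := by
  obtain ⟨n, e, U, hU, h⟩ := h x
  exact ⟨n, e, mem_of_superset hU fun y hy => ⟨(h y hy).1, (h y hy).2.1, (h y hy).2.2⟩⟩

section

variable {near : M → Submodule ℝ (∀ y, V y)} {ι : Type*} [Fintype ι] {e : ι → ∀ y, V y} {y : M}

theorem IsFrameAt.mem (he : IsFrameAt I near e y) (i : ι) : e i ∈ near y := by
  classical
  refine (he.mem_iff _).2 ⟨fun j _ => if j = i then 1 else 0, fun j => SmoothNear.const _ y, ?_⟩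
  exact Eventually.of_forall fun z => by simp

theorem IsFrameAt.frameCoord_eq (he : IsFrameAt I near e y) (i : ι) :
    frameCoord e i y = (Module.Basis.mk he.linearIndependent he.span_eq_top.ge).coord i := by
  rw [frameCoord, dif_pos ⟨he.linearIndependent, he.span_eq_top.ge⟩]

theorem IsFrameAt.sum_frameCoord (he : IsFrameAt I near e y) (v : V y) :
    ∑ i, frameCoord e i y v • e i y = v := by
  have := (Module.Basis.mk he.linearIndependent he.span_eq_top.ge).sum_repr v
  simpa [he.frameCoord_eq] using this

theorem IsFrameAt.frameCoord_self [DecidableEq ι] (he : IsFrameAt I near e y) (i j : ι) :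
    frameCoord e i y (e j y) = if i = j then 1 else 0 := by
  rw [he.frameCoord_eq]
  have := Module.Basis.mk_apply he.linearIndependent he.span_eq_top.ge j
  conv_lhs => rw [← this]
  rw [Module.Basis.coord_apply, Module.Basis.repr_self, Finsupp.single_apply]
  simp [eq_comm]

theorem IsFrameAt.frameCoord_sum (he : IsFrameAt I near e y) (c : ι → ℝ) (i : ι) :
    frameCoord e i y (∑ j, c j • e j y) = c i := by
  classical
  simp [he.frameCoord_self]

theorem IsFrameAt.eq_frameCoord [DecidableEq ι] (he : IsFrameAt I near e y) {i : ι}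
    {κ : V y →ₗ[ℝ] ℝ} (h : ∀ j, κ (e j y) = if i = j then 1 else 0) : frameCoord e i y = κ := by
  ext v
  rw [← he.sum_frameCoord v, he.frameCoord_sum]
  simp [h]

theorem smoothNear_frameCoord (he : ∀ᶠ z in 𝓝 y, IsFrameAt I near e z) {s : ∀ y, V y}
    (hs : s ∈ near y) (i : ι) : SmoothNear I (fun z => frameCoord e i z (s z)) y := by
  obtain ⟨c, hc, h⟩ := (he.self_of_nhds.mem_iff s).1 hs
  refine (hc i).congr ?_
  filter_upwards [h, he] with z hz hez
  rw [hz, hez.frameCoord_sum]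

end

variable {near : M → Submodule ℝ (∀ y, V y)} {ι : Type*} [Fintype ι] {x : M}

/-- Sections whose coordinates are linearly independent at `x` form a frame near `x`. -/
theorem isFrameAt_of_coords [DecidableEq ι] (hn : IsSheafLike I near) (κ : ι → ∀ y, V y →ₗ[ℝ] ℝ)
    (hinj : ∀ᶠ y in 𝓝 x, ∀ v : V y, (∀ a, κ a y v = 0) → v = 0)
    (hsm : ∀ᶠ y in 𝓝 x, ∀ s ∈ near y, ∀ a, SmoothNear I (fun z => κ a z (s z)) y)
    {g : ι → ∀ y, V y} (hg : ∀ a, g a ∈ near x)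
    (hdet : (Matrix.of fun a b => κ a x (g b x)).det ≠ 0) :
    ∀ᶠ y in 𝓝 x, IsFrameAt I near g y := by
  let G : M → Matrix ι ι ℝ := fun y => Matrix.of fun a b => κ a y (g b y)
  have hG : ∀ a b, SmoothNear I (fun y => G y a b) x := fun a b => hsm.self_of_nhds _ (hg b) a
  have hdet' : ∀ᶠ y in 𝓝 x, (G y).det ≠ 0 :=
    (SmoothNear.det hG).contMDiffAt.continuousAt.eventually_ne hdet
  have hg' : ∀ᶠ y in 𝓝 x, ∀ a, g a ∈ near y :=
    eventually_all.2 fun a => hn.eventually x _ (hg a)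
  -- The two sides have the same coordinates `κ`, and these separate the points of the fibre.
  have expand : ∀ y, (G y).det ≠ 0 → (∀ v : V y, (∀ a, κ a y v = 0) → v = 0) → ∀ v : V y,
      v = ∑ b, (∑ a, (G y)⁻¹ b a * κ a y v) • g b y := by
    intro y hd hi v
    rw [← sub_eq_zero]
    refine hi _ fun a => ?_
    have h1 : G y * (G y)⁻¹ = 1 := Matrix.mul_nonsing_inv _ (isUnit_iff_ne_zero.2 hd)
    have h2 : (G y).mulVec ((G y)⁻¹.mulVec fun a => κ a y v) = fun a => κ a y v := by
      rw [Matrix.mulVec_mulVec, h1, Matrix.one_mulVec]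
    have h3 := congrFun h2 a
    simp only [Matrix.mulVec, dotProduct] at h3
    rw [map_sub, map_sum, sub_eq_zero, ← h3]
    refine Finset.sum_congr rfl fun b _ => ?_
    rw [map_smul, smul_eq_mul, mul_comm]
    rfl
  filter_upwards [eventually_eventually_nhds.2 hdet', hg', eventually_eventually_nhds.2 hinj, hsm]
    with y hd hgy hi hs
  refine ⟨?_, ?_, fun s => ⟨fun h => ?_, ?_⟩⟩
  · rw [Fintype.linearIndependent_iff]
    intro c hc
    have h1 : (G y).mulVec c = 0 := by
      funext a
      have := congrArg (κ a y) hc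
      rw [map_sum, map_zero] at this
      simp only [Matrix.mulVec, dotProduct, Pi.zero_apply]
      rw [← this]
      refine Finset.sum_congr rfl fun b _ => ?_
      rw [map_smul, smul_eq_mul, mul_comm]
      rfl
    exact congrFun (Matrix.eq_zero_of_mulVec_eq_zero hd.self_of_nhds h1)
  · rw [eq_top_iff]
    intro v _
    rw [expand y hd.self_of_nhds hi.self_of_nhds v]
    exact Submodule.sum_mem _ fun b _ => Submodule.smul_mem _ _ (Submodule.subset_span ⟨b, rfl⟩)
  · refine ⟨fun b z => ∑ a, (G z)⁻¹ b a * κ a z (s z), fun b => ?_, ?_⟩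
    · exact SmoothNear.sum _ fun a _ => (SmoothNear.matrix_inv (fun a b => hs _ (hgy b) a)
        hd.self_of_nhds b a).mul (hs s h a)
    · filter_upwards [hd, hi] with z hdz hiz
      exact expand z hdz hiz (s z)
  · rintro ⟨c, hc, h⟩
    exact hn.congr y _ s (hn.sum_smul_mem _ (fun i _ => hc i) fun i _ => hgy i) h

/-- Smooth coordinates which are bijective at `x` are the coordinates of a local frame. -/
theorem exists_frame_of_coords [DecidableEq ι] (hn : IsSheafLike I near)
    (κ : ι → ∀ y, V y →ₗ[ℝ] ℝ)
    (hinj : ∀ᶠ y in 𝓝 x, ∀ v : V y, (∀ a, κ a y v = 0) → v = 0)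
    (hsm : ∀ᶠ y in 𝓝 x, ∀ s ∈ near y, ∀ a, SmoothNear I (fun z => κ a z (s z)) y)
    (hsurj : ∀ b, ∃ g ∈ near x, ∀ a, κ a x (g x) = if a = b then 1 else 0) :
    ∃ e : ι → ∀ y, V y, ∀ᶠ y in 𝓝 x, IsFrameAt I near e y ∧ ∀ a, frameCoord e a y = κ a y := by
  choose g hg hκ using hsurj
  let G : M → Matrix ι ι ℝ := fun y => Matrix.of fun a b => κ a y (g b y)
  have hG : ∀ a b, SmoothNear I (fun y => G y a b) x := fun a b => hsm.self_of_nhds _ (hg b) a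
  have hG1 : G x = 1 := by
    ext a b
    simp [G, hκ, Matrix.one_apply]
  have hGx : (G x).det ≠ 0 := by simp [hG1]
  have hdet : ∀ᶠ y in 𝓝 x, (G y).det ≠ 0 :=
    (SmoothNear.det hG).contMDiffAt.continuousAt.eventually_ne hGx
  -- Multiplying the sections `g` by the inverse of their coordinate matrix makes them dual to `κ`
  -- near `x`, and not only at `x`.
  let e : ι → ∀ y, V y := fun b y => ∑ a, (G y)⁻¹ a b • g a y
  have he : ∀ b, e b ∈ near x := fun b =>
    hn.sum_smul_mem _ (fun a _ => SmoothNear.matrix_inv hG hGx a b) fun a _ => hg a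
  have hκe : ∀ y, (G y).det ≠ 0 → ∀ a b, κ a y (e b y) = if a = b then 1 else 0 := by
    intro y hy a b
    have h1 : (G y * (G y)⁻¹) a b = (1 : Matrix ι ι ℝ) a b := by
      rw [Matrix.mul_nonsing_inv _ (isUnit_iff_ne_zero.2 hy)]
    rw [Matrix.mul_apply, Matrix.one_apply] at h1
    rw [← h1, map_sum]
    refine Finset.sum_congr rfl fun c _ => ?_
    rw [map_smul, smul_eq_mul, mul_comm]
    rfl
  refine ⟨e, ?_⟩
  have h1 : (Matrix.of fun a b => κ a x (e b x)) = 1 := by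
    ext a b
    rw [Matrix.of_apply, hκe x hGx, Matrix.one_apply]
  filter_upwards [isFrameAt_of_coords hn κ hinj hsm he (by simp [h1]), hdet] with y hy hd
  exact ⟨hy, fun a => hy.eq_frameCoord fun b => hκe y hd a b⟩

/-- Sections which are a basis of the fibre at `x` form a frame near `x`. -/
theorem isFrameAt_of_basis (hn : IsSheafLike I near) {e : ι → ∀ y, V y}
    (he : ∀ᶠ y in 𝓝 x, IsFrameAt I near e y) {ι' : Type*} [Fintype ι'] {g : ι' → ∀ y, V y}
    (hg : ∀ a, g a ∈ near x) (hli : LinearIndependent ℝ fun a => g a x)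
    (hspan : Submodule.span ℝ (range fun a => g a x) = ⊤) :
    ∀ᶠ y in 𝓝 x, IsFrameAt I near g y := by
  classical
  let b := Module.Basis.mk hli hspan.ge
  let b' := Module.Basis.mk he.self_of_nhds.linearIndependent he.self_of_nhds.span_eq_top.ge
  let φ : ι ≃ ι' := b'.indexEquiv b
  refine isFrameAt_of_coords hn (fun a => frameCoord e (φ.symm a)) ?_ ?_ hg ?_
  · filter_upwards [he] with y hy v hv
    rw [← hy.sum_frameCoord v]
    refine Finset.sum_eq_zero fun i _ => ?_
    have := hv (φ i)
    rw [φ.symm_apply_apply] at this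
    rw [this, zero_smul]
  · filter_upwards [eventually_eventually_nhds.2 he] with y hy s hs a
    exact smoothNear_frameCoord hy hs _
  -- At `x` the coordinate matrix is a change of basis, hence invertible.
  · have h1 : (Matrix.of fun a c => frameCoord e (φ.symm a) x (g c x)) =
        (b'.reindex φ).toMatrix b := by
      ext a c
      simp [Module.Basis.toMatrix_apply, he.self_of_nhds.frameCoord_eq, b, b']
    rw [h1]
    have h2 : (b'.reindex φ).toMatrix b * b.toMatrix (b'.reindex φ) = 1 :=
      Module.Basis.toMatrix_mul_toMatrix_flip _ _
    exact left_ne_zero_of_mul (by rw [← Matrix.det_mul, h2, Matrix.det_one]; exact one_ne_zero)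

end Frames

/-! ### Smooth vector bundles in the usual sense have local frames -/

section Bundles

variable {E₀ : Type*} [NormedAddCommGroup E₀] [NormedSpace ℝ E₀]
  {H : Type*} [TopologicalSpace H] (I : ModelWithCorners ℝ E₀ H)
  {M : Type*} [TopologicalSpace M] [ChartedSpace H M]

theorem isVectorBundle_bundleSections (F : Type*) [NormedAddCommGroup F] [NormedSpace ℝ F]
    [FiniteDimensional ℝ F]
    (V : M → Type*) [TopologicalSpace (TotalSpace F V)] [∀ x, AddCommGroup (V x)]
    [∀ x, Module ℝ (V x)] [∀ x, TopologicalSpace (V x)] [FiberBundle F V] [VectorBundle ℝ F V]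
    [ContMDiffVectorBundle ∞ F V I] : IsVectorBundle I (bundleSections I F V).near := by
  classical
  refine isVectorBundle_of_frames fun x => ?_
  let t := trivializationAt F V x
  have ht : t.baseSet ∈ 𝓝 x := t.open_baseSet.mem_nhds (mem_baseSet_trivializationAt F V x)
  let b := Module.finBasis ℝ F
  let κ : Fin _ → ∀ y, V y →ₗ[ℝ] ℝ := t.localFrameCoeff I b
  have hκ : ∀ y ∈ t.baseSet, ∀ a c, κ a y (t.localFrame b c y) = if a = c then 1 else 0 := by
    intro y hy a c
    simp only [κ]
    rw [t.localFrameCoeff_apply_of_mem_baseSet b hy (t.localFrame b c),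
      t.localFrame_apply_of_mem_baseSet b hy, Module.Basis.repr_self, Finsupp.single_apply]
    simp [eq_comm]
  suffices h : ∃ e : Fin _ → ∀ y, V y, ∀ᶠ y in 𝓝 x, IsFrameAt I (bundleSections I F V).near e y ∧
      ∀ a, frameCoord e a y = κ a y by
    obtain ⟨e, he⟩ := h
    exact ⟨_, inferInstance, e, he.mono fun y hy => hy.1⟩
  refine exists_frame_of_coords (bundleSections I F V).isSheafLike κ ?_ ?_ ?_
  · filter_upwards [ht] with y hy v hv
    -- The expansion is an identity for sections, so the vector is extended by zero away from `y`;
    -- no smoothness is needed for it.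
    have h1 := t.eq_sum_localFrameCoeff_smul (I := I) (b := b) (hx := hy)
      (s := fun z => if h : y = z then h ▸ v else 0)
    simp only [dite_true] at h1
    rw [h1]
    exact Finset.sum_eq_zero fun i _ => by
      rw [show t.localFrameCoeff I b i y v = 0 from hv i, zero_smul]
  · filter_upwards [t.open_baseSet.mem_nhds (mem_baseSet_trivializationAt F V x)] with y hy s hs a
    obtain ⟨U, hU, hs⟩ := hs
    obtain ⟨O, hOs, hO, hyO⟩ := mem_nhds_iff.1 (inter_mem hU (t.open_baseSet.mem_nhds hy))
    exact ⟨O, hO.mem_nhds hyO, contMDiffOn_localFrameCoeff (e := t) b hO (hOs.trans inter_subset_right)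
      (hs.mono (hOs.trans inter_subset_left)) a⟩
  · intro c
    refine ⟨t.localFrame b c, ⟨t.baseSet, ht, t.contMDiffOn_localFrame_baseSet ∞ b c⟩, fun a => ?_⟩
    exact hκ x (mem_of_mem_nhds ht) a c

end Bundles

end

end WeightedJet

namespace WeightedJet

noncomputable section

/-! ### The Lie bracket of vector fields as a commutator of derivations -/

section Bracket

variable {E₀ : Type*} [NormedAddCommGroup E₀] [NormedSpace ℝ E₀]
  {H : Type*} [TopologicalSpace H] {I : ModelWithCorners ℝ E₀ H}
  {M : Type*} [TopologicalSpace M] [ChartedSpace H M]  {x : M}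

theorem SmoothSectionNear.eventually {F : Type*} [NormedAddCommGroup F] [NormedSpace ℝ F]
    {V : M → Type*} [TopologicalSpace (TotalSpace F V)] [∀ x, TopologicalSpace (V x)]
    [FiberBundle F V] {s : ∀ y, V y} (h : SmoothSectionNear I F s x) :
    ∀ᶠ y in 𝓝 x, SmoothSectionNear I F s y := by
  obtain ⟨U, hU, hs⟩ := h
  filter_upwards [eventually_mem_nhds_iff.2 hU] with y hy
  exact ⟨U, hy, hs⟩

variable [IsManifold I ∞ M]

theorem SmoothFieldNear.mdifferentiableAt {X : ∀ y : M, TangentSpace I y}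
    (hX : SmoothFieldNear I X x) :
    MDifferentiableAt I (I.prod 𝓘(ℝ, E₀)) (fun y => (⟨y, X y⟩ : TangentBundle I M)) x := by
  obtain ⟨U, hU, h⟩ := hX
  exact (h.contMDiffAt hU).mdifferentiableAt (by simp)

theorem two_le_infty : (2 : ℕ∞ω) ≤ ∞ := WithTop.coe_le_coe.2 (le_top : (2 : ℕ∞) ≤ ⊤)

variable [FiniteDimensional ℝ E₀]

theorem SmoothFieldNear.mlieBracket {X Y : ∀ y : M, TangentSpace I y}
    (hX : SmoothFieldNear I X x) (hY : SmoothFieldNear I Y x) :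
    SmoothFieldNear I (VectorField.mlieBracket I X Y) x := by
  have : CompleteSpace E₀ := FiniteDimensional.complete ℝ E₀
  obtain ⟨U, hU, hX⟩ := hX
  obtain ⟨W, hW, hY⟩ := hY
  refine ⟨interior (U ∩ W), isOpen_interior.mem_nhds (mem_interior_iff_mem_nhds.2
    (inter_mem hU hW)), fun y hy => ?_⟩
  have hy' := mem_interior_iff_mem_nhds.1 hy
  have : IsManifold I ((⊤ : ℕ∞) + 1 : ℕ∞ω) M := inferInstanceAs (IsManifold I ∞ M)
  have : IsManifold I (minSmoothness ℝ 2) M := by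
    rw [minSmoothness_of_isRCLikeNormedField]
    exact IsManifold.of_le two_le_infty
  exact (ContMDiffAt.mlieBracket_vectorField (m := ⊤) (n := ⊤)
    (hX.contMDiffAt (mem_of_superset hy' inter_subset_left))
    (hY.contMDiffAt (mem_of_superset hy' inter_subset_right)) (by simp)).contMDiffWithinAt

/-- The chain rule for the chart. It moves derivatives along vector fields to the model space, where
the flat bracket is available. -/
theorem fderiv_comp_extChartAt_symm [I.Boundaryless] {f : M → ℝ} {y : M}
    (hy : y ∈ (extChartAt I x).source) (hf : SmoothNear I f y) (v : TangentSpace I y) :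
    fderiv ℝ (f ∘ (extChartAt I x).symm) (extChartAt I x y)
      (mfderiv I 𝓘(ℝ, E₀) (extChartAt I x) y v) = mvfderiv I f y v := by
  have h1 : MDifferentiableAt I 𝓘(ℝ, E₀) (extChartAt I x) y :=
    mdifferentiableAt_extChartAt (by simpa using hy)
  have h2 : f =ᶠ[𝓝 y] (f ∘ (extChartAt I x).symm) ∘ extChartAt I x := by
    filter_upwards [(isOpen_extChartAt_source x).mem_nhds hy] with z hz
    exact (congrArg f ((extChartAt I x).left_inv hz)).symm
  have h4 : (extChartAt I x).symm (extChartAt I x y) = y := (extChartAt I x).left_inv hy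
  have h3 : MDifferentiableAt 𝓘(ℝ, E₀) 𝓘(ℝ, ℝ) (f ∘ (extChartAt I x).symm) (extChartAt I x y) := by
    refine MDifferentiableAt.comp (I' := I) _ (by rw [h4]; exact hf.mdifferentiableAt) ?_
    have := contMDiffOn_extChartAt_symm (I := I) (n := ∞) x
    exact (this.contMDiffAt ((isOpen_extChartAt_target x).mem_nhds
      ((extChartAt I x).map_source hy))).mdifferentiableAt (by simp)
  have h5 : mfderiv I 𝓘(ℝ, ℝ) f y = (mfderiv 𝓘(ℝ, E₀) 𝓘(ℝ, ℝ) (f ∘ (extChartAt I x).symm)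
      (extChartAt I x y)).comp (mfderiv I 𝓘(ℝ, E₀) (extChartAt I x) y) := by
    rw [h2.mfderiv_eq]
    exact mfderiv_comp y h3 h1
  rw [mfderiv_eq_fderiv] at h5
  exact (congrArg (fun L : E₀ →L[ℝ] ℝ => L v) h5).symm

/-- The derivative along the Lie bracket is the commutator of the derivatives. -/
theorem lieDeriv_mlieBracket [I.Boundaryless] {X Y : ∀ y : M, TangentSpace I y} {f : M → ℝ}
    (hX : SmoothFieldNear I X x) (hY : SmoothFieldNear I Y x) (hf : SmoothNear I f x) :
    lieDeriv (VectorField.mlieBracket I X Y) f x =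
      lieDeriv X (lieDeriv Y f) x - lieDeriv Y (lieDeriv X f) x := by
  have : CompleteSpace E₀ := FiniteDimensional.complete ℝ E₀
  have : IsManifold I 2 M := IsManifold.of_le (n := ∞) two_le_infty
  set φ := extChartAt I x with hφ
  -- `P X` is the vector field `X` read in the chart at `x`; the bracket on `M` is the pullback of
  -- the flat bracket of such fields.
  let P : (∀ y : M, TangentSpace I y) → E₀ → E₀ := fun X =>
    VectorField.mpullbackWithin 𝓘(ℝ, E₀) I φ.symm X (range I)
  have hP : ∀ X : ∀ y : M, TangentSpace I y, SmoothFieldNear I X x →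
      DifferentiableAt ℝ (P X) (φ x) := by
    intro X hX
    have : DifferentiableWithinAt ℝ (P X) (φ.symm ⁻¹' univ ∩ range I) (φ x) :=
      (mdifferentiableWithinAt_univ.2 hX.mdifferentiableAt).differentiableWithinAt_mpullbackWithin_vectorField
    rw [preimage_univ, univ_inter, I.range_eq_univ, differentiableWithinAt_univ] at this
    exact this
  have hPv : ∀ X : ∀ y : M, TangentSpace I y, ∀ y ∈ φ.source,
      P X (φ y) = mfderiv I 𝓘(ℝ, E₀) φ y (X y) := by
    intro X y hy
    have h1 : φ.symm (φ y) = y := φ.left_inv hy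
    have h2 := isInvertible_mfderivWithin_extChartAt_symm (I := I) (φ.map_source hy)
    have h3 := mfderivWithin_extChartAt_symm_comp_mfderiv_extChartAt' (I := I) hy
    have h4 : mfderivWithin 𝓘(ℝ, E₀) I φ.symm (range I) (φ y)
        (mfderiv I 𝓘(ℝ, E₀) φ y (X y)) = X (φ.symm (φ y)) := by
      rw [h1]
      exact congrArg (fun L : E₀ →L[ℝ] E₀ => L (X y)) h3
    change (mfderivWithin 𝓘(ℝ, E₀) I φ.symm (range I) (φ y)).inverse (X (φ.symm (φ y))) = _
    rw [← h4]
    exact h2.inverse_apply_self _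
  have key : ∀ X : ∀ y : M, TangentSpace I y, ∀ g : M → ℝ, ∀ y ∈ φ.source, SmoothNear I g y →
      fderiv ℝ (g ∘ φ.symm) (φ y) (P X (φ y)) = lieDeriv X g y := by
    intro X g y hy hg
    rw [hPv X y hy]
    exact fderiv_comp_extChartAt_symm hy hg _
  have hx : x ∈ φ.source := mem_extChartAt_source x
  have hz : φ.symm (φ x) = x := φ.left_inv hx
  -- An identity on a whole neighbourhood is needed, because it is differentiated once more.
  have key' : ∀ X : ∀ y : M, TangentSpace I y, (lieDeriv X f ∘ φ.symm) =ᶠ[𝓝 (φ x)]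
      fun z => fderiv ℝ (f ∘ φ.symm) z (P X z) := by
    intro X
    have hc : ContinuousAt φ.symm (φ x) := continuousAt_extChartAt_symm x
    have hev : ∀ᶠ y in 𝓝 (φ.symm (φ x)), SmoothNear I f y := by
      rw [hz]
      exact hf.eventually
    filter_upwards [(isOpen_extChartAt_target x).mem_nhds (mem_extChartAt_target x),
      hc.eventually hev] with z hzt hzf
    have := key X f (φ.symm z) (φ.map_target hzt) hzf
    rw [φ.right_inv hzt] at this
    exact this.symm
  have hf' : ContDiffAt ℝ ∞ (f ∘ φ.symm) (φ x) := by
    rw [← contMDiffAt_iff_contDiffAt]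
    refine ContMDiffAt.comp (I' := I) (φ x) (by rw [hz]; exact hf.contMDiffAt) ?_
    exact (contMDiffOn_extChartAt_symm (I := I) (n := ∞) x).contMDiffAt
      ((isOpen_extChartAt_target x).mem_nhds (mem_extChartAt_target x))
  have hb : VectorField.mlieBracket I X Y x =
      (mfderiv I 𝓘(ℝ, E₀) φ x).inverse (VectorField.lieBracket (E := E₀) ℝ (P X) (P Y) (φ x)) := by
    rw [← VectorField.mlieBracketWithin_univ, VectorField.mlieBracketWithin_apply, preimage_univ,
      univ_inter, ← VectorField.lieBracketWithin_univ]
    simp only [I.range_eq_univ, P, hφ]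
    rfl
  have hA : (mfderiv I 𝓘(ℝ, E₀) φ x).IsInvertible :=
    isInvertible_mfderiv_extChartAt (mem_extChartAt_source x)
  have h1 : lieDeriv (VectorField.mlieBracket I X Y) f x =
      fderiv ℝ (f ∘ φ.symm) (φ x) (VectorField.lieBracket ℝ (P X) (P Y) (φ x)) := by
    change mvfderiv I f x (VectorField.mlieBracket I X Y x) = _
    rw [← fderiv_comp_extChartAt_symm hx hf, hb]
    congr 1
    exact hA.self_apply_inverse _
  rw [h1, VectorField.fderiv_apply_lieBracket hf' (by simpa using two_le_infty) (hP Y hY) (hP X hX),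
    ← (key' Y).fderiv_eq, ← (key' X).fderiv_eq, key X _ x hx (hf.lieDeriv hY),
    key Y _ x hx (hf.lieDeriv hX)]

end Bracket

end

end WeightedJet

namespace WeightedJet

noncomputable section

/-! ### Words in derivations and their reordering -/

section Words

variable {A : Type*} [CommRing A] [Algebra ℝ A] {ι : Type*} (ξ : ι → Derivation ℝ A A)

/-- A derivation, as an element of the algebra of linear endomorphisms. -/
abbrev asEnd (X : Derivation ℝ A A) : Module.End ℝ A := (X : A →ₗ[ℝ] A)

/-- The composition of the derivations `ξ i` along a list of indices. -/
def word (L : List ι) : Module.End ℝ A := (L.map fun i => asEnd (ξ i)).prod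

@[simp]
theorem word_nil : word ξ [] = 1 := rfl

@[simp]
theorem word_cons (i : ι) (L : List ι) :
    word ξ (i :: L) = asEnd (ξ i) * word ξ L := by
  simp [word]

/-- The operators which are linear combinations of compositions of at most `l` derivations of total
weight at most `r`. -/
def wordSpan (w : ι → ℕ) (r l : ℕ) : Submodule A (Module.End ℝ A) :=
  Submodule.span A {D | ∃ L : List ι, (L.map w).sum ≤ r ∧ L.length ≤ l ∧ D = word ξ L}

variable {ξ} {w : ι → ℕ} {r r' l l' : ℕ}

theorem word_mem_wordSpan {L : List ι} (h : (L.map w).sum ≤ r) (h' : L.length ≤ l) :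
    word ξ L ∈ wordSpan ξ w r l := Submodule.subset_span ⟨L, h, h', rfl⟩

theorem wordSpan_mono (h : r ≤ r') (h' : l ≤ l') : wordSpan ξ w r l ≤ wordSpan ξ w r' l' :=
  Submodule.span_mono fun _ ⟨L, hL, hl, hD⟩ => ⟨L, hL.trans h, hl.trans h', hD⟩

/-- The Leibniz rule for operators. The term where `a` is differentiated is shorter by one
derivation, which is why `wordSpan` bounds weight and length from above instead of fixing them. -/
theorem derivation_mul_smul (X : Derivation ℝ A A) (a : A) (D : Module.End ℝ A) :
    asEnd X * (a • D) =
      a • (asEnd X * D) + X a • D := by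
  ext f
  simp [mul_comm]

theorem end_smul_mul (a : A) (D D' : Module.End ℝ A) : (a • D) * D' = a • (D * D') := rfl

theorem mul_mem_wordSpan (i : ι) {D : Module.End ℝ A} (hD : D ∈ wordSpan ξ w r l) :
    asEnd (ξ i) * D ∈ wordSpan ξ w (r + w i) (l + 1) := by
  induction hD using Submodule.span_induction with
  | mem D hD =>
    obtain ⟨L, hL, hl, rfl⟩ := hD
    rw [← word_cons]
    exact word_mem_wordSpan (by simp; omega) (by simpa using hl)
  | zero => simp
  | add D D' _ _ h h' =>
    rw [mul_add]
    exact add_mem h h'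
  | smul a D hD h =>
    rw [derivation_mul_smul]
    exact add_mem (Submodule.smul_mem _ _ h)
      (Submodule.smul_mem _ _ (wordSpan_mono (by omega) (by omega) hD))

/-- Meant for a vector field of weight at most `j` expanded in an adapted frame: its nonzero
coefficients belong to frame fields of weight at most `j`. They stand on the left, so no Leibniz
term arises from them. -/
theorem sum_mul_mem_wordSpan [Fintype ι] {j : ℕ} {c : ι → A} (hc : ∀ i, c i ≠ 0 → w i ≤ j)
    {X : Module.End ℝ A} (hX : X = ∑ i, c i • asEnd (ξ i))
    {D : Module.End ℝ A} (hD : D ∈ wordSpan ξ w r l) :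
    X * D ∈ wordSpan ξ w (r + j) (l + 1) := by
  rw [hX, Finset.sum_mul]
  refine Submodule.sum_mem _ fun i _ => ?_
  rw [end_smul_mul]
  by_cases hi : c i = 0
  · simp [hi]
  · exact Submodule.smul_mem _ _ (wordSpan_mono (by have := hc i hi; omega) le_rfl
      (mul_mem_wordSpan i hD))

theorem comp_mem_wordSpan {D D' : Module.End ℝ A} (hD : D ∈ wordSpan ξ w r l)
    (hD' : D' ∈ wordSpan ξ w r' l') : D * D' ∈ wordSpan ξ w (r + r') (l + l') := by
  induction hD using Submodule.span_induction with
  | mem D hD =>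
    obtain ⟨L, hL, hl, rfl⟩ := hD
    induction L generalizing r l with
    | nil => exact wordSpan_mono (Nat.le_add_left _ _) (Nat.le_add_left _ _) (by simpa using hD')
    | cons i L ih =>
      simp only [List.map_cons, List.sum_cons, List.length_cons] at hL hl
      rw [word_cons, mul_assoc]
      -- The bounds `r - w i` and `l - 1` are honest subtractions, since the word still contains the
      -- letter `i`.
      exact wordSpan_mono (by omega) (by omega)
        (mul_mem_wordSpan i (ih (r := r - w i) (l := l - 1) (by omega) (by omega)))
  | zero => simp
  | add D D' _ _ h h' =>
    rw [add_mul]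
    exact add_mem h h'
  | smul a D hD h =>
    rw [end_smul_mul]
    exact Submodule.smul_mem _ _ h

/-- Multiplication by a function has order zero, so a coefficient to the right of an operator can be
absorbed into it without raising the weight. -/
theorem mulLeft_mem_wordSpan (g : A) : LinearMap.mulLeft ℝ g ∈ wordSpan ξ w 0 0 := by
  have h : LinearMap.mulLeft ℝ g = g • word ξ [] := by
    ext f
    simp
  rw [h]
  exact Submodule.smul_mem _ _ (word_mem_wordSpan (by simp) (by simp))

variable [Fintype ι]
  (hbr : ∀ i j, ∃ c : ι → A, (∀ k, c k ≠ 0 → w k ≤ w i + w j) ∧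
    asEnd (ξ i) * asEnd (ξ j) -
      asEnd (ξ j) * asEnd (ξ i) =
        ∑ k, c k • asEnd (ξ k))

include hbr

/-- Permuting the derivations changes a composition by shorter ones of at most the same weight. -/
theorem word_sub_word_mem {L L' : List ι} (h : L.Perm L') :
    word ξ L - word ξ L' ∈ wordSpan ξ w (L.map w).sum (L.length - 1) := by
  induction h with
  | nil => simp
  | cons i h ih =>
    rename_i L₁ L₂
    rw [word_cons, word_cons, ← mul_sub]
    -- For an empty tail the truncated length is `0`, and adding a letter would exceed the bound;
    -- but then the two words coincide.
    rcases L₁ with _ | ⟨j, L₁⟩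
    · rw [List.nil_perm.1 h]
      simp
    · exact wordSpan_mono (by simp; omega) (by simp) (mul_mem_wordSpan i ih)
  | swap i j L =>
    simp only [word_cons, ← mul_assoc, ← sub_mul]
    obtain ⟨c, hc, h⟩ := hbr j i
    exact wordSpan_mono (by simp; omega) (by simp) (sum_mul_mem_wordSpan hc h
      (word_mem_wordSpan (L := L) le_rfl le_rfl))
  | trans h₁ h₂ ih₁ ih₂ =>
    rw [← sub_add_sub_cancel]
    refine add_mem ih₁ ?_
    rwa [(h₁.map w).sum_eq, h₁.length_eq]

/-- The ordered compositions span all compositions. -/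
theorem wordSpan_le_span_sorted [LinearOrder ι] (r l : ℕ) : wordSpan ξ w r l ≤
    Submodule.span A {D | ∃ L : List ι, L.Pairwise (· ≤ ·) ∧ (L.map w).sum ≤ r ∧
      D = word ξ L} := by
  induction l with
  | zero =>
    refine Submodule.span_mono ?_
    rintro _ ⟨L, hL, hl, rfl⟩
    obtain rfl : L = [] := by simpa using hl
    exact ⟨[], by simp, by simp, rfl⟩
  | succ l ih =>
    refine Submodule.span_le.2 ?_
    rintro _ ⟨L, hL, hl, rfl⟩
    -- Sorting changes the word only by strictly shorter ones of no larger weight, to which the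
    -- induction on length applies.
    have hp : L.Perm (L.insertionSort (· ≤ ·)) := (List.perm_insertionSort _ L).symm
    rw [← sub_add_cancel (word ξ L) (word ξ (L.insertionSort (· ≤ ·)))]
    refine add_mem (ih (wordSpan_mono hL (by omega) (word_sub_word_mem hbr hp))) ?_
    exact Submodule.subset_span ⟨_, List.pairwise_insertionSort _ L,
      by rwa [← (hp.map w).sum_eq], rfl⟩

end Words

/-! ### Germs of smooth functions, on which vector fields act as derivations -/

section Germs

variable {E₀ : Type*} [NormedAddCommGroup E₀] [NormedSpace ℝ E₀]
  {H : Type*} [TopologicalSpace H] (I : ModelWithCorners ℝ E₀ H)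
  {M : Type*} [TopologicalSpace M] [ChartedSpace H M] (x : M)

/-- The functions which are smooth near `x`. -/
def smoothAt : Subalgebra ℝ (M → ℝ) where
  carrier := {f | SmoothNear I f x}
  mul_mem' := SmoothNear.mul
  add_mem' := SmoothNear.add
  algebraMap_mem' c := SmoothNear.const c x

/-- The functions which vanish near `x`. -/
def vanishingIdeal : Ideal (smoothAt I x) where
  carrier := {f | f.1 =ᶠ[𝓝 x] 0}
  zero_mem' := EventuallyEq.rfl
  add_mem' {f g} hf hg := by
    filter_upwards [hf, hg] with y h h'
    simp [h, h']
  smul_mem' f g hg := by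
    filter_upwards [hg] with y h
    simp [h]

/-- The algebra of germs at `x` of smooth functions. -/
def SmoothGerm : Type _ := smoothAt I x ⧸ vanishingIdeal I x

instance : CommRing (SmoothGerm I x) :=
  inferInstanceAs (CommRing (smoothAt I x ⧸ vanishingIdeal I x))

instance : Algebra ℝ (SmoothGerm I x) :=
  inferInstanceAs (Algebra ℝ (smoothAt I x ⧸ vanishingIdeal I x))

variable {I x}

/-- The germ of a smooth function. -/
def germ (f : M → ℝ) (hf : SmoothNear I f x) : SmoothGerm I x :=
  Ideal.Quotient.mk (vanishingIdeal I x) ⟨f, hf⟩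

theorem exists_germ (g : SmoothGerm I x) : ∃ f, ∃ hf : SmoothNear I f x, germ f hf = g := by
  obtain ⟨⟨f, hf⟩, rfl⟩ := Ideal.Quotient.mk_surjective g
  exact ⟨f, hf, rfl⟩

theorem germ_eq_iff {f g : M → ℝ} {hf : SmoothNear I f x} {hg : SmoothNear I g x} :
    germ f hf = germ g hg ↔ f =ᶠ[𝓝 x] g := by
  refine Ideal.Quotient.eq.trans ?_
  change (f - g) =ᶠ[𝓝 x] 0 ↔ _
  simp only [EventuallyEq, Pi.sub_apply, Pi.zero_apply, sub_eq_zero]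

theorem germ_add {f g : M → ℝ} (hf : SmoothNear I f x) (hg : SmoothNear I g x) :
    germ f hf + germ g hg = germ (fun y => f y + g y) (hf.add hg) := rfl

theorem germ_mul {f g : M → ℝ} (hf : SmoothNear I f x) (hg : SmoothNear I g x) :
    germ f hf * germ g hg = germ (fun y => f y * g y) (hf.mul hg) := rfl

theorem smul_germ {f : M → ℝ} (c : ℝ) (hf : SmoothNear I f x) :
    c • germ f hf = germ (fun y => c * f y) ((SmoothNear.const c x).mul hf) := rfl

/-- The value at `x` of a germ. -/
def germEval : SmoothGerm I x →ₐ[ℝ] ℝ :=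
  Ideal.Quotient.liftₐ (vanishingIdeal I x)
    ((Pi.evalAlgHom ℝ (fun _ : M => ℝ) x).comp (smoothAt I x).val) fun _ hf => hf.self_of_nhds

@[simp]
theorem germEval_germ {f : M → ℝ} (hf : SmoothNear I f x) : germEval (germ f hf) = f x := rfl

variable [IsManifold I 1 M]

/-- The derivation of the germs at `x` given by a vector field. -/
def germDeriv (X : ∀ y : M, TangentSpace I y) (hX : SmoothFieldNear I X x) :
    Derivation ℝ (SmoothGerm I x) (SmoothGerm I x) :=
  let D : SmoothGerm I x → SmoothGerm I x := fun g =>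
    germ (lieDeriv X (exists_germ g).choose) ((exists_germ g).choose_spec.choose.lieDeriv hX)
  -- The derivative of a germ does not depend on the representative chosen in `D`.
  have hD : ∀ f (hf : SmoothNear I f x), D (germ f hf) = germ (lieDeriv X f) (hf.lieDeriv hX) :=
    fun f hf => germ_eq_iff.2
      (lieDeriv_congr (germ_eq_iff.1 (exists_germ (germ f hf)).choose_spec.choose_spec))
  Derivation.mk'
    { toFun := D
      map_add' := by
        intro a b
        obtain ⟨f, hf, rfl⟩ := exists_germ a
        obtain ⟨g, hg, rfl⟩ := exists_germ b
        rw [germ_add, hD, hD, hD, germ_add, germ_eq_iff]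
        exact lieDeriv_add hf hg
      map_smul' := by
        intro c a
        obtain ⟨f, hf, rfl⟩ := exists_germ a
        rw [smul_germ, hD, hD, RingHom.id_apply, smul_germ, germ_eq_iff]
        exact lieDeriv_const_mul c hf }
    (by
      intro a b
      obtain ⟨f, hf, rfl⟩ := exists_germ a
      obtain ⟨g, hg, rfl⟩ := exists_germ b
      simp only [LinearMap.coe_mk, AddHom.coe_mk, smul_eq_mul]
      rw [germ_mul, hD, hD, hD, germ_mul, germ_mul, germ_add, germ_eq_iff]
      filter_upwards [hf.eventually, hg.eventually] with y hfy hgy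
      exact lieDeriv_mul hfy hgy)

theorem germDeriv_germ {X : ∀ y : M, TangentSpace I y} (hX : SmoothFieldNear I X x) {f : M → ℝ}
    (hf : SmoothNear I f x) : germDeriv X hX (germ f hf) = germ (lieDeriv X f) (hf.lieDeriv hX) :=
  germ_eq_iff.2
      (lieDeriv_congr (germ_eq_iff.1 (exists_germ (germ f hf)).choose_spec.choose_spec))

end Germs

end

end WeightedJet

namespace WeightedJet

noncomputable section

/-! ### Bases adapted to a flag of subspaces -/

section Flags

variable {V : Type*} [AddCommGroup V] [Module ℝ V]

/-- A flag has an adapted basis whose members are taken from given generating sets. -/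
theorem exists_adapted_set {F : ℕ → Submodule ℝ V} (h0 : F 0 = ⊥) (hmono : Monotone F)
    {P : ℕ → Set V} (hP : ∀ j, P j ⊆ F j)
    (hspan : ∀ j, F (j + 1) ≤ Submodule.span ℝ (P (j + 1)) ⊔ F j) (k : ℕ) :
    ∃ (B : Set V) (W : V → ℕ), LinearIndepOn ℝ id B ∧
      (∀ v ∈ B, 1 ≤ W v ∧ W v ≤ k ∧ v ∈ P (W v)) ∧
      ∀ j ≤ k, Submodule.span ℝ {v ∈ B | W v ≤ j} = F j := by
  classical
  induction k with
  | zero =>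
    refine ⟨∅, fun _ => 0, linearIndepOn_empty ℝ id, by simp, fun j hj => ?_⟩
    obtain rfl : j = 0 := by omega
    simp [h0]
  | succ k ih =>
    obtain ⟨B, W, hli, hB, hF⟩ := ih
    -- The basis of `F k` is enlarged inside `B ∪ P (k + 1)`; the vectors added are those of weight
    -- `k + 1`.
    obtain ⟨B', hB't, hBB', htB', hli'⟩ := exists_linearIndepOn_id_extension hli
      (subset_union_left (s := B) (t := P (k + 1)))
    have hBk : Submodule.span ℝ B = F k := by
      rw [← hF k le_rfl]
      congr 1
      ext v
      exact ⟨fun h => ⟨h, (hB v h).2.1⟩, fun h => h.1⟩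
    refine ⟨B', fun v => if v ∈ B then W v else k + 1, hli', fun v hv => ?_, fun j hj => ?_⟩
    · by_cases hvB : v ∈ B
      · simp only [hvB, if_true]
        exact ⟨(hB v hvB).1, (hB v hvB).2.1.trans (by omega), (hB v hvB).2.2⟩
      · simp only [hvB, if_false]
        exact ⟨by omega, le_rfl, (hB't hv).resolve_left hvB⟩
    · rcases Nat.lt_or_ge k j with hkj | hkj
      · obtain rfl : j = k + 1 := by omega
        have h1 : {v ∈ B' | (if v ∈ B then W v else k + 1) ≤ k + 1} = B' := by
          ext v
          refine ⟨fun h => h.1, fun h => ⟨h, ?_⟩⟩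
          by_cases hvB : v ∈ B
          · simp only [hvB, if_true]
            exact (hB v hvB).2.1.trans (by omega)
          · simp [hvB]
        rw [h1]
        apply le_antisymm
        · refine Submodule.span_le.2 fun v hv => ?_
          rcases hB't hv with h | h
          · exact hmono (Nat.le_succ k) (hBk ▸ Submodule.subset_span h)
          · exact hP _ h
        · refine (hspan k).trans (sup_le (Submodule.span_le.2 (subset_union_right.trans htB')) ?_)
          rw [← hBk]
          exact Submodule.span_mono hBB'
      · rw [← hF j hkj]
        congr 1
        ext v
        constructor
        · rintro ⟨h, h'⟩
          by_cases hvB : v ∈ B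
          · simp only [hvB, if_true] at h'
            exact ⟨hvB, h'⟩
          · simp only [hvB, if_false] at h'
            omega
        · rintro ⟨h, h'⟩
          exact ⟨hBB' h, by simpa only [h, if_true] using h'⟩

end Flags

/-! ### Frames of vector fields adapted to the filtration -/

section AdaptedFrames

variable {E₀ : Type*} [NormedAddCommGroup E₀] [NormedSpace ℝ E₀]
  {H : Type*} [TopologicalSpace H] (I : ModelWithCorners ℝ E₀ H)
  (M : Type*) [TopologicalSpace M] [ChartedSpace H M] [IsManifold I ∞ M]

instance : ContMDiffVectorBundle ∞ E₀ (TangentSpace I (M := M)) I :=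
  have : IsManifold I (∞ + 1 : ℕ∞ω) M := inferInstanceAs (IsManifold I ∞ M)
  TangentBundle.contMDiffVectorBundle

/-- The smooth local vector fields. -/
def fieldSections : SmoothSections I (fun y : M => TangentSpace I y) :=
  bundleSections I E₀ (fun y : M => TangentSpace I y)

variable {I M}

/-- The vector fields `ξ i`, with weights `w i`, form a frame adapted to the filtration at `y`. -/
structure IsAdaptedAt (𝓕 : Filtration I M) {ι : Type*} [Fintype ι]
    (ξ : ι → ∀ y : M, TangentSpace I y) (w : ι → ℕ) (y : M) : Prop where
  pos : ∀ i, 1 ≤ w i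
  isSection : ∀ i, 𝓕.IsSectionNear (w i) (ξ i) y
  isFrame : IsFrameAt I (fieldSections I M).near ξ y
  span_eq : ∀ j, Submodule.span ℝ ((fun i => ξ i y) '' {i | w i ≤ j}) = 𝓕.T j y

variable {𝓕 : Filtration I M} {x : M}

theorem Filtration.IsSectionNear.eventually {j : ℕ} {X : ∀ y : M, TangentSpace I y}
    (h : 𝓕.IsSectionNear j X x) : ∀ᶠ y in 𝓝 x, 𝓕.IsSectionNear j X y := by
  filter_upwards [SmoothSectionNear.eventually h.1, eventually_eventually_nhds.2 h.2] with y h1 h2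
  exact ⟨h1, h2⟩

theorem Filtration.IsSectionNear.mono {i j : ℕ} (hij : i ≤ j) {X : ∀ y : M, TangentSpace I y}
    (h : 𝓕.IsSectionNear i X x) : 𝓕.IsSectionNear j X x :=
  ⟨h.1, h.2.mono fun y hy => 𝓕.mono i j y hij hy⟩

theorem Filtration.IsSectionNear.sum {j : ℕ} {κ : Type*} (s : Finset κ) {c : κ → M → ℝ}
    {X : κ → ∀ y : M, TangentSpace I y} (hc : ∀ i ∈ s, SmoothNear I (c i) x)
    (h : ∀ i ∈ s, 𝓕.IsSectionNear j (X i) x) :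
    𝓕.IsSectionNear j (fun y => ∑ i ∈ s, c i y • X i y) x :=
  ⟨(fieldSections I M).isSheafLike.sum_smul_mem s hc fun i hi => (h i hi).1,
    ((eventually_all_finset s).2 fun i hi => (h i hi).2).mono fun _ hy =>
      Submodule.sum_mem _ fun i hi => Submodule.smul_mem _ _ (hy i hi)⟩

/-- Extend with constant coefficients in a local frame of the subbundle. -/
theorem Filtration.exists_section (j : ℕ) (v : TangentSpace I x)
    (hv : v ∈ 𝓕.T j x) :
    ∃ X, 𝓕.IsSectionNear j X x ∧ X x = v := by
  obtain ⟨n, e, he, h⟩ := 𝓕.subbundle j x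
  rw [← h.self_of_nhds.2, Submodule.mem_span_range_iff_exists_fun] at hv
  obtain ⟨c, rfl⟩ := hv
  refine ⟨fun y => ∑ a, c a • e a y, Filtration.IsSectionNear.sum Finset.univ
    (c := fun a _ => c a) (fun a _ => SmoothNear.const _ x) fun a _ => ⟨he a, ?_⟩, rfl⟩
  filter_upwards [h] with y hy
  rw [← hy.2]
  exact Submodule.subset_span ⟨a, rfl⟩

theorem Filtration.eventually_finrank_eq (𝓕 : Filtration I M) (j : ℕ) (x : M) :
    ∀ᶠ y in 𝓝 x, Module.finrank ℝ (𝓕.T j y) = Module.finrank ℝ (𝓕.T j x) := by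
  obtain ⟨n, e, -, h⟩ := 𝓕.subbundle j x
  filter_upwards [h] with y hy
  rw [← hy.2, ← h.self_of_nhds.2, finrank_span_eq_card hy.1,
    finrank_span_eq_card h.self_of_nhds.1]

variable [FiniteDimensional ℝ E₀]

/-- A basis of the tangent space at `x` adapted to the flag, made of values of fields from the sets
`P j`, stays a frame near `x`. It stays adapted because the fields of weight at most `j` span a
subspace of `T⁻ʲM` of the same, locally constant, dimension. The sets `P j` are a parameter so that
the fields can be all sections or only those generated by `T⁻¹M`. -/
theorem exists_adapted_frame {P : ℕ → Set (∀ y : M, TangentSpace I y)}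
    (hP : ∀ j, ∀ X ∈ P j, 𝓕.IsSectionNear j X x)
    (hspan : ∀ j, 𝓕.T (j + 1) x ≤
      Submodule.span ℝ ((fun X : ∀ y : M, TangentSpace I y => X x) '' P (j + 1)) ⊔ 𝓕.T j x) :
    ∃ (n : ℕ) (ξ : Fin n → ∀ y : M, TangentSpace I y) (w : Fin n → ℕ),
      (∀ i, ξ i ∈ P (w i)) ∧ ∀ᶠ y in 𝓝 x, IsAdaptedAt 𝓕 ξ w y := by
  have hfd : ∀ y : M, FiniteDimensional ℝ (TangentSpace I y) :=
    fun y => inferInstanceAs (FiniteDimensional ℝ E₀)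
  obtain ⟨k, hk⟩ := 𝓕.exhaustive
  obtain ⟨B, W, hli, hB, hF⟩ := exists_adapted_set (F := fun j => 𝓕.T j x) (𝓕.zero x)
    (fun i j hij => 𝓕.mono i j x hij)
    (P := fun j => (fun X : ∀ y : M, TangentSpace I y => X x) '' P j)
    (by rintro j _ ⟨X, hX, rfl⟩; exact (hP j X hX).2.self_of_nhds) hspan k
  have hfin : Finite B := hli.finite
  obtain ⟨n, ⟨φ⟩⟩ := Finite.exists_equiv_fin B
  have hX : ∀ i : Fin n, ∃ X ∈ P (W (φ.symm i)), X x = φ.symm i := fun i => (hB _ (φ.symm i).2).2.2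
  choose ξ hξ hξx using hX
  let w : Fin n → ℕ := fun i => W (φ.symm i)
  have hwk : ∀ i, w i ≤ k := fun i => (hB _ (φ.symm i).2).2.1
  have himg : ∀ j, (fun i => ξ i x) '' {i | w i ≤ j} = {v ∈ B | W v ≤ j} := by
    intro j
    ext v
    constructor
    · rintro ⟨i, hi, rfl⟩
      simp only [hξx]
      exact ⟨(φ.symm i).2, hi⟩
    · rintro ⟨hv, hj⟩
      exact ⟨φ ⟨v, hv⟩, by simpa [w] using hj, by simp [hξx]⟩
  have hsec : ∀ i, 𝓕.IsSectionNear (w i) (ξ i) x := fun i => hP _ _ (hξ i)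
  have hlix : LinearIndependent ℝ fun i => ξ i x := by
    simp only [hξx]
    exact hli.linearIndependent.comp φ.symm φ.symm.injective
  have hspx : Submodule.span ℝ (range fun i => ξ i x) = ⊤ := by
    rw [← hk x, ← hF k le_rfl, ← himg k, ← image_univ]
    congr 2
    ext i
    simp [hwk]
  obtain ⟨m, e, he⟩ := (isVectorBundle_bundleSections I E₀
    (fun y : M => TangentSpace I y)).exists_frame x
  have hframe : ∀ᶠ y in 𝓝 x, IsFrameAt I (fieldSections I M).near ξ y :=
    isFrameAt_of_basis (bundleSections I E₀ (fun y : M => TangentSpace I y)).isSheafLike he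
      (fun i => (hsec i).1) hlix hspx
  refine ⟨n, ξ, w, hξ, ?_⟩
  have hfr : ∀ᶠ y in 𝓝 x, ∀ j ∈ Finset.range (k + 1),
      Module.finrank ℝ (𝓕.T j y) = Module.finrank ℝ (𝓕.T j x) :=
    (eventually_all_finset _).2 fun j _ => 𝓕.eventually_finrank_eq j x
  filter_upwards [hframe, hfr, eventually_all.2 fun i => (hsec i).eventually] with y hy hr hs
  have hle : ∀ j, Submodule.span ℝ ((fun i => ξ i y) '' {i | w i ≤ j}) ≤ 𝓕.T j y := by
    intro j
    rw [Submodule.span_le]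
    rintro _ ⟨i, hi, rfl⟩
    exact 𝓕.mono _ _ y hi (hs i).2.self_of_nhds
  have hcard : ∀ (z : M), LinearIndependent ℝ (fun i => ξ i z) → ∀ j,
      Module.finrank ℝ (Submodule.span ℝ ((fun i => ξ i z) '' {i | w i ≤ j})) =
        Fintype.card {i | w i ≤ j} := by
    intro z hz j
    rw [image_eq_range]
    exact finrank_span_eq_card (hz.comp _ Subtype.val_injective)
  have heq : ∀ j ≤ k, Submodule.span ℝ ((fun i => ξ i y) '' {i | w i ≤ j}) = 𝓕.T j y := by
    intro j hj
    refine Submodule.eq_of_le_of_finrank_eq (hle j) ?_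
    rw [hr j (by simpa using Nat.lt_succ_of_le hj), hcard y hy.linearIndependent, ← hF j hj,
      ← himg j, hcard x hlix]
  refine ⟨fun i => (hB _ (φ.symm i).2).1, hs, hy, fun j => ?_⟩
  -- Ranks were compared only for the finitely many `j ≤ k`; beyond `k` the filtration is already
  -- the whole tangent space.
  rcases le_total j k with hj | hj
  · exact heq j hj
  · refine le_antisymm (hle j) ?_
    calc 𝓕.T j y ≤ 𝓕.T k y := by rw [hk y]; exact le_top
      _ = _ := (heq k le_rfl).symm
      _ ≤ _ := Submodule.span_mono (image_mono fun i hi => le_trans hi hj)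

theorem exists_section_frame (𝓕 : Filtration I M) (x : M) :
    ∃ (n : ℕ) (ξ : Fin n → ∀ y : M, TangentSpace I y) (w : Fin n → ℕ),
      ∀ᶠ y in 𝓝 x, IsAdaptedAt 𝓕 ξ w y := by
  obtain ⟨n, ξ, w, -, h⟩ := exists_adapted_frame (𝓕 := 𝓕) (x := x)
    (P := fun j => {X | 𝓕.IsSectionNear j X x}) (fun j X hX => hX) fun j v hv => by
      obtain ⟨X, hX, rfl⟩ := 𝓕.exists_section (j + 1) v hv
      exact Submodule.mem_sup_left (Submodule.subset_span ⟨X, hX, rfl⟩)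
  exact ⟨n, ξ, w, h⟩

variable {ι : Type*} [Fintype ι] {ξ : ι → ∀ y : M, TangentSpace I y} {w : ι → ℕ} {y : M}

theorem IsAdaptedAt.frameCoord_eq_zero (h : IsAdaptedAt 𝓕 ξ w y) {j : ℕ} {v : TangentSpace I y}
    (hv : v ∈ 𝓕.T j y) {i : ι} (hi : j < w i) : frameCoord ξ i y v = 0 := by
  classical
  rw [← h.span_eq j] at hv
  induction hv using Submodule.span_induction with
  | mem v hv =>
    obtain ⟨i', hi', rfl⟩ := hv
    rw [h.isFrame.frameCoord_self, if_neg]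
    rintro rfl
    exact absurd hi' (by simpa using hi)
  | zero => simp
  | add a b _ _ h1 h2 => rw [map_add, h1, h2, add_zero]
  | smul c a _ h1 => rw [map_smul, h1, smul_zero]

/-- A section of `T⁻ʲM` is a combination, with smooth coefficients, of the fields of weight at
most `j` of an adapted frame. -/
theorem exists_coeff (h : ∀ᶠ z in 𝓝 y, IsAdaptedAt 𝓕 ξ w z) {j : ℕ}
    {X : ∀ y : M, TangentSpace I y} (hX : 𝓕.IsSectionNear j X y) :
    ∃ c : ι → M → ℝ, (∀ i, SmoothNear I (c i) y) ∧ (∀ i, j < w i → c i = 0) ∧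
      ∀ᶠ z in 𝓝 y, X z = ∑ i, c i z • ξ i z := by
  classical
  -- Coordinates of too large weight vanish only near `y`; they are replaced by the zero function so
  -- that they vanish identically.
  refine ⟨fun i => if w i ≤ j then fun z => frameCoord ξ i z (X z) else 0, fun i => ?_,
    fun i hi => if_neg (not_le.2 hi), ?_⟩
  · by_cases hi : w i ≤ j
    · simp only [hi, if_true]
      exact smoothNear_frameCoord (h.mono fun z hz => hz.isFrame) hX.1 i
    · simp only [hi, if_false]
      exact SmoothNear.const 0 y
  · filter_upwards [h, hX.2] with z hz hXz
    conv_lhs => rw [← hz.isFrame.sum_frameCoord (X z)]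
    refine Finset.sum_congr rfl fun i _ => ?_
    by_cases hi : w i ≤ j
    · simp [hi]
    · simp only [hi, if_false]
      rw [hz.frameCoord_eq_zero hXz (not_le.1 hi)]
      simp

end AdaptedFrames

end

end WeightedJet

namespace WeightedJet

noncomputable section

/-! ### Weighted differential operators as combinations of words in an adapted frame -/

section FieldOperators

variable {E₀ : Type*} [NormedAddCommGroup E₀] [NormedSpace ℝ E₀]
  {H : Type*} [TopologicalSpace H] {I : ModelWithCorners ℝ E₀ H}
  {M : Type*} [TopologicalSpace M] [ChartedSpace H M] [IsManifold I ∞ M]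
  {𝓕 : Filtration I M} {x : M}

theorem germ_sum {κ : Type*} (s : Finset κ) {f : κ → M → ℝ} (hf : ∀ i, SmoothNear I (f i) x) :
    germ (fun y => ∑ i ∈ s, f i y) (SmoothNear.sum s fun i _ => hf i) =
      ∑ i ∈ s, germ (f i) (hf i) := by
  classical
  induction s using Finset.induction_on with
  | empty => rfl
  | insert a s ha ih =>
    rw [Finset.sum_insert ha, ← ih, germ_add, germ_eq_iff]
    exact Eventually.of_forall fun y => Finset.sum_insert ha

/-- The derivations of the germs at `x` given by a family of vector fields. -/
def fieldDeriv {κ : Type*} (ξ : κ → ∀ y : M, TangentSpace I y)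
    (hξ : ∀ i, SmoothFieldNear I (ξ i) x) (i : κ) :
    Derivation ℝ (SmoothGerm I x) (SmoothGerm I x) := germDeriv (ξ i) (hξ i)

theorem SmoothNear.iterDeriv_map {κ : Type*} {ξ : κ → ∀ y : M, TangentSpace I y}
    (hξ : ∀ i, SmoothFieldNear I (ξ i) x) (L : List κ) {f : M → ℝ} (hf : SmoothNear I f x) :
    SmoothNear I (Filtration.iterDeriv (L.map ξ) f) x :=
  Filtration.SmoothNear.iterDeriv hf _ fun X hX => by
    obtain ⟨i, -, rfl⟩ := List.mem_map.1 hX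
    exact hξ i

theorem word_germ {κ : Type*} {ξ : κ → ∀ y : M, TangentSpace I y}
    (hξ : ∀ i, SmoothFieldNear I (ξ i) x) (L : List κ) {f : M → ℝ} (hf : SmoothNear I f x) :
    word (fieldDeriv ξ hξ) L (germ f hf) =
      germ (Filtration.iterDeriv (L.map ξ) f) (SmoothNear.iterDeriv_map hξ L hf) := by
  induction L with
  | nil => rfl
  | cons i L ih =>
    rw [word_cons, Module.End.mul_apply, ih]
    exact germDeriv_germ (hξ i) _

theorem germDeriv_eq_sum {κ : Type*} [Fintype κ] {ξ : κ → ∀ y : M, TangentSpace I y}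
    (hξ : ∀ i, SmoothFieldNear I (ξ i) x) {X : ∀ y : M, TangentSpace I y}
    (hX : SmoothFieldNear I X x) {c : κ → M → ℝ} (hc : ∀ i, SmoothNear I (c i) x)
    (h : ∀ᶠ y in 𝓝 x, X y = ∑ i, c i y • ξ i y) :
    asEnd (germDeriv X hX) =
      ∑ i, germ (c i) (hc i) • asEnd (fieldDeriv ξ hξ i) := by
  refine LinearMap.ext fun a => ?_
  obtain ⟨f, hf, rfl⟩ := exists_germ a
  rw [LinearMap.sum_apply]
  change germDeriv X hX (germ f hf) = ∑ i, germ (c i) (hc i) * germDeriv (ξ i) (hξ i) (germ f hf)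
  simp only [germDeriv_germ, germ_mul]
  rw [← germ_sum Finset.univ fun i => (hc i).mul (hf.lieDeriv (hξ i)), germ_eq_iff]
  filter_upwards [h] with y hy
  simp only [lieDeriv]
  rw [hy, map_sum]
  simp

theorem germDeriv_smul_add {X Y : ∀ y : M, TangentSpace I y} (hX : SmoothFieldNear I X x)
    (hY : SmoothFieldNear I Y x) (c : ℝ) (hXY : SmoothFieldNear I (c • X + Y) x) :
    germDeriv (c • X + Y) hXY = c • germDeriv X hX + germDeriv Y hY := by
  refine Derivation.ext fun a => ?_
  obtain ⟨f, hf, rfl⟩ := exists_germ a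
  rw [Derivation.add_apply, Derivation.smul_apply]
  simp only [germDeriv_germ, smul_germ, germ_add, germ_eq_iff]
  refine Eventually.of_forall fun y => ?_
  simp only [lieDeriv, Pi.add_apply, Pi.smul_apply, map_add, map_smul, smul_eq_mul]

/-- The index type is arbitrary because the lemma is applied to an adapted frame, to a single field,
and to a frame with one field adjoined. -/
theorem iterDeriv_mem_diffOp {κ : Type*} {ξ : κ → ∀ y : M, TangentSpace I y} {w : κ → ℕ}
    (hw : ∀ i, 1 ≤ w i) (hξ : ∀ i, 𝓕.IsSectionNear (w i) (ξ i) x) {r : ℕ} {L : List κ}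
    (hL : (L.map w).sum ≤ r) : Filtration.iterDeriv (L.map ξ) ∈ 𝓕.diffOp r x := by
  refine Submodule.subset_span ⟨fun _ => 1, L.map fun i => (ξ i, w i), SmoothNear.const 1 x,
    ?_, ?_, ?_⟩
  · intro p hp
    obtain ⟨i, -, rfl⟩ := List.mem_map.1 hp
    exact ⟨hw i, hξ i⟩
  · simpa [List.map_map, Function.comp_def] using hL
  · simp [List.map_map, Function.comp_def]

variable [FiniteDimensional ℝ E₀]

theorem germDeriv_mlieBracket [I.Boundaryless] {X Y : ∀ y : M, TangentSpace I y}
    (hX : SmoothFieldNear I X x) (hY : SmoothFieldNear I Y x) :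
    asEnd (germDeriv (VectorField.mlieBracket I X Y) (hX.mlieBracket hY)) =
      asEnd (germDeriv X hX) *
        asEnd (germDeriv Y hY) -
      asEnd (germDeriv Y hY) *
        asEnd (germDeriv X hX) := by
  refine LinearMap.ext fun a => ?_
  obtain ⟨f, hf, rfl⟩ := exists_germ a
  rw [LinearMap.sub_apply, Module.End.mul_apply, Module.End.mul_apply, Derivation.coeFn_coe,
    Derivation.coeFn_coe, Derivation.coeFn_coe, germDeriv_germ, germDeriv_germ, germDeriv_germ,
    germDeriv_germ, germDeriv_germ, eq_sub_iff_add_eq, germ_add, germ_eq_iff]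
  filter_upwards [SmoothSectionNear.eventually hX, SmoothSectionNear.eventually hY, hf.eventually]
    with y h1 h2 h3
  rw [lieDeriv_mlieBracket h1 h2 h3]
  ring

theorem Filtration.IsSectionNear.mlieBracket {i j : ℕ} {X Y : ∀ y : M, TangentSpace I y}
    (hX : 𝓕.IsSectionNear i X x) (hY : 𝓕.IsSectionNear j Y x) :
    𝓕.IsSectionNear (i + j) (VectorField.mlieBracket I X Y) x := by
  refine ⟨hX.1.mlieBracket hY.1, ?_⟩
  filter_upwards [hX.eventually, hY.eventually] with y h1 h2
  exact 𝓕.bracket i j y X Y h1.1 h1.2 h2.1 h2.2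

variable {ι : Type*} [Fintype ι] {ξ : ι → ∀ y : M, TangentSpace I y} {w : ι → ℕ}

theorem germDeriv_eq_sum_of_adapted (h : ∀ᶠ y in 𝓝 x, IsAdaptedAt 𝓕 ξ w y)
    (hξ : ∀ i, SmoothFieldNear I (ξ i) x) {j : ℕ} {X : ∀ y : M, TangentSpace I y}
    (hX : 𝓕.IsSectionNear j X x) :
    ∃ c : ι → SmoothGerm I x, (∀ i, c i ≠ 0 → w i ≤ j) ∧
      asEnd (germDeriv X hX.1) =
      ∑ i, c i • asEnd (fieldDeriv ξ hξ i) := by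
  obtain ⟨c, hc, hc0, hcX⟩ := exists_coeff h hX
  refine ⟨fun i => germ (c i) (hc i), fun i hi => ?_, germDeriv_eq_sum hξ hX.1 hc hcX⟩
  by_contra hlt
  refine hi (germ_eq_iff (hg := SmoothNear.const 0 x) |>.2 ?_)
  rw [hc0 i (not_le.1 hlt)]
  rfl

/-- The compatibility of the filtration with the bracket enters the reordering of words here: this
is the hypothesis `hbr` of `wordSpan_le_span_sorted`. -/
theorem commutator_eq_sum [I.Boundaryless] (h : ∀ᶠ y in 𝓝 x, IsAdaptedAt 𝓕 ξ w y)
    (hξ : ∀ i, SmoothFieldNear I (ξ i) x) (i j : ι) :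
    ∃ c : ι → SmoothGerm I x, (∀ k, c k ≠ 0 → w k ≤ w i + w j) ∧
    asEnd (fieldDeriv ξ hξ i) *
      asEnd (fieldDeriv ξ hξ j) -
      asEnd (fieldDeriv ξ hξ j) *
      asEnd (fieldDeriv ξ hξ i) =
        ∑ k, c k • asEnd (fieldDeriv ξ hξ k) := by
  have hs := h.self_of_nhds.isSection
  obtain ⟨c, hc, hcX⟩ := germDeriv_eq_sum_of_adapted h hξ ((hs i).mlieBracket (hs j))
  exact ⟨c, hc, by rw [← hcX, germDeriv_mlieBracket]; rfl⟩

/-- Each field is expanded in the adapted frame in turn, starting from the innermost; neither the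
total weight nor the number of factors grows. -/
theorem exists_wordSpan_of_list (h : ∀ᶠ y in 𝓝 x, IsAdaptedAt 𝓕 ξ w y)
    (hξ : ∀ i, SmoothFieldNear I (ξ i) x) (L : List ((∀ y : M, TangentSpace I y) × ℕ))
    (hL : ∀ p ∈ L, 1 ≤ p.2 ∧ 𝓕.IsSectionNear p.2 p.1 x) :
    ∃ D ∈ wordSpan (fieldDeriv ξ hξ) w (L.map Prod.snd).sum L.length,
      ∀ f (hf : SmoothNear I f x), ∃ hf', germ (Filtration.iterDeriv (L.map Prod.fst) f) hf' =
        D (germ f hf) := by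
  induction L with
  | nil => exact ⟨1, word_mem_wordSpan (L := []) le_rfl le_rfl, fun f hf => ⟨hf, rfl⟩⟩
  | cons p L ih =>
    obtain ⟨D, hD, hDf⟩ := ih fun q hq => hL q (by simp [hq])
    have hp := (hL p (by simp)).2
    obtain ⟨c, hc, hX⟩ := germDeriv_eq_sum_of_adapted h hξ hp
    refine ⟨_, wordSpan_mono (by simp; omega) (by simp) (sum_mul_mem_wordSpan hc hX hD),
      fun f hf => ?_⟩
    obtain ⟨hf', h'⟩ := hDf f hf
    refine ⟨hf'.lieDeriv hp.1, ?_⟩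
    rw [Module.End.mul_apply, ← h']
    exact (germDeriv_germ hp.1 hf').symm

/-- A differential operator of weighted order at most `r` acts as a combination of words of weight
at most `r` in an adapted frame. -/
theorem exists_wordSpan_of_diffOp (h : ∀ᶠ y in 𝓝 x, IsAdaptedAt 𝓕 ξ w y)
    (hξ : ∀ i, SmoothFieldNear I (ξ i) x) {r : ℕ} {D : (M → ℝ) → M → ℝ}
    (hD : D ∈ 𝓕.diffOp r x) :
    ∃ D' ∈ wordSpan (fieldDeriv ξ hξ) w r r, ∀ f (hf : SmoothNear I f x),
      D f x = germEval (D' (germ f hf)) := by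
  induction hD using Submodule.span_induction with
  | mem D hD =>
    obtain ⟨c, L, hc, hL, hr, rfl⟩ := hD
    obtain ⟨D, hD, hDf⟩ := exists_wordSpan_of_list h hξ L hL
    -- All weights are at least one, so `r` also bounds the number of fields.
    have hlen : L.length ≤ (L.map Prod.snd).sum := by
      have := List.card_nsmul_le_sum (L.map Prod.snd) 1 (by
        intro k hk
        obtain ⟨p, hp, rfl⟩ := List.mem_map.1 hk
        exact (hL p hp).1)
      simpa using this
    refine ⟨germ c hc • D, Submodule.smul_mem _ _ (wordSpan_mono hr (hlen.trans hr) hD),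
      fun f hf => ?_⟩
    obtain ⟨hf', h'⟩ := hDf f hf
    rw [LinearMap.smul_apply, ← h', smul_eq_mul, map_mul]
    rfl
  | zero => exact ⟨0, zero_mem _, fun f hf => by simp⟩
  | add D D' _ _ h1 h2 =>
    obtain ⟨D₁, hD₁, h1⟩ := h1
    obtain ⟨D₂, hD₂, h2⟩ := h2
    exact ⟨D₁ + D₂, add_mem hD₁ hD₂, fun f hf => by
      rw [LinearMap.add_apply, map_add, ← h1, ← h2]
      rfl⟩
  | smul a D _ h1 =>
    obtain ⟨D₁, hD₁, h1⟩ := h1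
    refine ⟨algebraMap ℝ (SmoothGerm I x) a • D₁, Submodule.smul_mem _ _ hD₁, fun f hf => ?_⟩
    rw [LinearMap.smul_apply, smul_eq_mul, map_mul, ← h1, AlgHom.commutes]
    rfl

/-- After sorting, the value at `x` is a combination of the ordered derivatives at `x`, with the
values of the coefficients as factors. -/
theorem germEval_eq_zero_of_sorted [I.Boundaryless] [LinearOrder ι]
    (h : ∀ᶠ y in 𝓝 x, IsAdaptedAt 𝓕 ξ w y)
    (hξ : ∀ i, SmoothFieldNear I (ξ i) x) {r l : ℕ} {D : Module.End ℝ (SmoothGerm I x)}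
    (hD : D ∈ wordSpan (fieldDeriv ξ hξ) w r l) {f : M → ℝ} (hf : SmoothNear I f x)
    (h0 : ∀ L : List ι, L.Pairwise (· ≤ ·) → (L.map w).sum ≤ r →
      Filtration.iterDeriv (L.map ξ) f x = 0) : germEval (D (germ f hf)) = 0 := by
  have hD' := wordSpan_le_span_sorted (commutator_eq_sum h hξ) r l hD
  clear hD
  induction hD' using Submodule.span_induction with
  | mem D hD =>
    obtain ⟨L, hL, hr, rfl⟩ := hD
    rw [word_germ, germEval_germ, h0 L hL hr]
  | zero => simp
  | add D D' _ _ h1 h2 => rw [LinearMap.add_apply, map_add, h1, h2, add_zero]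
  | smul a D _ h1 => rw [LinearMap.smul_apply, smul_eq_mul, map_mul, h1, mul_zero]

end FieldOperators

/-! ### Consequences of the symbol algebra being generated in degree `-1` -/

section Generation

variable {E₀ : Type*} [NormedAddCommGroup E₀] [NormedSpace ℝ E₀] [FiniteDimensional ℝ E₀]
  {H : Type*} [TopologicalSpace H] {I : ModelWithCorners ℝ E₀ H}
  {M : Type*} [TopologicalSpace M] [ChartedSpace H M] [IsManifold I ∞ M]
  {𝓕 : Filtration I M} {x : M}

/-- The bracket of a section of `T⁻ⁱM` whose value at `x` is in `T⁻ⁱ⁺¹M` with a section of `T⁻ʲM`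
has value in `T⁻ⁱ⁻ʲ⁺¹M` at `x`. -/
theorem mlieBracket_mem_of_mem {i j : ℕ} (hi : 1 ≤ i) (hj : 1 ≤ j)
    {Z Y : ∀ y : M, TangentSpace I y} (hZ : 𝓕.IsSectionNear i Z x) (hY : 𝓕.IsSectionNear j Y x)
    (hZx : Z x ∈ 𝓕.T (i - 1) x) : VectorField.mlieBracket I Z Y x ∈ 𝓕.T (i + j - 1) x := by
  classical
  have : CompleteSpace E₀ := FiniteDimensional.complete ℝ E₀
  have : IsManifold I (minSmoothness ℝ 2) M := by
    rw [minSmoothness_of_isRCLikeNormedField]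
    exact IsManifold.of_le two_le_infty
  have : IsManifold I 2 M := IsManifold.of_le two_le_infty
  obtain ⟨n, ξ, w, h⟩ := exists_section_frame 𝓕 x
  have hx := h.self_of_nhds
  obtain ⟨c, hc, hc0, hcZ⟩ := exists_coeff h hZ
  -- The coefficients of the fields of weight exactly `i` vanish at `x`; this removes the only
  -- brackets of weight `i + j`.
  have hcx : ∀ k, i ≤ w k → c k x = 0 := by
    intro k hk
    have h1 := hx.frameCoord_eq_zero hZx (i := k) (by omega)
    rwa [hcZ.self_of_nhds, hx.isFrame.frameCoord_sum] at h1
  have key : ∀ s : Finset (Fin n), VectorField.mlieBracket I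
      (fun y => ∑ k ∈ s, c k y • ξ k y) Y x ∈ 𝓕.T (i + j - 1) x := by
    intro s
    induction s using Finset.induction_on with
    | empty =>
      have h0 : (fun y => ∑ k ∈ (∅ : Finset (Fin n)), c k y • ξ k y) = 0 := rfl
      rw [h0, VectorField.mlieBracket_zero_left]
      exact zero_mem _
    | insert k s hk ih =>
      have h1 : (fun y => ∑ k ∈ insert k s, c k y • ξ k y) =
          c k • ξ k + fun y => ∑ k ∈ s, c k y • ξ k y := by
        funext y
        rw [Finset.sum_insert hk]
        rfl
      have hs : ∀ k, SmoothFieldNear I (ξ k) x := fun k => (hx.isSection k).1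
      have h2 : SmoothFieldNear I (c k • ξ k) x :=
        (fieldSections I M).smul_mem x _ _ (hc k) (hs k)
      have h3 : SmoothFieldNear I (fun y => ∑ k ∈ s, c k y • ξ k y) x :=
        (fieldSections I M).isSheafLike.sum_smul_mem s (fun k _ => hc k) fun k _ => hs k
      rw [h1, VectorField.mlieBracket_add_left h2.mdifferentiableAt h3.mdifferentiableAt]
      refine add_mem ?_ ih
      -- Besides the bracket with factor `c k x`, there is a multiple of `ξ k`, of weight at most
      -- `i`. This lies below `i + j` because `j` is positive.
      rw [VectorField.mlieBracket_smul_left (hc k).mdifferentiableAt (hs k).mdifferentiableAt]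
      have hsec := (hx.isSection k).2.self_of_nhds
      rcases Nat.lt_or_ge i (w k) with hik | hik
      · have h4 : mvfderiv I (c k) x = 0 := by
          rw [hc0 k hik]
          exact mvfderiv_const (0 : ℝ)
        rw [hc0 k hik] at h4 ⊢
        simp [h4]
      · refine add_mem (Submodule.smul_mem _ _ (𝓕.mono _ _ x (by omega) hsec)) ?_
        rcases Nat.lt_or_ge (w k) i with hlt | hge
        · exact Submodule.smul_mem _ _ (𝓕.mono _ _ x (by omega)
            ((hx.isSection k).mlieBracket hY).2.self_of_nhds)
        · rw [hcx k hge, zero_smul]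
          exact zero_mem _
  have hZeq : VectorField.mlieBracket I Z Y x =
      VectorField.mlieBracket I (fun y => ∑ k, c k y • ξ k y) Y x :=
    EventuallyEq.mlieBracket_vectorField_eq hcZ EventuallyEq.rfl
  rw [hZeq]
  exact key Finset.univ

/-- The operators on germs generated by at most `r` sections of `T⁻¹M`. -/
def genSpan (𝓕 : Filtration I M) (x : M) (r : ℕ) :
    Submodule (SmoothGerm I x) (Module.End ℝ (SmoothGerm I x)) :=
  wordSpan (fieldDeriv (fun X : {X // 𝓕.IsSectionNear 1 X x} => X.1) fun X => X.2.1)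
    (fun _ => 1) r r

theorem genSpan_mono {r r' : ℕ} (h : r ≤ r') : genSpan 𝓕 x r ≤ genSpan 𝓕 x r' :=
  wordSpan_mono h h

theorem asEnd_mem_genSpan {X : ∀ y : M, TangentSpace I y} (hX : 𝓕.IsSectionNear 1 X x) :
    asEnd (germDeriv X hX.1) ∈ genSpan 𝓕 x 1 := by
  have := word_mem_wordSpan (ξ := fieldDeriv (fun X : {X // 𝓕.IsSectionNear 1 X x} => X.1)
    fun X => X.2.1) (w := fun _ => 1) (L := [⟨X, hX⟩]) (r := 1) (l := 1) (by simp) (by simp)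
  rwa [word_cons, word_nil, mul_one] at this

/-- The sections of `T⁻ʲM` which are, as operators, generated by at most `j` sections of
`T⁻¹M`. -/
def genFields (𝓕 : Filtration I M) (x : M) (j : ℕ) : Set (∀ y : M, TangentSpace I y) :=
  {X | 𝓕.IsSectionNear j X x ∧ ∃ hX, asEnd (germDeriv X hX) ∈ genSpan 𝓕 x j}

theorem smul_add_mem_genFields {j : ℕ} {X Y : ∀ y : M, TangentSpace I y}
    (hX : X ∈ genFields 𝓕 x j) (hY : Y ∈ genFields 𝓕 x j) (c : ℝ) :
    c • X + Y ∈ genFields 𝓕 x j := by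
  obtain ⟨hX, hX', hXg⟩ := hX
  obtain ⟨hY, hY', hYg⟩ := hY
  have h : SmoothFieldNear I (c • X + Y) x :=
    add_mem (S := Submodule ℝ _) (s := (fieldSections I M).near x) (Submodule.smul_mem _ c hX') hY'
  refine ⟨⟨h, ?_⟩, h, ?_⟩
  · filter_upwards [hX.2, hY.2] with y h1 h2
    exact add_mem (Submodule.smul_mem _ c h1) h2
  · have h1 : asEnd (germDeriv (c • X + Y) h) =
        algebraMap ℝ (SmoothGerm I x) c • asEnd (germDeriv X hX') + asEnd (germDeriv Y hY') := by
      rw [germDeriv_smul_add hX' hY']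
      ext a
      simp [Algebra.smul_def]
    rw [h1]
    exact add_mem (Submodule.smul_mem _ _ hXg) hYg

theorem zero_mem_genFields (j : ℕ) : (0 : ∀ y : M, TangentSpace I y) ∈ genFields 𝓕 x j := by
  have h : SmoothFieldNear I (0 : ∀ y : M, TangentSpace I y) x :=
    zero_mem ((fieldSections I M).near x)
  refine ⟨⟨h, Eventually.of_forall fun y => zero_mem _⟩, h, ?_⟩
  have h1 : asEnd (germDeriv (0 : ∀ y : M, TangentSpace I y) h) = 0 := by
    refine LinearMap.ext fun a => ?_
    obtain ⟨f, hf, rfl⟩ := exists_germ a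
    refine (germDeriv_germ h hf).trans (germ_eq_iff (hg := SmoothNear.const 0 x) |>.2 ?_)
    exact Eventually.of_forall fun y => by simp [lieDeriv]
  rw [h1]
  exact zero_mem _

/-- As an operator the bracket is a commutator, and both products are made of at most `i + j`
sections of `T⁻¹M`. -/
theorem mlieBracket_mem_genFields [I.Boundaryless] {i j : ℕ} {X Y : ∀ y : M, TangentSpace I y}
    (hX : X ∈ genFields 𝓕 x i) (hY : Y ∈ genFields 𝓕 x j) :
    VectorField.mlieBracket I X Y ∈ genFields 𝓕 x (i + j) := by
  obtain ⟨hX, hX', hXg⟩ := hX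
  obtain ⟨hY, hY', hYg⟩ := hY
  refine ⟨hX.mlieBracket hY, hX'.mlieBracket hY', ?_⟩
  rw [germDeriv_mlieBracket hX' hY']
  refine sub_mem (comp_mem_wordSpan hXg hYg) ?_
  rw [genSpan, add_comm]
  exact comp_mem_wordSpan hYg hXg

theorem toGr_eq_iff {i : ℕ} {u v : 𝓕.T i x} :
    𝓕.toGr i x u = 𝓕.toGr i x v ↔ (u : TangentSpace I x) - v ∈ 𝓕.T (i - 1) x :=
  Submodule.Quotient.eq _

/-- The classes of the fields in `genFields 𝓕 x i` form a family of subspaces of the graded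
components to which the generation hypothesis applies, so every class is represented by such a
field. -/
theorem le_span_genFields [I.Boundaryless] (hgen : 𝓕.GeneratedAt x) (j : ℕ) :
    𝓕.T (j + 1) x ≤ Submodule.span ℝ ((fun X : ∀ y : M, TangentSpace I y => X x) ''
      genFields 𝓕 x (j + 1)) ⊔ 𝓕.T j x := by
  have : CompleteSpace E₀ := FiniteDimensional.complete ℝ E₀
  have : IsManifold I 2 M := IsManifold.of_le two_le_infty
  have hmem : ∀ {i X}, X ∈ genFields 𝓕 x i → X x ∈ 𝓕.T i x := fun h => h.1.2.self_of_nhds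
  let S : ∀ i, Submodule ℝ (𝓕.Gr i x) := fun i =>
    { carrier := {q | ∃ X, ∃ hX : X ∈ genFields 𝓕 x i, 𝓕.toGr i x ⟨X x, hmem hX⟩ = q}
      zero_mem' := ⟨0, zero_mem_genFields i, map_zero (𝓕.toGr i x)⟩
      add_mem' := by
        rintro _ _ ⟨X, hX, rfl⟩ ⟨Y, hY, rfl⟩
        refine ⟨(1 : ℝ) • X + Y, smul_add_mem_genFields hX hY 1, ?_⟩
        rw [← map_add]
        congr 1
        ext
        simp
      smul_mem' := by
        rintro c _ ⟨X, hX, rfl⟩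
        refine ⟨c • X + 0, smul_add_mem_genFields hX (zero_mem_genFields i) c, ?_⟩
        rw [← map_smul]
        congr 1
        ext
        simp }
  have hS : ∀ i, S i = ⊤ := by
    refine hgen S ?_ ?_
    · rw [eq_top_iff]
      intro q _
      obtain ⟨v, rfl⟩ := Submodule.mkQ_surjective _ q
      obtain ⟨X, hX, hXv⟩ := 𝓕.exists_section 1 v.1 v.2
      exact ⟨X, ⟨hX, hX.1, asEnd_mem_genSpan hX⟩, congrArg (𝓕.toGr 1 x) (Subtype.ext hXv)⟩
    · rintro i j X Y hXx hYx hXY hX hY ⟨X', hX', hXX'⟩ ⟨Y', hY', hYY'⟩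
      -- In weight zero one field vanishes near `x`, and so does the bracket. Such weights are
      -- treated apart because `mlieBracket_mem_of_mem` needs positive ones.
      rcases Nat.eq_zero_or_pos i with rfl | hi
      · refine ⟨0, zero_mem_genFields _, ?_⟩
        have h0 : VectorField.mlieBracket I X Y x = 0 := by
          rw [EventuallyEq.mlieBracket_vectorField_eq (V := 0) (W := Y) ?_ EventuallyEq.rfl,
            VectorField.mlieBracket_zero_left]
          · rfl
          · filter_upwards [hX.2] with y hy
            rwa [𝓕.zero, Submodule.mem_bot] at hy
        exact congrArg _ (Subtype.ext h0.symm)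
      rcases Nat.eq_zero_or_pos j with rfl | hj
      · refine ⟨0, zero_mem_genFields _, ?_⟩
        have h0 : VectorField.mlieBracket I X Y x = 0 := by
          rw [EventuallyEq.mlieBracket_vectorField_eq (V := X) (W := 0) EventuallyEq.rfl ?_,
            VectorField.mlieBracket_zero_right]
          · rfl
          · filter_upwards [hY.2] with y hy
            rwa [𝓕.zero, Submodule.mem_bot] at hy
        exact congrArg _ (Subtype.ext h0.symm)
      -- The given fields need not be generated by `T⁻¹M`; only their classes agree with those of
      -- `X'` and `Y'`. Replacing one field at a time changes the bracket by terms of lower weight.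
      refine ⟨_, mlieBracket_mem_genFields hX' hY', toGr_eq_iff.2 ?_⟩
      have sub : ∀ {k : ℕ} {A B : ∀ y : M, TangentSpace I y}, 𝓕.IsSectionNear k A x →
          𝓕.IsSectionNear k B x → 𝓕.IsSectionNear k (A - B) x := fun hA hB =>
        ⟨Submodule.sub_mem ((fieldSections I M).near x) hA.1 hB.1,
          (hA.2.and hB.2).mono fun y hy => sub_mem hy.1 hy.2⟩
      have hZ := sub hX'.1 hX
      have hZ' := sub hY'.1 hY
      have h1 := mlieBracket_mem_of_mem hi hj hZ hY'.1 (toGr_eq_iff.1 hXX')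
      have h2 := mlieBracket_mem_of_mem hj hi hZ' hX (toGr_eq_iff.1 hYY')
      have e1 : VectorField.mlieBracket I X' Y' x = VectorField.mlieBracket I (X' - X) Y' x +
          VectorField.mlieBracket I X Y' x := by
        rw [← VectorField.mlieBracket_add_left hZ.1.mdifferentiableAt hX.1.mdifferentiableAt,
          sub_add_cancel]
      have e2 : VectorField.mlieBracket I X Y' x = VectorField.mlieBracket I X (Y' - Y) x +
          VectorField.mlieBracket I X Y x := by
        rw [← VectorField.mlieBracket_add_right hZ'.1.mdifferentiableAt hY.1.mdifferentiableAt,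
          sub_add_cancel]
      change VectorField.mlieBracket I X' Y' x - VectorField.mlieBracket I X Y x ∈ _
      rw [e1, e2, add_sub_assoc, add_sub_cancel_right, VectorField.mlieBracket_swap_apply (V := X)]
      exact add_mem h1 (neg_mem (by rwa [add_comm i j]))
  intro v hv
  have hq : 𝓕.toGr (j + 1) x ⟨v, hv⟩ ∈ S (j + 1) := by
    rw [hS]
    trivial
  obtain ⟨X, hX, h⟩ := hq
  have h1 : X x - v ∈ 𝓕.T j x := toGr_eq_iff.1 h
  rw [← sub_sub_cancel (X x) v]
  exact sub_mem (Submodule.mem_sup_left (Submodule.subset_span ⟨X, hX, rfl⟩))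
    (Submodule.mem_sup_right h1)

/-- If the symbol algebra at `x` is generated in degree `-1`, there is an adapted frame near `x`
whose fields of weight `j` are generated, as operators, by `j` sections of `T⁻¹M`. -/
theorem exists_generated_frame [I.Boundaryless] (hgen : 𝓕.GeneratedAt x) :
    ∃ (n : ℕ) (ξ : Fin n → ∀ y : M, TangentSpace I y) (w : Fin n → ℕ),
      (∀ i, ξ i ∈ genFields 𝓕 x (w i)) ∧ ∀ᶠ y in 𝓝 x, IsAdaptedAt 𝓕 ξ w y :=
  exists_adapted_frame (fun _ _ hX => hX.1) (le_span_genFields hgen)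

theorem word_mem_genSpan {ι : Type*} {ξ : ι → ∀ y : M, TangentSpace I y} {w : ι → ℕ}
    (h : ∀ i, ξ i ∈ genFields 𝓕 x (w i)) (hξ : ∀ i, SmoothFieldNear I (ξ i) x) (L : List ι) :
    word (fieldDeriv ξ hξ) L ∈ genSpan 𝓕 x (L.map w).sum := by
  induction L with
  | nil => exact word_mem_wordSpan (L := []) le_rfl le_rfl
  | cons i L ih =>
    obtain ⟨-, hX, hg⟩ := h i
    rw [word_cons, List.map_cons, List.sum_cons]
    exact comp_mem_wordSpan hg ih

/-- A function is flat to order `r + 1` at `x` if its derivatives of order at most `r` and their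
first derivatives along `T⁻¹M` vanish at `x`. -/
theorem iterDeriv_eq_zero_of_generated [I.Boundaryless] {ι : Type*} [Fintype ι] [LinearOrder ι]
    {ξ : ι → ∀ y : M, TangentSpace I y} {w : ι → ℕ}
    (hg : ∀ i, ξ i ∈ genFields 𝓕 x (w i)) (h : ∀ᶠ y in 𝓝 x, IsAdaptedAt 𝓕 ξ w y) {r : ℕ}
    {f : M → ℝ} (hf : SmoothNear I f x)
    (h0 : ∀ L : List ι, L.Pairwise (· ≤ ·) → (L.map w).sum ≤ r →
      Filtration.iterDeriv (L.map ξ) f x = 0 ∧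
      ∀ X, 𝓕.IsSectionNear 1 X x → lieDeriv X (Filtration.iterDeriv (L.map ξ) f) x = 0)
    {L : List ι} (hL : (L.map w).sum ≤ r + 1) : Filtration.iterDeriv (L.map ξ) f x = 0 := by
  have hξ : ∀ i, SmoothFieldNear I (ξ i) x := fun i => (h.self_of_nhds.isSection i).1
  -- At most `r` sections of `T⁻¹M` compose to a combination of ordered frame words of weight at
  -- most `r`. The vanishing of the value is carried along with that of the first derivatives,
  -- because differentiating a coefficient leaves the value behind.
  have key : ∀ L' : List {X // 𝓕.IsSectionNear 1 X x}, L'.length ≤ r →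
      germEval (word (fieldDeriv (fun X : {X // 𝓕.IsSectionNear 1 X x} => X.1) fun X => X.2.1) L'
        (germ f hf)) = 0 ∧
      ∀ X (hX : 𝓕.IsSectionNear 1 X x), germEval (germDeriv X hX.1
        (word (fieldDeriv (fun X : {X // 𝓕.IsSectionNear 1 X x} => X.1) fun X => X.2.1) L'
        (germ f hf))) = 0 := by
    intro L' hL'
    have h2 : word (fieldDeriv (fun X : {X // 𝓕.IsSectionNear 1 X x} => X.1) fun X => X.2.1) L' ∈
        wordSpan (fieldDeriv ξ hξ) w L'.length L'.length := by
      clear hL'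
      induction L' with
      | nil => exact word_mem_wordSpan (L := []) le_rfl le_rfl
      | cons X L' ih =>
        obtain ⟨c, hc, hX⟩ := germDeriv_eq_sum_of_adapted h hξ X.2
        exact sum_mul_mem_wordSpan hc hX ih
    replace h2 := wordSpan_le_span_sorted (commutator_eq_sum h hξ) r _
      (wordSpan_mono hL' le_rfl h2)
    generalize word (fieldDeriv (fun X : {X // 𝓕.IsSectionNear 1 X x} => X.1) fun X => X.2.1) L' =
      D at h2
    induction h2 using Submodule.span_induction with
    | mem D hD =>
      obtain ⟨L, hL, hr, rfl⟩ := hD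
      rw [word_germ]
      refine ⟨(h0 L hL hr).1, fun X hX => ?_⟩
      rw [germDeriv_germ]
      exact (h0 L hL hr).2 X hX
    | zero => simp
    | add D D' _ _ h1 h2 =>
      simp only [LinearMap.add_apply, map_add, h1.1, h2.1, add_zero, true_and]
      intro X hX
      rw [h1.2 X hX, h2.2 X hX, add_zero]
    | smul a D _ h1 =>
      simp only [LinearMap.smul_apply, smul_eq_mul, map_mul, h1.1, mul_zero, true_and]
      intro X hX
      rw [Derivation.leibniz, map_add, smul_eq_mul, smul_eq_mul, map_mul, map_mul, h1.1,
        h1.2 X hX]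
      simp
  have h1 : ∀ D ∈ genSpan 𝓕 x (r + 1), germEval (D (germ f hf)) = 0 := by
    intro D hD
    induction hD using Submodule.span_induction with
    | mem D hD =>
      obtain ⟨L', -, hl, rfl⟩ := hD
      -- The outermost field is split off; the remaining at most `r` factors are covered by `key`.
      rcases L' with _ | ⟨X, L'⟩
      · exact (h0 [] List.Pairwise.nil (by simp)).1
      · rw [word_cons, Module.End.mul_apply]
        exact (key L' (by simpa using hl)).2 X.1 X.2
    | zero => simp
    | add D D' _ _ h1 h2 => rw [LinearMap.add_apply, map_add, h1, h2, add_zero]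
    | smul a D _ h1 => rw [LinearMap.smul_apply, smul_eq_mul, map_mul, h1, mul_zero]
  have h2 := h1 _ (genSpan_mono hL (word_mem_genSpan hg hξ L))
  rwa [word_germ] at h2

end Generation

end

end WeightedJet

namespace WeightedJet

noncomputable section

/-! ### Independence of the ordered derivatives at a point -/

section Independence

/-- A composition of `l ≤ m` derivations applied to `hᵐ`, modulo higher powers of `h`. -/
theorem word_pow {A : Type*} [CommRing A] [Algebra ℝ A] {ι : Type*} (ξ : ι → Derivation ℝ A A)
    (h : A) (m : ℕ) (L : List ι) (hL : L.length ≤ m) :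
    ∃ g, word ξ L (h ^ m) = h ^ (m - L.length) *
      ((m.descFactorial L.length : A) * (L.map fun i => ξ i h).prod + h * g) := by
  induction L with
  | nil => exact ⟨0, by simp⟩
  | cons i L ih =>
    obtain ⟨g, hg⟩ := ih (by simp at hL; omega)
    obtain ⟨k, hk⟩ : ∃ k, m - L.length = k + 1 :=
      ⟨m - L.length - 1, by simp at hL; omega⟩
    have hk' : m - (L.length + 1) = k := by omega
    rw [word_cons, Module.End.mul_apply, hg, List.length_cons, Nat.descFactorial_succ, hk, hk',
      List.map_cons, List.prod_cons, Derivation.coeFn_coe, Derivation.leibniz,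
      Derivation.leibniz_pow]
    set P := (m.descFactorial L.length : A) * (L.map fun i => ξ i h).prod
    refine ⟨(k + 1) * ξ i h * g + ξ i (P + h * g), ?_⟩
    simp only [smul_eq_mul, nsmul_eq_mul, Nat.add_sub_cancel, Nat.cast_mul]
    push_cast
    rw [show ((k : A) + 1) * (m.descFactorial L.length : A) *
      (ξ i h * (L.map fun i => ξ i h).prod) = (k + 1) * ξ i h * P by simp only [P]; ring]
    ring

/-- Used to see that distinct ordered words have distinct monomials as symbols. -/
theorem list_prod_X_eq_monomial {ι : Type*} [DecidableEq ι] (L : List ι) :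
    (L.map (MvPolynomial.X (R := ℝ))).prod =
      MvPolynomial.monomial (Multiset.toFinsupp (L : Multiset ι)) 1 := by
  induction L with
  | nil => simp
  | cons i L ih =>
    rw [List.map_cons, List.prod_cons, ih, ← Multiset.singleton_add (i) (L : Multiset ι) |>.trans
      (Multiset.cons_coe i L), map_add, Multiset.toFinsupp_singleton, MvPolynomial.X,
      MvPolynomial.monomial_mul, one_mul]

variable {E₀ : Type*} [NormedAddCommGroup E₀] [NormedSpace ℝ E₀] [FiniteDimensional ℝ E₀]
  {H : Type*} [TopologicalSpace H] {I : ModelWithCorners ℝ E₀ H}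
  {M : Type*} [TopologicalSpace M] [ChartedSpace H M] [IsManifold I ∞ M]
  {𝓕 : Filtration I M} {x : M}

/-- Every covector at `x` is the differential of a function which is smooth near `x`. -/
theorem exists_potential (x : M) (α : TangentSpace I x →ₗ[ℝ] ℝ) :
    ∃ f : M → ℝ, SmoothNear I f x ∧ f x = 0 ∧ ∀ v, mvfderiv I f x v = α v := by
  let A := mfderiv I 𝓘(ℝ, E₀) (extChartAt I x) x
  have hA : A.IsInvertible := isInvertible_mfderiv_extChartAt (mem_extChartAt_source x)
  let l : E₀ →L[ℝ] ℝ := LinearMap.toContinuousLinearMap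
    ((α ∘ₗ A.inverse.toLinearMap : E₀ →ₗ[ℝ] ℝ))
  refine ⟨fun y => l (extChartAt I x y) - l (extChartAt I x x), ?_, sub_self _, fun v => ?_⟩
  · refine ⟨_, (chartAt H x).open_source.mem_nhds (mem_chart_source H x), ?_⟩
    exact (l.contMDiff.comp_contMDiffOn contMDiffOn_extChartAt).sub contMDiffOn_const
  · have h2 : HasMFDerivAt I 𝓘(ℝ, ℝ) (fun y => l (extChartAt I x y)) x (l ∘L A) :=
      l.hasMFDerivAt.comp x
        (mdifferentiableAt_extChartAt (mem_chart_source H x)).hasMFDerivAt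
    have h6 := h2.sub (hasMFDerivAt_const (I := I) (I' := 𝓘(ℝ, ℝ)) (l (extChartAt I x x)) x)
    have h7 : (l.comp (show E₀ →L[ℝ] E₀ from A)) - (0 : E₀ →L[ℝ] ℝ) = l.comp A := sub_zero _
    have h1 : HasMFDerivAt I 𝓘(ℝ, ℝ) (fun y => l (extChartAt I x y) - l (extChartAt I x x)) x
        (l ∘L A) := h7 ▸ h6
    have h3 : mvfderiv I (fun y => l (extChartAt I x y) - l (extChartAt I x x)) x v = l (A v) :=
      congrArg (fun L : E₀ →L[ℝ] ℝ => L v) h1.mfderiv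
    have h4 : A.inverse (A v) = v := hA.inverse_apply_self v
    rw [h3]
    exact congrArg α h4

/-- The indices of the ordered words of weight at most `r`. -/
abbrev WordIdx {ι : Type*} [LinearOrder ι] (w : ι → ℕ) (r : ℕ) : Type _ :=
  {L : List ι // L.Pairwise (· ≤ ·) ∧ (L.map w).sum ≤ r}

/-- Weights are at least one, so the length of a word is at most `r`. -/
theorem finite_wordIdx {ι : Type*} [LinearOrder ι] [Finite ι] {w : ι → ℕ} (hw : ∀ i, 1 ≤ w i)
    (r : ℕ) : Finite (WordIdx w r) := by
  refine Set.Finite.subset (List.finite_length_le ι r) ?_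
  rintro L ⟨-, hL⟩
  have := List.card_nsmul_le_sum (L.map w) 1 (by
    intro k hk
    obtain ⟨i, -, rfl⟩ := List.mem_map.1 hk
    exact hw i)
  simp only [List.length_map, smul_eq_mul, mul_one] at this
  exact this.trans hL

variable {ι : Type*} [Fintype ι] [LinearOrder ι] {ξ : ι → ∀ y : M, TangentSpace I y} {w : ι → ℕ}

/-- The derivatives along the ordered words of a frame can be prescribed at a point. -/
theorem exists_prescribed_derivatives (h : ∀ᶠ y in 𝓝 x, IsAdaptedAt 𝓕 ξ w y) {r : ℕ}
    (t : WordIdx w r → ℝ) : ∃ f : M → ℝ, SmoothNear I f x ∧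
      ∀ L : WordIdx w r, Filtration.iterDeriv (L.1.map ξ) f x = t L := by
  classical
  have hx := h.self_of_nhds
  have hξ : ∀ i, SmoothFieldNear I (ξ i) x := fun i => (hx.isSection i).1
  have := finite_wordIdx hx.pos r
  have := Fintype.ofFinite (WordIdx w r)
  let Φ : SmoothGerm I x →ₗ[ℝ] WordIdx w r → ℝ := LinearMap.pi fun L =>
    (germEval (I := I) (x := x)).toLinearMap ∘ₗ word (fieldDeriv ξ hξ) L.1
  suffices hΦ : LinearMap.range Φ = ⊤ by
    obtain ⟨g, hg⟩ := LinearMap.range_eq_top.1 hΦ t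
    obtain ⟨f, hf, rfl⟩ := exists_germ g
    refine ⟨f, hf, fun L => ?_⟩
    rw [← hg]
    change _ = germEval (word (fieldDeriv ξ hξ) L.1 (germ f hf))
    rw [word_germ, germEval_germ]
  by_contra hne
  -- If not all values were attained, a nonzero combination `c` of ordered derivatives at `x` would
  -- annihilate every function. Its principal part, in the ordinary sense of length, leads to a
  -- contradiction.
  obtain ⟨φ, hφ0, hφ⟩ := Submodule.exists_le_ker_of_lt_top _ (lt_top_iff_ne_top.2 hne)
  let c : WordIdx w r → ℝ := fun L => φ (Pi.single L 1)
  have hφc : ∀ v, φ v = ∑ L, v L * c L := by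
    intro v
    conv_lhs => rw [pi_eq_sum_univ' v]
    simp [c]
  have hvan : ∀ g : SmoothGerm I x, ∑ L, germEval (word (fieldDeriv ξ hξ) L.1 g) * c L = 0 := by
    intro g
    have h1 : φ (Φ g) = 0 := hφ ⟨g, rfl⟩
    rwa [hφc] at h1
  have hc : ∃ L, c L ≠ 0 := by
    by_contra! hc
    exact hφ0 (LinearMap.ext fun v => by simp [hφc, hc])
  obtain ⟨L₀, hL₀, hmax⟩ := Finset.exists_max_image (Finset.univ.filter fun L => c L ≠ 0)
    (fun L : WordIdx w r => L.1.length) (by simpa [Finset.filter_nonempty_iff] using hc)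
  set m := L₀.1.length with hm
  -- The symbol of the words of maximal length `m` in the support of `c`, as a polynomial on
  -- covectors.
  let p : MvPolynomial ι ℝ := ∑ L ∈ Finset.univ.filter fun L : WordIdx w r => L.1.length = m,
    MvPolynomial.C (c L) * (L.1.map MvPolynomial.X).prod
  have hp : p = 0 := by
    refine MvPolynomial.funext fun τ => ?_
    obtain ⟨f, hf, hf0, hfd⟩ := exists_potential x
      (∑ i, τ i • frameCoord ξ i x)
    have hd : ∀ i, germEval (fieldDeriv ξ hξ i (germ f hf)) = τ i := by
      intro i
      rw [fieldDeriv, germDeriv_germ, germEval_germ, lieDeriv, hfd]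
      simp [hx.isFrame.frameCoord_self]
    -- The test function is the `m`-th power of a function vanishing at `x` with differential `τ`:
    -- shorter words give zero at `x`, and words of length `m` give `m!` times their symbol at `τ`.
    have h1 := hvan (germ f hf ^ m)
    have h2 : ∀ L : WordIdx w r, germEval (word (fieldDeriv ξ hξ) L.1 (germ f hf ^ m)) * c L =
        if L.1.length = m then m.factorial * (c L * (L.1.map τ).prod) else 0 := by
      intro L
      by_cases hcL : c L = 0
      · simp [hcL]
      · have hle : L.1.length ≤ m := hmax L (by simpa using hcL)
        obtain ⟨g, hg⟩ := word_pow (fieldDeriv ξ hξ) (germ f hf) m L.1 hle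
        rw [hg, map_mul, map_pow, map_add, map_mul, map_mul, germEval_germ, hf0, map_list_prod,
          List.map_map]
        by_cases hlen : L.1.length = m
        · simp only [hlen, if_true, Nat.sub_self, pow_zero, map_natCast, Nat.descFactorial_self,
            Function.comp_def, hd]
          ring
        · rw [if_neg hlen, zero_pow (by omega)]
          ring
    rw [Finset.sum_congr rfl fun L _ => h2 L, ← Finset.sum_filter, ← Finset.mul_sum] at h1
    have h3 := (mul_eq_zero.1 h1).resolve_left (by positivity)
    rw [map_zero, map_sum, ← h3]
    refine Finset.sum_congr rfl fun L _ => ?_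
    rw [map_mul, MvPolynomial.eval_C, map_list_prod, List.map_map]
    simp [Function.comp_def]
  have hcoeff := congrArg (MvPolynomial.coeff (Multiset.toFinsupp (L₀.1 : Multiset ι))) hp
  rw [MvPolynomial.coeff_zero, MvPolynomial.coeff_sum,
    Finset.sum_eq_single_of_mem L₀ (by simp [hm])] at hcoeff
  · rw [list_prod_X_eq_monomial, MvPolynomial.coeff_C_mul, MvPolynomial.coeff_monomial, if_pos rfl,
      mul_one] at hcoeff
    exact (Finset.mem_filter.1 hL₀).2 hcoeff
  · intro L _ hL
    rw [list_prod_X_eq_monomial, MvPolynomial.coeff_C_mul, MvPolynomial.coeff_monomial, if_neg,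
      mul_zero]
    intro heq
    -- Equal monomials mean equal letters with multiplicity, and the order is fixed by sorting.
    have hperm : L.1.Perm L₀.1 := Multiset.coe_eq_coe.1 (Multiset.toFinsupp.injective heq)
    exact hL (Subtype.ext (hperm.eq_of_pairwise (fun a b _ _ => le_antisymm) L.2.1 L₀.2.1))

end Independence

/-! ### Coordinates and frames of the weighted jet bundles -/

section JetFrames

variable {E₀ : Type*} [NormedAddCommGroup E₀] [NormedSpace ℝ E₀] [FiniteDimensional ℝ E₀]
  {H : Type*} [TopologicalSpace H] {I : ModelWithCorners ℝ E₀ H} [I.Boundaryless]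
  {M : Type*} [TopologicalSpace M] [ChartedSpace H M] [IsManifold I ∞ M]
  {𝓕 : Filtration I M} {V : M → Type*} [∀ x, AddCommGroup (V x)] [∀ x, Module ℝ (V x)]
  {Γ : SmoothSections I V} {x : M}
  {ι : Type*} [Fintype ι] [LinearOrder ι] {ξ : ι → ∀ y : M, TangentSpace I y} {w : ι → ℕ}
  {κ : Type*} [Fintype κ] {e : κ → ∀ y, V y} {r : ℕ}

theorem frameCoord_mem_dual (he : ∀ᶠ y in 𝓝 x, IsFrameAt I Γ.near e y) (i : κ) :
    frameCoord e i ∈ Γ.dual x := fun _ hs => smoothNear_frameCoord he hs i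

/-- The pairing with a dual section is the sum of the frame coordinates of `s` times smooth
functions. Multiplication by these has order zero, so it can be absorbed into the operator, which is
then reduced to ordered words. -/
theorem mem_nullJets_iff (h : ∀ᶠ y in 𝓝 x, IsAdaptedAt 𝓕 ξ w y)
    (he : ∀ᶠ y in 𝓝 x, IsFrameAt I Γ.near e y) {s : Γ.near x} :
    s ∈ nullJets 𝓕 Γ r x ↔ ∀ L : List ι, L.Pairwise (· ≤ ·) → (L.map w).sum ≤ r → ∀ i,
      Filtration.iterDeriv (L.map ξ) (fun y => frameCoord e i y (s.1 y)) x = 0 := by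
  have hx := h.self_of_nhds
  have hξ : ∀ i, SmoothFieldNear I (ξ i) x := fun i => (hx.isSection i).1
  refine ⟨fun hs L _ hL i => hs _ (iterDeriv_mem_diffOp hx.pos hx.isSection hL) _
    (frameCoord_mem_dual he i), fun hs D hD l hl => ?_⟩
  have hc : ∀ i, SmoothNear I (fun y => frameCoord e i y (s.1 y)) x :=
    fun i => smoothNear_frameCoord he s.2 i
  have hle : ∀ i, SmoothNear I (fun y => l y (e i y)) x :=
    fun i => hl _ (he.self_of_nhds.mem i)
  have hsum : (fun y => l y (s.1 y)) =ᶠ[𝓝 x]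
      fun y => ∑ i, l y (e i y) * frameCoord e i y (s.1 y) := by
    filter_upwards [he] with y hy
    conv_lhs => rw [← hy.sum_frameCoord (s.1 y)]
    simp [mul_comm]
  obtain ⟨D', hD', hDD'⟩ := exists_wordSpan_of_diffOp h hξ hD
  rw [Filtration.diffOp_congr hD hsum, hDD' _ (SmoothNear.sum _ fun i _ => (hle i).mul (hc i)),
    germ_sum _ fun i => (hle i).mul (hc i), map_sum, map_sum]
  refine Finset.sum_eq_zero fun i _ => ?_
  rw [← germ_mul (hle i) (hc i), ← LinearMap.mulLeft_apply (R := ℝ), ← Module.End.mul_apply]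
  exact germEval_eq_zero_of_sorted h hξ (comp_mem_wordSpan hD' (mulLeft_mem_wordSpan _)) (hc i)
    fun L hL hr => hs L hL hr i

/-- The functional on sections is assembled from maps of germs, which makes its linearity automatic;
it descends to jets by `mem_nullJets_iff`. -/
theorem exists_jetCoord (h : ∀ᶠ y in 𝓝 x, IsAdaptedAt 𝓕 ξ w y)
    (he : ∀ᶠ y in 𝓝 x, IsFrameAt I Γ.near e y) (L : WordIdx w r) (i : κ) :
    ∃ φ : Jet 𝓕 Γ r x →ₗ[ℝ] ℝ, ∀ s : Γ.near x, φ (jetAt 𝓕 Γ r x s) =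
      Filtration.iterDeriv (L.1.map ξ) (fun y => frameCoord e i y (s.1 y)) x := by
  have hx := h.self_of_nhds
  have hξ : ∀ i, SmoothFieldNear I (ξ i) x := fun i => (hx.isSection i).1
  have hc : ∀ s : Γ.near x, SmoothNear I (fun y => frameCoord e i y (s.1 y)) x :=
    fun s => smoothNear_frameCoord he s.2 i
  let G : Γ.near x →ₗ[ℝ] SmoothGerm I x :=
    { toFun := fun s => germ (fun y => frameCoord e i y (s.1 y)) (hc s)
      map_add' := fun s t => by
        rw [germ_add, germ_eq_iff]
        exact Eventually.of_forall fun y => map_add (frameCoord e i y) (s.1 y) (t.1 y)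
      map_smul' := fun c s => by
        rw [RingHom.id_apply, smul_germ, germ_eq_iff]
        exact Eventually.of_forall fun y => map_smul (frameCoord e i y) c (s.1 y) }
  have hG : ∀ s, germEval (word (fieldDeriv ξ hξ) L.1 (G s)) =
      Filtration.iterDeriv (L.1.map ξ) (fun y => frameCoord e i y (s.1 y)) x := by
    intro s
    change germEval (word (fieldDeriv ξ hξ) L.1 (germ _ (hc s))) = _
    rw [word_germ, germEval_germ]
  refine ⟨(nullJets 𝓕 Γ r x).liftQ
    ((germEval (I := I) (x := x)).toLinearMap ∘ₗ word (fieldDeriv ξ hξ) L.1 ∘ₗ G) ?_, hG⟩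
  intro s hs
  exact (hG s).trans ((mem_nullJets_iff h he).1 hs L.1 L.2.1 L.2.2 i)

variable (𝓕 Γ) in
open Classical in
/-- The functional `jʳ_y s ↦ (ξ_L sᵢ)(y)` on jets, with `sᵢ` the coordinates of `s` in a frame. -/
def jetCoord (ξ : ι → ∀ y : M, TangentSpace I y) (e : κ → ∀ y, V y) (r : ℕ) (L : List ι) (i : κ)
    (y : M) : Jet 𝓕 Γ r y →ₗ[ℝ] ℝ :=
  if h : ∃ φ : Jet 𝓕 Γ r y →ₗ[ℝ] ℝ, ∀ s : Γ.near y, φ (jetAt 𝓕 Γ r y s) =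
      Filtration.iterDeriv (L.map ξ) (fun z => frameCoord e i z (s.1 z)) y then h.choose else 0

theorem jetCoord_jetAt (h : ∀ᶠ y in 𝓝 x, IsAdaptedAt 𝓕 ξ w y)
    (he : ∀ᶠ y in 𝓝 x, IsFrameAt I Γ.near e y) (L : WordIdx w r) (i : κ) (s : Γ.near x) :
    jetCoord 𝓕 Γ ξ e r L.1 i x (jetAt 𝓕 Γ r x s) =
      Filtration.iterDeriv (L.1.map ξ) (fun y => frameCoord e i y (s.1 y)) x := by
  have hφ := exists_jetCoord h he L i
  rw [jetCoord, dif_pos hφ]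
  exact hφ.choose_spec s

/-- Induction principle for the smooth sections of a jet bundle. -/
theorem jetBundle_induction {p : (∀ y, Jet 𝓕 Γ r y) → Prop}
    (congr : ∀ s t, p s → (∀ᶠ y in 𝓝 x, t y = s y) → p t) (zero : p 0)
    (add : ∀ s t, p s → p t → p (s + t))
    (smul : ∀ (f : M → ℝ) (s : ∀ y, V y), SmoothNear I f x → s ∈ Γ.near x →
      p fun y => f y • jetSection 𝓕 Γ r s y) {σ : ∀ y, Jet 𝓕 Γ r y}
    (hσ : σ ∈ (jetBundle 𝓕 Γ r).near x) : p σ := by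
  obtain ⟨u, hu, h⟩ := hσ
  refine congr u σ ?_ h
  clear h
  refine Submodule.closure_induction zero (fun s t _ _ => add s t) ?_ hu
  rintro a _ ⟨f, s, hf, hs, rfl⟩
  have := smul _ s ((SmoothNear.const a x).mul hf) hs
  simp only [mul_smul] at this
  exact this

/-- A frame of `V` and an adapted frame of vector fields give a frame of the jet bundle. -/
theorem exists_jet_frame [Fintype (WordIdx w r)] (h : ∀ᶠ y in 𝓝 x, IsAdaptedAt 𝓕 ξ w y)
    (he : ∀ᶠ y in 𝓝 x, IsFrameAt I Γ.near e y) :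
    ∃ E : WordIdx w r × κ → ∀ y, Jet 𝓕 Γ r y,
      ∀ᶠ y in 𝓝 x, IsFrameAt I (jetBundle 𝓕 Γ r).near E y ∧
      ∀ (L : WordIdx w r) (i : κ) (s : Γ.near y), frameCoord E (L, i) y (jetAt 𝓕 Γ r y s) =
        Filtration.iterDeriv (L.1.map ξ) (fun z => frameCoord e i z (s.1 z)) y := by
  classical
  -- At each nearby point the frames are needed on a neighbourhood of that point, since
  -- `jetCoord_jetAt` differentiates there.
  have hev := (eventually_eventually_nhds.2 h).and (eventually_eventually_nhds.2 he)
  suffices hE : ∃ E : WordIdx w r × κ → ∀ y, Jet 𝓕 Γ r y, ∀ᶠ y in 𝓝 x,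
      IsFrameAt I (jetBundle 𝓕 Γ r).near E y ∧
      ∀ a, frameCoord E a y = jetCoord 𝓕 Γ ξ e r a.1.1 a.2 y by
    obtain ⟨E, hE⟩ := hE
    refine ⟨E, ?_⟩
    filter_upwards [hE, hev] with y hy hy'
    exact ⟨hy.1, fun L i s => by rw [hy.2, jetCoord_jetAt hy'.1 hy'.2]⟩
  refine exists_frame_of_coords (jetBundle 𝓕 Γ r).isSheafLike
    (fun (a : WordIdx w r × κ) y => jetCoord 𝓕 Γ ξ e r a.1.1 a.2 y) ?_ ?_ ?_
  · filter_upwards [hev] with y hy v hv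
    obtain ⟨s, rfl⟩ := jetAt_surjective r y v
    rw [jetAt_eq_zero_iff, mem_nullJets_iff hy.1 hy.2]
    intro L hL hr i
    rw [← jetCoord_jetAt hy.1 hy.2 (⟨L, hL, hr⟩ : WordIdx w r) i s]
    exact hv (⟨L, hL, hr⟩, i)
  · filter_upwards [hev] with y hy σ hσ a
    refine jetBundle_induction (p := fun σ => SmoothNear I (fun z =>
      jetCoord 𝓕 Γ ξ e r a.1.1 a.2 z (σ z)) y) ?_ ?_ ?_ ?_ hσ
    · intro s t hs hst
      exact hs.congr (hst.mono fun z hz => by simp only [hz])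
    · simpa using SmoothNear.const 0 y
    · intro s t hs ht
      simpa using hs.add ht
    · intro f s hf hs
      have h1 : SmoothNear I (Filtration.iterDeriv (a.1.1.map ξ)
          (fun z => frameCoord e a.2 z (s z))) y :=
        SmoothNear.iterDeriv_map (fun i => (hy.1.self_of_nhds.isSection i).1) _
          (smoothNear_frameCoord hy.2 hs a.2)
      refine (hf.mul h1).congr ?_
      filter_upwards [eventually_eventually_nhds.2 hy.1, eventually_eventually_nhds.2 hy.2,
        Γ.eventually y s hs] with z h2 h3 h4
      rw [map_smul, jetSection_of_mem h4, jetCoord_jetAt h2 h3 a.1 a.2]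
      rfl
  · intro b
    -- The section with coordinates `f i` has all its jet coordinates at `x` equal to zero except
    -- the one indexed by `b`, which is one.
    choose f hf hfL using fun i : κ => exists_prescribed_derivatives h
      (fun L : WordIdx w r => if (L, i) = b then 1 else 0)
    have hs : (fun y => ∑ i, f i y • e i y) ∈ Γ.near x :=
      Γ.isSheafLike.sum_smul_mem _ (fun i _ => hf i) fun i _ => he.self_of_nhds.mem i
    refine ⟨_, jetSection_mem hs, fun a => ?_⟩
    rw [jetSection_of_mem hs, jetCoord_jetAt h he a.1 a.2, ← hfL a.2 a.1]
    refine (Filtration.iterDeriv_congr ?_ _).eq_of_nhds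
    filter_upwards [he] with y hy
    rw [hy.frameCoord_sum]

theorem isVectorBundle_jetBundle (𝓕 : Filtration I M) (hΓ : IsVectorBundle I Γ.near) (r : ℕ) :
    IsVectorBundle I (jetBundle 𝓕 Γ r).near := by
  refine isVectorBundle_of_frames fun x => ?_
  obtain ⟨n, ξ, w, h⟩ := exists_section_frame 𝓕 x
  obtain ⟨m, e, he⟩ := hΓ.exists_frame x
  have := finite_wordIdx h.self_of_nhds.pos r
  have := Fintype.ofFinite (WordIdx w r)
  obtain ⟨E, hE⟩ := exists_jet_frame (r := r) h he
  exact ⟨_, inferInstance, E, hE.mono fun y hy => hy.1⟩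

end JetFrames

end

end WeightedJet

namespace WeightedJet

noncomputable section

/-! ### Smooth sections of the dual of `gr₋₁(TM)` -/

section Covectors

variable {E₀ : Type*} [NormedAddCommGroup E₀] [NormedSpace ℝ E₀]
  {H : Type*} [TopologicalSpace H] {I : ModelWithCorners ℝ E₀ H}
  {M : Type*} [TopologicalSpace M] [ChartedSpace H M] [IsManifold I ∞ M]
  {𝓕 : Filtration I M} {x : M}

theorem ext_toGr {i : ℕ} {α β : Module.Dual ℝ (𝓕.Gr i x)}
    (h : ∀ v, α (𝓕.toGr i x v) = β (𝓕.toGr i x v)) : α = β := by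
  refine LinearMap.ext fun w => ?_
  obtain ⟨v, rfl⟩ := Submodule.mkQ_surjective _ w
  exact h v

theorem grDifferential_eq_zero_iff {f : M → ℝ} :
    grDifferential 𝓕 x f = 0 ↔ ∀ X, 𝓕.IsSectionNear 1 X x → lieDeriv X f x = 0 := by
  refine ⟨fun h X hX => ?_, fun h => ext_toGr fun v => ?_⟩
  · exact congrArg (fun α => α (𝓕.toGr 1 x ⟨X x, hX.2.self_of_nhds⟩)) h
  · obtain ⟨X, hX, hXv⟩ := 𝓕.exists_section 1 (v : TangentSpace I x) v.2
    have := h X hX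
    rwa [lieDeriv, hXv] at this

theorem grDifferential_congr {f g : M → ℝ} (h : f =ᶠ[𝓝 x] g) :
    grDifferential 𝓕 x f = grDifferential 𝓕 x g :=
  ext_toGr fun v => by
    have h1 := Filter.EventuallyEq.mfderiv_eq (I := I) (I' := 𝓘(ℝ, ℝ)) h
    exact congrArg (fun L : E₀ →L[ℝ] ℝ => L (v : TangentSpace I x)) h1

theorem isCovectorNear_grDifferential {f : M → ℝ} (hf : SmoothNear I f x) :
    IsCovectorNear 𝓕 (fun y => grDifferential 𝓕 y f) x :=
  fun _ hX => SmoothNear.lieDeriv hX hf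

variable (𝓕) in
/-- An extension of the linear form on `T⁻¹M` given by a covector on `gr₋₁(TM)`. -/
theorem exists_extend_covector (y : M) (α : Module.Dual ℝ (𝓕.Gr 1 y)) :
    ∃ β : TangentSpace I y →ₗ[ℝ] ℝ, ∀ v : 𝓕.T 1 y, β v = α (𝓕.toGr 1 y v) := by
  obtain ⟨β, hβ⟩ := LinearMap.exists_extend (α ∘ₗ 𝓕.toGr 1 y)
  exact ⟨β, fun v => congrArg (fun φ => φ v) hβ⟩

open Classical in
/-- The section of `gr₋₁(TM)` given by a vector field with values in `T⁻¹M`. -/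
def grSection (𝓕 : Filtration I M) (X : ∀ y : M, TangentSpace I y) (y : M) : 𝓕.Gr 1 y :=
  if h : X y ∈ 𝓕.T 1 y then 𝓕.toGr 1 y ⟨X y, h⟩ else 0

theorem grSection_of_mem {X : ∀ y : M, TangentSpace I y} (h : X x ∈ 𝓕.T 1 x) :
    grSection 𝓕 X x = 𝓕.toGr 1 x ⟨X x, h⟩ := dif_pos h

theorem IsCovectorNear.smoothNear {α : ∀ y, Module.Dual ℝ (𝓕.Gr 1 y)}
    (hα : IsCovectorNear 𝓕 α x) {X : ∀ y : M, TangentSpace I y} (hX : 𝓕.IsSectionNear 1 X x) :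
    SmoothNear I (fun y => α y (grSection 𝓕 X y)) x := by
  classical
  have h1 : SmoothFieldNear I
      (fun y => ((if h : X y ∈ 𝓕.T 1 y then ⟨X y, h⟩ else 0 : 𝓕.T 1 y) : TangentSpace I y)) x :=
    (fieldSections I M).congr x X _ hX.1 (hX.2.mono fun y hy => by rw [dif_pos hy])
  refine (hα _ h1).congr ?_
  filter_upwards [hX.2] with y hy
  rw [grSection_of_mem hy, dif_pos hy]

variable {ι : Type*} [Fintype ι] {ξ : ι → ∀ y : M, TangentSpace I y} {w : ι → ℕ}

/-- Reduces the quantification over all sections of `T⁻¹M` to finitely many fields. This makes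
smoothness of a covector an open condition, as used in `IsCovectorNear.eventually`. -/
theorem isCovectorNear_iff [FiniteDimensional ℝ E₀] (h : ∀ᶠ y in 𝓝 x, IsAdaptedAt 𝓕 ξ w y)
    {α : ∀ y, Module.Dual ℝ (𝓕.Gr 1 y)} : IsCovectorNear 𝓕 α x ↔
      ∀ i, w i ≤ 1 → SmoothNear I (fun y => α y (grSection 𝓕 (ξ i) y)) x := by
  classical
  refine ⟨fun hα i hi => hα.smoothNear ((h.self_of_nhds.isSection i).mono hi), fun hα X hX => ?_⟩
  -- Forms on the whole tangent space can be applied to the frame expansion term by term, without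
  -- proofs of membership in `T⁻¹M`. No smoothness of `β` is required.
  choose β hβ using fun y => exists_extend_covector 𝓕 y (α y)
  obtain ⟨c, hc, hc0, hcX⟩ := exists_coeff h
    (X := fun y => (X y : TangentSpace I y)) (j := 1) ⟨hX, Eventually.of_forall fun y => (X y).2⟩
  refine (SmoothNear.sum Finset.univ (f := fun i y => if w i ≤ 1 then
    c i y * α y (grSection 𝓕 (ξ i) y) else 0) fun i _ => ?_).congr ?_
  · by_cases hi : w i ≤ 1
    · simp only [if_pos hi]
      exact (hc i).mul (hα i hi)
    · simp only [if_neg hi]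
      exact SmoothNear.const 0 x
  · filter_upwards [hcX, h] with y hy hy'
    rw [← hβ, hy, map_sum]
    refine Finset.sum_congr rfl fun i _ => ?_
    by_cases hi : w i ≤ 1
    · have h1 : ξ i y ∈ 𝓕.T 1 y := ((hy'.isSection i).mono hi).2.self_of_nhds
      rw [if_pos hi, map_smul, smul_eq_mul, grSection_of_mem h1, ← hβ]
    · rw [if_neg hi, hc0 i (not_le.1 hi)]
      simp

theorem IsCovectorNear.eventually [FiniteDimensional ℝ E₀] {α : ∀ y, Module.Dual ℝ (𝓕.Gr 1 y)}
    (hα : IsCovectorNear 𝓕 α x) : ∀ᶠ y in 𝓝 x, IsCovectorNear 𝓕 α y := by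
  obtain ⟨n, ξ, w, h⟩ := exists_section_frame 𝓕 x
  have h1 : ∀ᶠ y in 𝓝 x, ∀ i, w i ≤ 1 →
      SmoothNear I (fun y => α y (grSection 𝓕 (ξ i) y)) y := by
    rw [eventually_all]
    intro i
    by_cases hi : w i ≤ 1
    · exact ((isCovectorNear_iff h).1 hα i hi).eventually.mono fun y hy _ => hy
    · exact Eventually.of_forall fun y h => absurd h hi
  filter_upwards [h1, eventually_eventually_nhds.2 h] with y hy hy'
  exact (isCovectorNear_iff hy').2 hy

theorem IsCovectorNear.smul {α : ∀ y, Module.Dual ℝ (𝓕.Gr 1 y)} (hα : IsCovectorNear 𝓕 α x)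
    {f : M → ℝ} (hf : SmoothNear I f x) : IsCovectorNear 𝓕 (fun y => f y • α y) x :=
  fun X hX => hf.mul (hα X hX)

end Covectors

/-! ### The inclusion of symbols into first jets and the bundle of symbols -/

section Symbols

variable {E₀ : Type*} [NormedAddCommGroup E₀] [NormedSpace ℝ E₀] [FiniteDimensional ℝ E₀]
  {H : Type*} [TopologicalSpace H] {I : ModelWithCorners ℝ E₀ H} [I.Boundaryless]
  {M : Type*} [TopologicalSpace M] [ChartedSpace H M] [IsManifold I ∞ M]
  {V : M → Type*} [∀ x, AddCommGroup (V x)] [∀ x, Module ℝ (V x)]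
  {𝓕 : Filtration I M} {Γ : SmoothSections I V} {x : M}
  {κ : Type*} [Fintype κ] {e : κ → ∀ y, V y}

theorem mem_nullJets_zero_iff {s : Γ.near x} : s ∈ nullJets 𝓕 Γ 0 x ↔
    ∀ l ∈ Γ.dual x, l x (s.1 x) = 0 := by
  refine ⟨fun hs l hl => hs (Filtration.iterDeriv []) (Submodule.subset_span
    ⟨fun _ => 1, [], SmoothNear.const 1 x, by simp, by simp,
      funext fun f => funext fun y => (one_mul _).symm⟩) l hl, fun hs D hD l hl => ?_⟩
  induction hD using Submodule.span_induction with
  | mem D hD =>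
    obtain ⟨c, L, hc, hL, hr, rfl⟩ := hD
    match L, hL, hr with
    | [], _, _ => simp [Filtration.iterDeriv, hs l hl]
    | (X, w) :: L, hL, hr =>
      have h1 := (hL (X, w) (by simp)).1
      simp at hr h1
      omega
  | zero => rfl
  | add D D' _ _ h1 h2 => simp only [Pi.add_apply, h1, h2, add_zero]
  | smul a D _ h1 => simp only [Pi.smul_apply, h1, smul_zero]

/-- This is the identification of `J⁰(V)` with `V`; a local frame is needed so that there are enough
dual sections. -/
theorem jetAt_zero_eq_zero_iff (he : ∀ᶠ y in 𝓝 x, IsFrameAt I Γ.near e y) {s : Γ.near x} :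
    jetAt 𝓕 Γ 0 x s = 0 ↔ s.1 x = 0 := by
  rw [jetAt_eq_zero_iff, mem_nullJets_zero_iff]
  refine ⟨fun h => ?_, fun h l _ => by rw [h, map_zero]⟩
  rw [← he.self_of_nhds.sum_frameCoord (s.1 x)]
  exact Finset.sum_eq_zero fun i _ => by rw [h _ (frameCoord_mem_dual he i), zero_smul]

/-- Since weights are positive, a word of weight at most one is empty or a single section of `T⁻¹M`.
-/
theorem mem_nullJets_one_iff (he : ∀ᶠ y in 𝓝 x, IsFrameAt I Γ.near e y) {s : Γ.near x} :
    s ∈ nullJets 𝓕 Γ 1 x ↔ ∀ i, frameCoord e i x (s.1 x) = 0 ∧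
      grDifferential 𝓕 x (fun y => frameCoord e i y (s.1 y)) = 0 := by
  obtain ⟨n, ξ, w, h⟩ := exists_section_frame 𝓕 x
  simp only [grDifferential_eq_zero_iff]
  refine ⟨fun hs i => ⟨?_, fun X hX => ?_⟩, fun hs => (mem_nullJets_iff h he).2 fun L _ hL i => ?_⟩
  · exact (mem_nullJets_iff h he).1 hs [] List.Pairwise.nil (by simp) i
  · exact hs _ (iterDeriv_mem_diffOp (ξ := fun _ : Unit => X) (w := fun _ => 1) (L := [()])
      (fun _ => le_rfl) (fun _ => hX) (by simp)) _ (frameCoord_mem_dual he i)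
  · match L, hL with
    | [], _ => exact (hs i).1
    | [k], hk => exact (hs i).2 _ ((h.self_of_nhds.isSection k).mono (by simpa using hk))
    | k :: l :: L, hL =>
      have h1 := h.self_of_nhds.pos k
      have h2 := h.self_of_nhds.pos l
      simp at hL
      omega

/-- A tensor is expanded in a basis of the fibre of `V`, and its covector coefficients are realised
by differentials of functions vanishing at `x`. -/
theorem exists_sum_pureTensor (he : IsFrameAt I Γ.near e x) (a : SymbolSpace 𝓕 V x) :
    ∃ h : κ → M → ℝ, (∀ i, SmoothNear I (h i) x) ∧ (∀ i, h i x = 0) ∧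
      a = ∑ i, pureTensor 𝓕 (grDifferential 𝓕 x (h i)) (e i x) := by
  let b := Module.Basis.mk he.linearIndependent he.span_eq_top.ge
  obtain ⟨c, hc⟩ := TensorProduct.eq_repr_basis_right b a
  obtain ⟨R, hR⟩ := exists_linear_potential 𝓕 x
  refine ⟨fun i => R (c i), fun i => (hR _).1, fun i => (hR _).2.1, hc.symm.trans
    ((Finsupp.sum_fintype c (fun i m => m ⊗ₜ[ℝ] b i) fun i => TensorProduct.zero_tmul _ _).trans
    (Finset.sum_congr rfl fun i _ => ?_))⟩
  simp only [(hR (c i)).2.2]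
  exact congrArg (pureTensor 𝓕 (c i)) (Module.Basis.mk_apply _ _ _)

theorem symbolInclusion_sum {h : κ → M → ℝ} (hh : ∀ i, SmoothNear I (h i) x)
    (h0 : ∀ i, h i x = 0) (he : ∀ i, e i ∈ Γ.near x) :
    symbolInclusion 𝓕 Γ x (∑ i, pureTensor 𝓕 (grDifferential 𝓕 x (h i)) (e i x)) =
      jetAt 𝓕 Γ 1 x ⟨fun y => ∑ i, h i y • e i y,
        Γ.isSheafLike.sum_smul_mem _ (fun i _ => hh i) fun i _ => he i⟩ := by
  rw [map_sum, Finset.sum_congr rfl fun i _ => symbolInclusion_tmul (hh i) (h0 i) (he i),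
    ← map_sum]
  congr 1
  ext y
  simp [Finset.sum_apply]

theorem symbolInclusion_injective (he : ∀ᶠ y in 𝓝 x, IsFrameAt I Γ.near e y) :
    Function.Injective (symbolInclusion 𝓕 Γ x) := by
  rw [injective_iff_map_eq_zero]
  intro a ha
  obtain ⟨h, hh, h0, rfl⟩ := exists_sum_pureTensor he.self_of_nhds a
  rw [symbolInclusion_sum hh h0 fun i => he.self_of_nhds.mem i, jetAt_eq_zero_iff,
    mem_nullJets_one_iff he] at ha
  refine Finset.sum_eq_zero fun i _ => ?_
  have h1 := (ha i).2
  rw [grDifferential_congr (g := h i) (he.mono fun y hy => hy.frameCoord_sum _ _)] at h1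
  rw [h1]
  exact TensorProduct.zero_tmul _ _

/-- A section vanishing at `x` is a combination of frame sections with coefficients vanishing at
`x`, which is the shape of a value of `ι`. -/
theorem jetAt_one_mem_range (he : ∀ᶠ y in 𝓝 x, IsFrameAt I Γ.near e y) {s : Γ.near x}
    (hs : s.1 x = 0) : jetAt 𝓕 Γ 1 x s ∈ LinearMap.range (symbolInclusion 𝓕 Γ x) := by
  refine ⟨_, (symbolInclusion_sum (h := fun i y => frameCoord e i y (s.1 y))
    (fun i => smoothNear_frameCoord he s.2 i) (fun i => by rw [hs, map_zero])
    fun i => he.self_of_nhds.mem i).trans (jetAt_congr ?_)⟩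
  filter_upwards [he] with y hy
  exact hy.sum_frameCoord _

theorem range_symbolInclusion (he : ∀ᶠ y in 𝓝 x, IsFrameAt I Γ.near e y) :
    LinearMap.range (symbolInclusion 𝓕 Γ x) =
      LinearMap.ker (jetProj 𝓕 Γ (zero_le_one : (0 : ℕ) ≤ 1) x) := by
  refine le_antisymm ?_ fun v hv => ?_
  · rintro _ ⟨a, rfl⟩
    obtain ⟨h, hh, h0, rfl⟩ := exists_sum_pureTensor he.self_of_nhds a
    rw [symbolInclusion_sum hh h0 fun i => he.self_of_nhds.mem i, LinearMap.mem_ker]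
    refine (jetAt_zero_eq_zero_iff he).2 ?_
    exact Finset.sum_eq_zero fun i _ => by rw [h0, zero_smul]
  · obtain ⟨s, rfl⟩ := jetAt_surjective 1 x v
    exact jetAt_one_mem_range he ((jetAt_zero_eq_zero_iff he).1 hv)

/-- The condition `f(x) = 0` is removed by subtracting a constant. The formula holds at all points
near a given one for the same `f` and `s`, so it shows that `ι` is smooth. -/
theorem symbolInclusion_grDifferential {f : M → ℝ} {s : ∀ y, V y} (hf : SmoothNear I f x)
    (hs : s ∈ Γ.near x) :
    symbolInclusion 𝓕 Γ x (pureTensor 𝓕 (grDifferential 𝓕 x f) (s x)) =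
      jetAt 𝓕 Γ 1 x ⟨fun y => f y • s y, Γ.smul_mem x f s hf hs⟩ -
        f x • jetAt 𝓕 Γ 1 x ⟨s, hs⟩ := by
  have h1 : grDifferential 𝓕 x f = grDifferential 𝓕 x (fun y => f y - f x) :=
    ext_toGr fun v => by
      rw [grDifferential_toGr, grDifferential_toGr,
        mvfderiv_fun_sub hf.mdifferentiableAt (SmoothNear.const _ x).mdifferentiableAt,
        mvfderiv_const, sub_zero]
  rw [h1, symbolInclusion_tmul (hf.sub (SmoothNear.const _ x)) (sub_self _) hs, ← map_smul,
    ← map_sub]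
  congr 1
  ext y
  exact sub_smul _ _ _

variable (𝓕) in
theorem isSheafLike_covectorSections (Γ : SmoothSections I V) :
    IsSheafLike I (covectorSections 𝓕 Γ) := by
  refine isSheafLike_locallySpanned (G := fun x => {a | ∃ (α : ∀ y, Module.Dual ℝ (𝓕.Gr 1 y))
    (s : ∀ y, V y), IsCovectorNear 𝓕 α x ∧ s ∈ Γ.near x ∧
      a = fun y => pureTensor 𝓕 (α y) (s y)}) ?_ ?_
  · rintro x _ ⟨α, s, hα, hs, rfl⟩
    filter_upwards [hα.eventually, Γ.eventually x s hs] with y h1 h2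
    exact ⟨α, s, h1, h2, rfl⟩
  · rintro x f _ hf ⟨α, s, hα, hs, rfl⟩
    exact ⟨_, s, hα.smul hf, hs, funext fun y => TensorProduct.smul_tmul' _ _ _⟩

/-- The linear form `α ⊗ v ↦ α(u) φ(v)`. -/
def tensorCoord (u : 𝓕.Gr 1 x) (φ : V x →ₗ[ℝ] ℝ) : SymbolSpace 𝓕 V x →ₗ[ℝ] ℝ :=
  TensorProduct.lift ((LinearMap.mul ℝ ℝ).compl₁₂ (Module.Dual.eval ℝ (𝓕.Gr 1 x) u) φ)

theorem tensorCoord_pureTensor (u : 𝓕.Gr 1 x) (φ : V x →ₗ[ℝ] ℝ) (α : Module.Dual ℝ (𝓕.Gr 1 x))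
    (v : V x) : tensorCoord u φ (pureTensor 𝓕 α v) = α u * φ v := rfl

theorem covectorSections_induction {p : (∀ y, SymbolSpace 𝓕 V y) → Prop}
    (congr : ∀ s t, p s → (∀ᶠ y in 𝓝 x, t y = s y) → p t) (zero : p 0)
    (add : ∀ s t, p s → p t → p (s + t)) (smul : ∀ (c : ℝ) s, p s → p (c • s))
    (pure : ∀ (α : ∀ y, Module.Dual ℝ (𝓕.Gr 1 y)) (s : ∀ y, V y), IsCovectorNear 𝓕 α x →
      s ∈ Γ.near x → p fun y => pureTensor 𝓕 (α y) (s y)) {a : ∀ y, SymbolSpace 𝓕 V y}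
    (ha : a ∈ covectorSections 𝓕 Γ x) : p a := by
  obtain ⟨u, hu, h⟩ := ha
  refine congr u a ?_ h
  clear h
  induction hu using Submodule.span_induction with
  | mem a ha =>
    obtain ⟨α, s, hα, hs, rfl⟩ := ha
    exact pure α s hα hs
  | zero => exact zero
  | add a b _ _ ha hb => exact add a b ha hb
  | smul c a _ ha => exact smul c a ha

/-- There are functions whose differentials and a frame of `V` form a frame of `gr₋₁(TM)* ⊗ V`. -/
theorem exists_covector_frame (𝓕 : Filtration I M) (he : ∀ᶠ y in 𝓝 x, IsFrameAt I Γ.near e y) :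
    ∃ (ν : Type) (_ : Fintype ν) (h : ν → M → ℝ), (∀ k, SmoothNear I (h k) x) ∧ ∀ᶠ y in 𝓝 x,
      IsFrameAt I (covectorSections 𝓕 Γ)
        (fun (a : ν × κ) z => pureTensor 𝓕 (grDifferential 𝓕 z (h a.1)) (e a.2 z)) y := by
  classical
  obtain ⟨n, ξ, w, h⟩ := exists_section_frame 𝓕 x
  have hsec : ∀ {y}, IsAdaptedAt 𝓕 ξ w y → ∀ k : {k // w k ≤ 1}, 𝓕.IsSectionNear 1 (ξ k) y :=
    fun hy k => (hy.isSection k).mono k.2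
  -- The differentials of these functions at `x` are dual to the frame fields, so the coordinate
  -- matrix at `x` is the identity.
  choose f hf hf0 hfd using fun k : {k // w k ≤ 1} => exists_potential x (frameCoord ξ (k : Fin n) x)
  refine ⟨{k // w k ≤ 1}, inferInstance, f, hf, ?_⟩
  refine isFrameAt_of_coords (isSheafLike_covectorSections 𝓕 Γ)
    (fun (a : {k // w k ≤ 1} × κ) y => tensorCoord (grSection 𝓕 (ξ a.1) y) (frameCoord e a.2 y))
    ?_ ?_ (fun a => ⟨_, Submodule.subset_span ⟨_, _, isCovectorNear_grDifferential (hf a.1),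
      he.self_of_nhds.mem a.2, rfl⟩, Eventually.of_forall fun y => rfl⟩) ?_
  · filter_upwards [h, he] with y hy hey a ha
    obtain ⟨g, -, -, rfl⟩ := exists_sum_pureTensor hey a
    refine Finset.sum_eq_zero fun i _ => ?_
    suffices h1 : grDifferential 𝓕 y (g i) = 0 by
      rw [h1]
      exact TensorProduct.zero_tmul _ _
    obtain ⟨β, hβ⟩ := exists_extend_covector 𝓕 y (grDifferential 𝓕 y (g i))
    -- It suffices that `β` kills the frame fields of weight at most one, since they span `T⁻¹M`.
    have h2 : 𝓕.T 1 y ≤ LinearMap.ker β := by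
      rw [← hy.span_eq 1, Submodule.span_le]
      rintro _ ⟨k, hk, rfl⟩
      have h3 := ha (⟨k, hk⟩, i)
      simp only [map_sum, tensorCoord_pureTensor, hey.frameCoord_self, mul_ite, mul_one, mul_zero,
        Finset.sum_ite_eq, Finset.mem_univ, if_true] at h3
      have h4 : ξ k y ∈ 𝓕.T 1 y := (hsec hy ⟨k, hk⟩).2.self_of_nhds
      rw [grSection_of_mem h4, ← hβ] at h3
      exact h3
    exact ext_toGr fun v => (hβ v).symm.trans (h2 v.2)
  · filter_upwards [h, eventually_eventually_nhds.2 he] with y hy hey a ha b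
    refine covectorSections_induction (Γ := Γ) (p := fun a => SmoothNear I (fun z =>
      tensorCoord (grSection 𝓕 (ξ b.1) z) (frameCoord e b.2 z) (a z)) y) ?_ ?_ ?_ ?_ ?_ ha
    · intro s t hs hst
      exact hs.congr (hst.mono fun z hz => by simp only [hz])
    · simpa using SmoothNear.const 0 y
    · intro s t hs ht
      simpa using hs.add ht
    · intro c s hs
      simpa using (SmoothNear.const c y).mul hs
    · intro α s hα hs
      exact (hα.smoothNear (hsec hy b.1)).mul (smoothNear_frameCoord hey hs b.2)
  · have hx := h.self_of_nhds
    rw [show (Matrix.of fun a b : {k // w k ≤ 1} × κ => tensorCoord (grSection 𝓕 (ξ a.1) x)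
      (frameCoord e a.2 x) (pureTensor 𝓕 (grDifferential 𝓕 x (f b.1)) (e b.2 x))) = 1 from ?_]
    · simp
    · ext a b
      have h4 : ξ a.1 x ∈ 𝓕.T 1 x := (hsec hx a.1).2.self_of_nhds
      rw [Matrix.of_apply, tensorCoord_pureTensor, grSection_of_mem h4, grDifferential_toGr, hfd,
        he.self_of_nhds.frameCoord_self, hx.isFrame.frameCoord_self, Matrix.one_apply]
      rcases a with ⟨⟨a, ha⟩, i⟩
      rcases b with ⟨⟨b, hb⟩, j⟩
      by_cases h1 : b = a
      · by_cases h2 : i = j <;> simp [h1, h2]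
      · simp [h1, Ne.symm h1]

theorem isVectorBundle_covectorSections (𝓕 : Filtration I M) (hΓ : IsVectorBundle I Γ.near) :
    IsVectorBundle I (covectorSections 𝓕 Γ) := by
  refine isVectorBundle_of_frames fun x => ?_
  obtain ⟨m, e, he⟩ := hΓ.exists_frame x
  obtain ⟨ν, _, h, -, hh⟩ := exists_covector_frame 𝓕 he
  exact ⟨_, inferInstance, _, hh⟩

theorem symbolInclusion_smooth (hΓ : IsVectorBundle I Γ.near) {a : ∀ y, SymbolSpace 𝓕 V y}
    (ha : a ∈ covectorSections 𝓕 Γ x) :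
    (fun y => symbolInclusion 𝓕 Γ y (a y)) ∈ (jetBundle 𝓕 Γ 1).near x := by
  obtain ⟨m, e, he⟩ := hΓ.exists_frame x
  obtain ⟨ν, _, h, hs, hh⟩ := exists_covector_frame 𝓕 he
  obtain ⟨c, hc, hca⟩ := (hh.self_of_nhds.mem_iff a).1 ha
  have hJ := (jetBundle 𝓕 Γ 1).isSheafLike
  have hm : ∀ b : ν × Fin m, (fun y => h b.1 y • e b.2 y) ∈ Γ.near x := fun b =>
    Γ.smul_mem x _ _ (hs b.1) (he.self_of_nhds.mem b.2)
  refine (jetBundle 𝓕 Γ 1).congr x _ _ (sub_mem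
    (hJ.sum_smul_mem Finset.univ (fun b _ => hc b) fun b _ => jetSection_mem (hm b))
    (hJ.sum_smul_mem Finset.univ (fun b _ => (hc b).mul (hs b.1)) fun (b : ν × Fin m) _ =>
      jetSection_mem (he.self_of_nhds.mem b.2))) ?_
  have hs' : ∀ᶠ y in 𝓝 x, ∀ k, SmoothNear I (h k) y :=
    eventually_all.2 fun k => (hs k).eventually
  filter_upwards [hca, hs', he] with y h1 h2 h3
  rw [h1, map_sum, Pi.sub_apply, ← Finset.sum_sub_distrib]
  refine Finset.sum_congr rfl fun b _ => ?_
  rw [map_smul, symbolInclusion_grDifferential (h2 b.1) (h3.mem b.2), smul_sub, smul_smul,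
    jetSection_of_mem (h3.mem b.2),
    jetSection_of_mem (Γ.smul_mem y _ _ (h2 b.1) (h3.mem b.2))]

end Symbols

end

end WeightedJet

namespace WeightedJet

noncomputable section

/-! ### The embedding of `Jʳ⁺¹(V)` into `J¹(Jʳ(V))` -/

section IteratedJets

variable {E₀ : Type*} [NormedAddCommGroup E₀] [NormedSpace ℝ E₀] [FiniteDimensional ℝ E₀]
  {H : Type*} [TopologicalSpace H] {I : ModelWithCorners ℝ E₀ H} [I.Boundaryless]
  {M : Type*} [TopologicalSpace M] [ChartedSpace H M] [IsManifold I ∞ M]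
  {V : M → Type*} [∀ x, AddCommGroup (V x)] [∀ x, Module ℝ (V x)]
  {𝓕 : Filtration I M} {Γ : SmoothSections I V} {x : M}

/-- The vanishing of `j¹ₓ(jʳ s)` in terms of the coordinates of `s`. -/
theorem iteratedJetAt_eq_zero_iff {ι : Type*} [Fintype ι] [LinearOrder ι]
    {ξ : ι → ∀ y : M, TangentSpace I y} {w : ι → ℕ} {κ : Type*} [Fintype κ] {e : κ → ∀ y, V y}
    (h : ∀ᶠ y in 𝓝 x, IsAdaptedAt 𝓕 ξ w y) (he : ∀ᶠ y in 𝓝 x, IsFrameAt I Γ.near e y)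
    {r : ℕ} {s : Γ.near x} :
    iteratedJetAt 𝓕 Γ r x s = 0 ↔ ∀ L : List ι, L.Pairwise (· ≤ ·) → (L.map w).sum ≤ r → ∀ i,
      Filtration.iterDeriv (L.map ξ) (fun y => frameCoord e i y (s.1 y)) x = 0 ∧
      ∀ X, 𝓕.IsSectionNear 1 X x → lieDeriv X (Filtration.iterDeriv (L.map ξ)
        (fun y => frameCoord e i y (s.1 y))) x = 0 := by
  have := finite_wordIdx h.self_of_nhds.pos r
  have := Fintype.ofFinite (WordIdx w r)
  obtain ⟨E, hE⟩ := exists_jet_frame (r := r) h he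
  have hc : ∀ a : WordIdx w r × κ, (fun y => frameCoord E a y (jetSection 𝓕 Γ r s.1 y)) =ᶠ[𝓝 x]
      Filtration.iterDeriv (a.1.1.map ξ) (fun y => frameCoord e a.2 y (s.1 y)) := fun a => by
    filter_upwards [hE, Γ.eventually x s.1 s.2] with y hy hs
    rw [jetSection_of_mem hs]
    exact hy.2 a.1 a.2 ⟨s.1, hs⟩
  change jetAt 𝓕 _ 1 x _ = 0 ↔ _
  rw [jetAt_eq_zero_iff, mem_nullJets_one_iff (hE.mono fun y hy => hy.1)]
  simp only [grDifferential_congr (hc _), (hc _).eq_of_nhds, grDifferential_eq_zero_iff]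
  exact ⟨fun H L hL hr i => H (⟨L, hL, hr⟩, i), fun H a => H a.1.1 a.1.2.1 a.1.2.2 a.2⟩

/-- Well-definedness of the embedding: a section of `T⁻¹M` composed with an operator of weight at
most `r` has weight at most `r + 1`. -/
theorem nullJets_succ_le (hΓ : IsVectorBundle I Γ.near) (r : ℕ) :
    nullJets 𝓕 Γ (r + 1) x ≤ LinearMap.ker (iteratedJetAt 𝓕 Γ r x) := by
  intro s hs
  obtain ⟨n, ξ, w, h⟩ := exists_section_frame 𝓕 x
  obtain ⟨m, e, he⟩ := hΓ.exists_frame x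
  have hx := h.self_of_nhds
  refine (iteratedJetAt_eq_zero_iff h he).2 fun L _ hr i => ⟨?_, fun X hX => ?_⟩
  · exact hs _ (iterDeriv_mem_diffOp hx.pos hx.isSection (hr.trans (Nat.le_succ r))) _
      (frameCoord_mem_dual he i)
  -- The field `X` is adjoined to the frame as the letter `none`, of weight one, so that it may
  -- stand in front of the word.
  · have h1 := iterDeriv_mem_diffOp (𝓕 := 𝓕) (x := x) (r := r + 1)
      (ξ := fun o : Option (Fin n) => o.elim X ξ) (w := fun o => o.elim 1 w)
      (L := none :: L.map some)
      (by rintro (_ | k); exacts [le_rfl, hx.pos k])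
      (by rintro (_ | k); exacts [hX, hx.isSection k])
      (by simpa [Function.comp_def, add_comm] using hr)
    have h2 := hs _ h1 _ (frameCoord_mem_dual he i)
    simpa [Function.comp_def, Filtration.iterDeriv] using h2

/-- Injectivity of the embedding, and the place where generation in degree `-1` is indispensable:
without it, a frame field of higher weight need not be reached by derivatives along `T⁻¹M`. -/
theorem ker_iteratedJetAt_le (hΓ : IsVectorBundle I Γ.near) (hgen : 𝓕.GeneratedAt x) (r : ℕ) :
    LinearMap.ker (iteratedJetAt 𝓕 Γ r x) ≤ nullJets 𝓕 Γ (r + 1) x := by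
  intro s hs
  obtain ⟨n, ξ, w, hg, h⟩ := exists_generated_frame hgen
  obtain ⟨m, e, he⟩ := hΓ.exists_frame x
  have hs' := (iteratedJetAt_eq_zero_iff h he).1 hs
  exact (mem_nullJets_iff h he).2 fun L _ hr i => iterDeriv_eq_zero_of_generated hg h
    (smoothNear_frameCoord he s.2 i) (fun L hL hr => hs' L hL hr i) hr

/-- The embedding `Jʳ⁺¹(V) → J¹(Jʳ(V))`, `jʳ⁺¹ₓ s ↦ j¹ₓ(jʳ s)`. -/
def iteratedJetMap (𝓕 : Filtration I M) (hΓ : IsVectorBundle I Γ.near) (r : ℕ) :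
    BundleMap (jetBundle 𝓕 Γ (r + 1)).near (jetBundle 𝓕 (jetBundle 𝓕 Γ r) 1).near where
  toFun x := (nullJets 𝓕 Γ (r + 1) x).liftQ (iteratedJetAt 𝓕 Γ r x) (nullJets_succ_le hΓ r)
  smooth x σ hσ := by
    let P : ∀ y, Jet 𝓕 Γ (r + 1) y →ₗ[ℝ] Jet 𝓕 (jetBundle 𝓕 Γ r) 1 y :=
      fun y => (nullJets 𝓕 Γ (r + 1) y).liftQ (iteratedJetAt 𝓕 Γ r y) (nullJets_succ_le hΓ r)
    refine jetBundle_induction (p := fun σ => (fun y => P y (σ y)) ∈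
      (jetBundle 𝓕 (jetBundle 𝓕 Γ r) 1).near x) ?_ ?_ ?_ ?_ hσ
    · intro s t hs hst
      exact SmoothSections.congr _ x _ _ hs (hst.mono fun y hy => by simp only [hy])
    · have h0 : (fun y => P y ((0 : ∀ y, Jet 𝓕 Γ (r + 1) y) y)) = 0 :=
        funext fun y => map_zero (P y)
      rw [h0]
      exact zero_mem _
    · intro s t hs ht
      convert! add_mem hs ht using 1
      exact funext fun y => map_add (P y) (s y) (t y)
    · intro f s hf hs
      refine SmoothSections.congr _ x _ _ (SmoothSections.smul_mem _ x f _ hf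
        (jetSection_mem (jetSection_mem hs))) ?_
      filter_upwards [Γ.eventually x s hs] with y hy
      rw [map_smul, jetSection_of_mem hy, jetSection_of_mem (jetSection_mem hy)]
      rfl

theorem iteratedJetMap_jetAt (hΓ : IsVectorBundle I Γ.near) (r : ℕ) (s : Γ.near x) :
    (iteratedJetMap 𝓕 hΓ r).toFun x (jetAt 𝓕 Γ (r + 1) x s) = iteratedJetAt 𝓕 Γ r x s := rfl

theorem iteratedJetMap_injective (hΓ : IsVectorBundle I Γ.near) (hgen : 𝓕.GeneratedAt x) (r : ℕ) :
    Function.Injective ((iteratedJetMap 𝓕 hΓ r).toFun x) := by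
  rw [injective_iff_map_eq_zero]
  intro v hv
  obtain ⟨s, rfl⟩ := jetAt_surjective (r + 1) x v
  exact jetAt_eq_zero_iff.2 (ker_iteratedJetAt_le hΓ hgen r hv)

theorem range_iteratedJetMap (hΓ : IsVectorBundle I Γ.near) (r : ℕ) :
    LinearMap.range ((iteratedJetMap 𝓕 hΓ r).toFun x) =
      LinearMap.range (iteratedJetAt 𝓕 Γ r x) :=
  Submodule.range_liftQ _ _ _

/-- Every `1`-jet of a section of `Jʳ(V)` is the sum of the jet of a jet section and of a
symbol. -/
theorem range_iteratedJetAt_sup_range (hΓ : IsVectorBundle I Γ.near) (r : ℕ) :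
    LinearMap.range (iteratedJetAt 𝓕 Γ r x) ⊔
      LinearMap.range (symbolInclusion 𝓕 (jetBundle 𝓕 Γ r) x) = ⊤ := by
  rw [eq_top_iff]
  rintro v -
  obtain ⟨σ, rfl⟩ := jetAt_surjective 1 x v
  obtain ⟨s, hs⟩ := jetAt_surjective r x (σ.1 x)
  obtain ⟨n, e, he⟩ := (isVectorBundle_jetBundle 𝓕 hΓ r).exists_frame x
  -- By the choice of `s` the two sections of `Jʳ(V)` agree at `x`, so their difference has a symbol
  -- as its `1`-jet.
  have h1 : (σ - ⟨jetSection 𝓕 Γ r s.1, jetSection_mem s.2⟩ : (jetBundle 𝓕 Γ r).near x).1 x = 0 := by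
    change σ.1 x - jetSection 𝓕 Γ r s.1 x = 0
    rw [jetSection_of_mem s.2, ← hs, sub_self]
  refine Submodule.mem_sup.2 ⟨_, ⟨s, rfl⟩, _, jetAt_one_mem_range he h1, ?_⟩
  rw [map_sub]
  exact add_sub_cancel _ _

/-- A symbol which is the jet of a jet section comes from the kernel of `Jʳ⁺¹(V) → Jʳ(V)`. -/
theorem symbolKernel_eq (hΓ : IsVectorBundle I Γ.near) (r : ℕ) :
    symbolKernel 𝓕 Γ r x = (LinearMap.range (iteratedJetAt 𝓕 Γ r x)).comap
      (symbolInclusion 𝓕 (jetBundle 𝓕 Γ r) x) := by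
  refine le_antisymm (Submodule.comap_mono LinearMap.map_le_range) ?_
  rintro a ⟨s, hs⟩
  refine ⟨s, ?_, hs⟩
  obtain ⟨n, e, he⟩ := (isVectorBundle_jetBundle 𝓕 hΓ r).exists_frame x
  -- Projecting to `J⁰(Jʳ(V))` turns `j¹ₓ(jʳ s)` into `jʳₓ s`, while a value of `ι` projects to
  -- zero; hence `jʳₓ s = 0`.
  have h1 : iteratedJetAt 𝓕 Γ r x s ∈
      LinearMap.ker (jetProj 𝓕 (jetBundle 𝓕 Γ r) (zero_le_one : (0 : ℕ) ≤ 1) x) := by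
    rw [← range_symbolInclusion he, hs]
    exact ⟨a, rfl⟩
  have h2 : jetSection 𝓕 Γ r s.1 x = 0 :=
    (jetAt_zero_eq_zero_iff he).1 (LinearMap.mem_ker.1 h1)
  rw [jetSection_of_mem s.2] at h2
  exact jetAt_eq_zero_iff.1 h2

end IteratedJets

end

end WeightedJet

namespace WeightedJet

noncomputable section

/-! ### Linear algebra in a single fibre -/

section QuotientLinear

variable {P J S : Type*} [AddCommGroup P] [Module ℝ P] [AddCommGroup J] [Module ℝ J]
  [AddCommGroup S] [Module ℝ S] {p : P →ₗ[ℝ] J} {i : S →ₗ[ℝ] J}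

/-- If `J` is the sum of the images of `p` and `i`, the quotient of `J` by the image of `p` is a
quotient of the source of `i`. -/
theorem exists_quotient_map (hsup : LinearMap.range p ⊔ LinearMap.range i = ⊤)
    {N : Submodule ℝ S} (hN : N = (LinearMap.range p).comap i) :
    ∃ δ : J →ₗ[ℝ] S ⧸ N, LinearMap.ker δ = LinearMap.range p ∧ δ ∘ₗ i = N.mkQ := by
  subst hN
  let q := Submodule.mapQ ((LinearMap.range p).comap i) (LinearMap.range p) i le_rfl
  -- The second isomorphism theorem: injective because `N` is the full preimage, surjective because
  -- the two images span `J`.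
  have hq : Function.Bijective q := by
    constructor
    · rw [← LinearMap.ker_eq_bot, Submodule.ker_mapQ, Submodule.mkQ_map_self]
    · intro z
      obtain ⟨v, rfl⟩ := Submodule.mkQ_surjective _ z
      obtain ⟨a, ha, _, ⟨b, rfl⟩, rfl⟩ := Submodule.mem_sup.1 (hsup.ge (Submodule.mem_top (x := v)))
      refine ⟨Submodule.mkQ _ b, ?_⟩
      rw [map_add, show (LinearMap.range p).mkQ a = 0 from
        (Submodule.Quotient.mk_eq_zero _).2 ha, zero_add]
      rfl
  refine ⟨(LinearEquiv.ofBijective q hq).symm.toLinearMap ∘ₗ (LinearMap.range p).mkQ, ?_, ?_⟩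
  · rw [LinearEquiv.ker_comp, Submodule.ker_mkQ]
  · refine LinearMap.ext fun a => ?_
    exact (LinearEquiv.ofBijective q hq).symm_apply_apply (Submodule.mkQ _ a)

/-- Uniqueness of the operator: both maps vanish on the image of `p` and agree on the image of `i`,
and these two images span `J`. -/
theorem eq_of_comp_eq (hsup : LinearMap.range p ⊔ LinearMap.range i = ⊤) {Q : Type*}
    [AddCommGroup Q] [Module ℝ Q] {δ δ' : J →ₗ[ℝ] Q} (hδ : LinearMap.ker δ = LinearMap.range p)
    (hδ' : LinearMap.ker δ' = LinearMap.range p) (h : δ ∘ₗ i = δ' ∘ₗ i) : δ = δ' := by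
  refine LinearMap.ext fun v => ?_
  obtain ⟨a, ha, _, ⟨b, rfl⟩, rfl⟩ := Submodule.mem_sup.1 (hsup.ge (Submodule.mem_top (x := v)))
  rw [map_add, map_add, LinearMap.mem_ker.1 (hδ.ge ha), LinearMap.mem_ker.1 (hδ'.ge ha)]
  exact congrArg (fun φ => 0 + φ b) h

/-- A basis of the source of an injection `p` extends to a basis of `J` by vectors in the image of
`i`, if `J` is the sum of the images of `p` and `i`. -/
theorem exists_complement [FiniteDimensional ℝ J] (hp : Function.Injective p)
    (hsup : LinearMap.range p ⊔ LinearMap.range i = ⊤) {κ : Type*} {e : κ → P}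
    (hli : LinearIndependent ℝ e) (hspan : Submodule.span ℝ (range e) = ⊤) :
    ∃ (m : ℕ) (a : Fin m → S),
      LinearIndependent ℝ (Sum.elim (fun k => p (e k)) fun j => i (a j)) ∧
      Submodule.span ℝ (range (Sum.elim (fun k => p (e k)) fun j => i (a j))) = ⊤ := by
  let b := Module.finBasis ℝ (J ⧸ LinearMap.range p)
  -- Every class modulo the image of `p` has a representative in the image of `i`.
  have hb : ∀ j, ∃ a, (LinearMap.range p).mkQ (i a) = b j := fun j => by
    obtain ⟨v, hv⟩ := Submodule.mkQ_surjective _ (b j)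
    obtain ⟨u, hu, _, ⟨a, rfl⟩, rfl⟩ := Submodule.mem_sup.1 (hsup.ge (Submodule.mem_top (x := v)))
    refine ⟨a, hv ▸ ?_⟩
    rw [map_add, show (LinearMap.range p).mkQ u = 0 from
      (Submodule.Quotient.mk_eq_zero _).2 hu, zero_add]
  choose a ha using hb
  have hpe : Submodule.span ℝ (range fun k => p (e k)) = LinearMap.range p := by
    rw [LinearMap.range_eq_map, ← hspan, Submodule.map_span, ← range_comp]
    rfl
  refine ⟨_, a, ?_, ?_⟩
  · refine LinearIndependent.sumElim_of_quotient (M' := LinearMap.range p)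
      (f := fun k => ⟨p (e k), e k, rfl⟩) ?_ (fun j => i (a j)) ?_
    · refine LinearIndependent.of_comp (LinearMap.range p).subtype ?_
      exact hli.map' p (LinearMap.ker_eq_bot.2 hp)
    · convert! b.linearIndependent using 1
      exact funext ha
  · rw [Sum.elim_range, Submodule.span_union, hpe, eq_top_iff]
    rintro v -
    have hv := b.sum_repr ((LinearMap.range p).mkQ v)
    simp only [← ha, ← map_smul, ← map_sum] at hv
    refine Submodule.mem_sup.2 ⟨v - ∑ j, b.repr ((LinearMap.range p).mkQ v) j • i (a j), ?_,
      ∑ j, b.repr ((LinearMap.range p).mkQ v) j • i (a j), ?_, sub_add_cancel _ _⟩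
    · rw [← Submodule.Quotient.mk_eq_zero (LinearMap.range p)]
      change (LinearMap.range p).mkQ _ = 0
      simp only [map_smul, map_sum] at hv ⊢
      rw [map_sub, sub_eq_zero]
      simpa using hv.symm
    · exact Submodule.sum_mem _ fun j _ => Submodule.smul_mem _ _ (Submodule.subset_span ⟨j, rfl⟩)

end QuotientLinear

/-! ### The quotient bundle and its unique projection -/

section QuotientBundle

variable {E₀ : Type*} [NormedAddCommGroup E₀] [NormedSpace ℝ E₀]
  {H : Type*} [TopologicalSpace H] {I : ModelWithCorners ℝ E₀ H}
  {M : Type*} [TopologicalSpace M] [ChartedSpace H M]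
  {P J S : M → Type*} [∀ x, AddCommGroup (P x)] [∀ x, Module ℝ (P x)]
  [∀ x, AddCommGroup (J x)] [∀ x, Module ℝ (J x)] [∀ x, AddCommGroup (S x)] [∀ x, Module ℝ (S x)]
  {nP : M → Submodule ℝ (∀ y, P y)} {nJ : M → Submodule ℝ (∀ y, J y)}
  {nS : M → Submodule ℝ (∀ y, S y)}

theorem IsFrameAt.exists_mem {ι : Type*} [Fintype ι] {e : ι → ∀ y, S y} {y : M}
    (he : IsFrameAt I nS e y) (v : S y) : ∃ s ∈ nS y, s y = v :=
  ⟨fun z => ∑ i, frameCoord e i y v • e i z,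
    (he.mem_iff _).2 ⟨fun i _ => frameCoord e i y v, fun _ => SmoothNear.const _ y,
      Eventually.of_forall fun _ => rfl⟩, he.sum_frameCoord v⟩

variable (N : ∀ x, Submodule ℝ (S x))

/-- The smooth sections of the quotient of `S` by `N`. -/
def quotientSections (nS : M → Submodule ℝ (∀ y, S y)) (x : M) : Submodule ℝ (∀ y, S y ⧸ N y) :=
  locallySpanned {w | ∃ a ∈ nS x, w = fun y => (N y).mkQ (a y)} x

theorem isSheafLike_quotientSections (hS : IsSheafLike I nS) :
    IsSheafLike I (quotientSections N nS) := by
  refine isSheafLike_locallySpanned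
    (G := fun x => {w | ∃ a ∈ nS x, w = fun y => (N y).mkQ (a y)}) ?_ ?_
  · rintro x _ ⟨a, ha, rfl⟩
    filter_upwards [hS.eventually x a ha] with y hy
    exact ⟨a, hy, rfl⟩
  · rintro x f _ hf ⟨a, ha, rfl⟩
    exact ⟨_, hS.smul_mem x f a hf ha, rfl⟩

variable {N}

theorem mem_quotientSections {x : M} {a : ∀ y, S y} (ha : a ∈ nS x) :
    (fun y => (N y).mkQ (a y)) ∈ quotientSections N nS x :=
  ⟨_, Submodule.subset_span ⟨a, ha, rfl⟩, Eventually.of_forall fun _ => rfl⟩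

/-- The images of sections of `S` are already closed under linear combinations, so passing to the
span adds nothing. -/
theorem exists_of_mem_quotientSections {x : M} {w : ∀ y, S y ⧸ N y}
    (hw : w ∈ quotientSections N nS x) :
    ∃ a ∈ nS x, ∀ᶠ y in 𝓝 x, w y = (N y).mkQ (a y) := by
  obtain ⟨u, hu, h⟩ := hw
  suffices hu' : ∃ a ∈ nS x, u = fun y => (N y).mkQ (a y) by
    obtain ⟨a, ha, rfl⟩ := hu'
    exact ⟨a, ha, h⟩
  clear h
  induction hu using Submodule.span_induction with
  | mem u hu => exact hu
  | zero => exact ⟨0, zero_mem _, funext fun y => (map_zero (N y).mkQ).symm⟩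
  | add u v _ _ hu hv =>
    obtain ⟨a, ha, rfl⟩ := hu
    obtain ⟨b, hb, rfl⟩ := hv
    exact ⟨a + b, add_mem ha hb, rfl⟩
  | smul c u _ hu =>
    obtain ⟨a, ha, rfl⟩ := hu
    exact ⟨c • a, Submodule.smul_mem _ c ha, rfl⟩

variable (hP : IsVectorBundle I nP) (hJ : IsVectorBundle I nJ) (hS : IsVectorBundle I nS)
  (hJ' : IsSheafLike I nJ) (hS' : IsSheafLike I nS) (p : BundleMap nP nJ) (i : BundleMap nS nJ)
  (hp : ∀ x, Function.Injective (p.toFun x))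
  (hsup : ∀ x, LinearMap.range (p.toFun x) ⊔ LinearMap.range (i.toFun x) = ⊤)

include hP hJ hS hJ' hp hsup in
/-- Near every point `J` has a frame which consists of images under `p` and `i`. -/
theorem exists_sum_frame (x : M) : ∃ (n m : ℕ) (e : Fin n → ∀ y, P y) (a : Fin m → ∀ y, S y),
    (∀ j, a j ∈ nS x) ∧ ∀ᶠ y in 𝓝 x, IsFrameAt I nP e y ∧
      IsFrameAt I nJ (Sum.elim (fun k y => p.toFun y (e k y)) fun j y => i.toFun y (a j y)) y := by
  obtain ⟨n, e, he⟩ := hP.exists_frame x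
  obtain ⟨n', g, hg⟩ := hJ.exists_frame x
  obtain ⟨l, s, hs⟩ := hS.exists_frame x
  have hgx := hg.self_of_nhds
  have hex := he.self_of_nhds
  have : FiniteDimensional ℝ (J x) :=
    (Module.Basis.mk hgx.linearIndependent hgx.span_eq_top.ge).finiteDimensional_of_finite
  obtain ⟨m, v, hli, hspan⟩ := exists_complement (hp x) (hsup x) hex.linearIndependent
    hex.span_eq_top
  choose a ha hav using fun j => hs.self_of_nhds.exists_mem (v j)
  refine ⟨n, m, e, a, ha, he.and ?_⟩
  have heq : (fun b => Sum.elim (fun k y => p.toFun y (e k y)) (fun j y => i.toFun y (a j y)) b x) =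
      Sum.elim (fun k => p.toFun x (e k x)) fun j => i.toFun x (v j) := by
    funext b
    rcases b with k | j
    · rfl
    · simp [hav]
  refine isFrameAt_of_basis hJ' hg ?_ (heq ▸ hli) (heq ▸ hspan)
  rintro (k | j)
  · exact p.smooth x _ (hex.mem k)
  · exact i.smooth x _ (ha j)

include hP hJ hS hJ' hS' hp hsup in
/-- The quotient of `S` by the preimage of the image of `p` is a vector bundle, and it is in a
unique way a quotient of `J` by the image of `p`. -/
theorem existsUnique_quotient_bundleMap
    (hN : ∀ x, N x = (LinearMap.range (p.toFun x)).comap (i.toFun x)) :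
    IsVectorBundle I (quotientSections N nS) ∧
    ∃! δ : BundleMap nJ (quotientSections N nS),
      (∀ x, LinearMap.ker (δ.toFun x) = LinearMap.range (p.toFun x)) ∧
      ∀ x, δ.toFun x ∘ₗ i.toFun x = (N x).mkQ := by
  -- The map is first built fibrewise; smoothness is checked afterwards in the frames of
  -- `exists_sum_frame`, where `δ` deletes the part coming from `p`.
  choose δ hker hsymb using fun x => exists_quotient_map (hsup x) (hN x)
  have hδp : ∀ y u, δ y (p.toFun y u) = 0 := fun y u =>
    LinearMap.mem_ker.1 ((hker y).ge ⟨u, rfl⟩)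
  have hδi : ∀ y a, δ y (i.toFun y a) = (N y).mkQ a := fun y a =>
    congrArg (fun φ => φ a) (hsymb y)
  have hW := isSheafLike_quotientSections N hS'
  have expand : ∀ {n m : ℕ} {e : Fin n → ∀ y, P y} {a : Fin m → ∀ y, S y} {c : Fin n ⊕ Fin m → ℝ}
      (y : M), δ y (∑ b, c b • Sum.elim (fun k y => p.toFun y (e k y))
        (fun j y => i.toFun y (a j y)) b y) = ∑ j, c (Sum.inr j) • (N y).mkQ (a j y) := by
    intro n m e a c y
    rw [Fintype.sum_sum_type, map_add, map_sum, map_sum]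
    simp only [Sum.elim_inl, Sum.elim_inr, map_smul, hδp, hδi, smul_zero, Finset.sum_const_zero,
      zero_add]
  have key : ∀ x, ∀ σ ∈ nJ x, (fun y => δ y (σ y)) ∈ quotientSections N nS x := by
    intro x σ hσ
    obtain ⟨n, m, e, a, ha, h⟩ := exists_sum_frame hP hJ hS hJ' p i hp hsup x
    obtain ⟨c, hc, hcσ⟩ := (h.self_of_nhds.2.mem_iff σ).1 hσ
    refine hW.congr x _ _ (hW.sum_smul_mem Finset.univ (fun j _ => hc (Sum.inr j))
      fun j _ => mem_quotientSections (ha j)) ?_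
    filter_upwards [hcσ] with y hy
    rw [hy, expand]
  refine ⟨isVectorBundle_of_frames fun x => ?_, ⟨δ, key⟩, ⟨hker, hsymb⟩, ?_⟩
  · obtain ⟨n, m, e, a, ha, h⟩ := exists_sum_frame hP hJ hS hJ' p i hp hsup x
    refine ⟨Fin m, inferInstance, fun j y => (N y).mkQ (a j y), ?_⟩
    have ha' : ∀ᶠ y in 𝓝 x, ∀ j, a j ∈ nS y :=
      eventually_all.2 fun j => hS'.eventually x _ (ha j)
    filter_upwards [h, ha'] with y hy hay
    refine ⟨Fintype.linearIndependent_iff.2 fun c hc j => ?_, ?_, fun w => ⟨fun hw => ?_, ?_⟩⟩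
    -- A relation in the quotient says that a combination of the `i`-images is some `p u`. Expanding
    -- `u` in `e` gives a relation in the frame of `J`, so all coefficients vanish.
    · have h1 : δ y (∑ j, c j • i.toFun y (a j y)) = 0 := by
        simpa only [map_sum, map_smul, hδi] using hc
      obtain ⟨u, hu⟩ := (hker y).le (LinearMap.mem_ker.2 h1)
      have h2 := Fintype.linearIndependent_iff.1 hy.2.linearIndependent
        (Sum.elim (fun k => -frameCoord e k y u) c) (by
          rw [Fintype.sum_sum_type]
          simp only [Sum.elim_inl, Sum.elim_inr, neg_smul, Finset.sum_neg_distrib]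
          rw [← hu]
          conv_lhs => rw [← hy.1.sum_frameCoord u]
          simp [hy.1.frameCoord_sum]) (Sum.inr j)
      exact h2
    · rw [eq_top_iff]
      rintro z -
      obtain ⟨b, rfl⟩ := Submodule.mkQ_surjective _ z
      rw [← hδi, ← hy.2.sum_frameCoord (i.toFun y b), expand]
      exact Submodule.sum_mem _ fun j _ => Submodule.smul_mem _ _ (Submodule.subset_span ⟨j, rfl⟩)
    · obtain ⟨b, hb, hbw⟩ := exists_of_mem_quotientSections hw
      obtain ⟨c, hc, hcb⟩ := (hy.2.mem_iff _).1 (i.smooth y b hb)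
      refine ⟨fun j => c (Sum.inr j), fun j => hc _, ?_⟩
      filter_upwards [hbw, hcb] with z h1 h2
      rw [h1, ← hδi, h2, expand]
    · rintro ⟨c, hc, hcw⟩
      exact hW.congr y _ _ (hW.sum_smul_mem Finset.univ (fun j _ => hc j)
        fun j _ => mem_quotientSections (hay j)) hcw
  · rintro ⟨δ', hδ'⟩ ⟨h1, h2⟩
    congr 1
    exact funext fun x => eq_of_comp_eq (hsup x) (h1 x) (hker x) ((h2 x).trans (hsymb x).symm)

end QuotientBundle

end

end WeightedJet

/-! ### The proposition -/

open WeightedJet in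
theorem proposition1
    {E₀ : Type*} [NormedAddCommGroup E₀] [NormedSpace ℝ E₀] [FiniteDimensional ℝ E₀]
    {H : Type*} [TopologicalSpace H] (I : ModelWithCorners ℝ E₀ H) [I.Boundaryless]
    (M : Type*) [TopologicalSpace M] [ChartedSpace H M] [IsManifold I ∞ M]
    -- the filtered manifold structure, with symbol algebras generated in degree `-1`
    (𝓕 : Filtration I M) (hgen : ∀ x, 𝓕.GeneratedAt x)
    -- the vector bundle `E`
    (F : Type*) [NormedAddCommGroup F] [NormedSpace ℝ F] [FiniteDimensional ℝ F]
    (E : M → Type*) [TopologicalSpace (TotalSpace F E)] [∀ x, AddCommGroup (E x)]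
    [∀ x, Module ℝ (E x)] [∀ x, TopologicalSpace (E x)] [FiberBundle F E] [VectorBundle ℝ F E]
    [ContMDiffVectorBundle ∞ F E I] (r : ℕ) :
    -- the objects in the statement are smooth vector bundles
    IsVectorBundle I (jetBundle 𝓕 (bundleSections I F E) (r + 1)).near ∧
    IsVectorBundle I (jetBundle 𝓕 (bundleSections I F E) r).near ∧
    IsVectorBundle I (jetBundle 𝓕 (jetBundle 𝓕 (bundleSections I F E) r) 1).near ∧
    IsVectorBundle I (covectorSections 𝓕 (jetBundle 𝓕 (bundleSections I F E) r)) ∧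
    IsVectorBundle I (wSections 𝓕 (bundleSections I F E) r) ∧
    -- `ι` identifies `gr₋₁(TM)* ⊗ Jʳ(E)` with the kernel of `π¹₀ : J¹(Jʳ(E)) → J⁰(Jʳ(E)) = Jʳ(E)`
    (∀ x, Function.Injective (symbolInclusion 𝓕 (jetBundle 𝓕 (bundleSections I F E) r) x) ∧
      LinearMap.range (symbolInclusion 𝓕 (jetBundle 𝓕 (bundleSections I F E) r) x) =
        LinearMap.ker (jetProj 𝓕 (jetBundle 𝓕 (bundleSections I F E) r)
          (zero_le_one : (0 : ℕ) ≤ 1) x)) ∧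
    -- the embedding `p = p₁(id_r)`, determined by `p(jʳ⁺¹ₓ s) = j¹ₓ(jʳ s)`
    ∃ p : BundleMap (jetBundle 𝓕 (bundleSections I F E) (r + 1)).near
        (jetBundle 𝓕 (jetBundle 𝓕 (bundleSections I F E) r) 1).near,
      (∀ x (s : (bundleSections I F E).near x),
        p.toFun x (jetAt 𝓕 (bundleSections I F E) (r + 1) x s) =
          iteratedJetAt 𝓕 (bundleSections I F E) r x s) ∧
      (∀ x, Function.Injective (p.toFun x)) ∧
      -- the operator `δʳ`, with its kernel and its symbol
      ∃! δ : BundleMap (jetBundle 𝓕 (jetBundle 𝓕 (bundleSections I F E) r) 1).near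
          (wSections 𝓕 (bundleSections I F E) r),
        (∀ x, LinearMap.ker (δ.toFun x) = LinearMap.range (p.toFun x)) ∧
        ∀ x, δ.toFun x ∘ₗ symbolInclusion 𝓕 (jetBundle 𝓕 (bundleSections I F E) r) x =
          (symbolKernel 𝓕 (bundleSections I F E) r x).mkQ := by
  have hE := isVectorBundle_bundleSections I F E
  have hJ := isVectorBundle_jetBundle 𝓕 hE r
  have hJJ := isVectorBundle_jetBundle 𝓕 hJ 1
  have hsup := fun x => (congrArg (· ⊔ _) (range_iteratedJetMap (𝓕 := 𝓕) (x := x) hE r)).trans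
    (range_iteratedJetAt_sup_range hE r)
  -- `wSections` unfolds to `quotientSections` for the family `symbolKernel`, and `symbolKernel_eq`
  -- identifies that family with the preimage of the whole image of the embedding.
  obtain ⟨hW, hδ⟩ := existsUnique_quotient_bundleMap (N := symbolKernel 𝓕 (bundleSections I F E) r)
    (isVectorBundle_jetBundle 𝓕 hE (r + 1)) hJJ (isVectorBundle_covectorSections 𝓕 hJ)
    (SmoothSections.isSheafLike _) (isSheafLike_covectorSections 𝓕 _) (iteratedJetMap 𝓕 hE r)
    ⟨symbolInclusion 𝓕 (jetBundle 𝓕 (bundleSections I F E) r),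
      fun x a ha => symbolInclusion_smooth hJ ha⟩
    (fun x => iteratedJetMap_injective hE (hgen x) r) hsup
    (fun x => (symbolKernel_eq hE r).trans
      (congrArg (Submodule.comap _) (range_iteratedJetMap hE r).symm))
  refine ⟨isVectorBundle_jetBundle 𝓕 hE (r + 1), hJ, hJJ, isVectorBundle_covectorSections 𝓕 hJ,
    hW, fun x => ?_, iteratedJetMap 𝓕 hE r, fun x s => iteratedJetMap_jetAt hE r s,
    fun x => iteratedJetMap_injective hE (hgen x) r, hδ⟩
  obtain ⟨n, e, he⟩ := hJ.exists_frame x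
  exact ⟨symbolInclusion_injective he, range_symbolInclusion he⟩
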